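/- **Theorem 1.3.** Notation. Let $A(\xi)=\sum_{|\alpha|=2l}a_\alpha\xi^\alpha$, $l\ge 1$, be a homogeneous polynomial on $\mathbb{R}^N$ with real coefficients and $A(\xi)>0$ for $\xi\ne0$, and let $A(D)=\sum_{|\alpha|=2l}a_\alpha D^\alpha$ with $D_j=-i\,\partial/\partial x_j$. For $0<\rho<1$ let $D_t^\rho h(t)=\frac1{\Gamma(1-\rho)}\int_0^t (t-s)^{-\rho}h'(s)\,ds$ be the Caputo derivative, and let $E_\rho(z)=\sum_{k\ge0}z^k/\Gamma(\rho k+1)$. For $f\in L_2(\mathbb{R}^N)$ let $\hat f(\xi)=(2\pi)^{-N}\int f(x)e^{-ix\xi}dx$ (in the sense of Plancherel); we say that $\hat f(\xi_0)$ exists and equals $c$ if $\xi_0$ is a Lebesgue point of $\hat f$ with value $c$, i.e. the mean of $|\hat f-c|$ over the ball of radius $r$ about $\xi_0$ tends to $0$ as $r\to0$. $L_2^\tau(\mathbb{R}^N)$ is the set of $f\in L_2(\mathbb{R}^N)$ with $\int(1+|\xi|^2)^\tau|\hat f(\xi)|^2d\xi<\infty$. Forward problem. Given $T>0$, $\rho\in(0,1)$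 and a continuous $\varphi:\mathbb{R}^N\to\mathbb{C}$, a solution is a function $u:\mathbb{R}^N\times[0,T]\to\mathbb{C}$ such that * for every $x$, $u(x,\cdot)$ is continuous on $[0,T]$ and differentiable on $(0,T)$, and the integral defining $D_t^\rho u(x,t)$ converges absolutely for $0<t\le T$; $u(\cdot,t)\in C^{2l}(\mathbb{R}^N)$ for $0<t\le T$; $D_t^\rho u$ and $A(D)u$ are continuous on $\mathbb{R}^N\times(0,T]$; * $D_t^\rho u+A(D)u=0$ on $\mathbb{R}^N\times(0,T]$, and $u(x,0)=\varphi(x)$ for all $x$; * for every $t\in(0,T]$: $D^\alpha u(x,t)\to0$ as $|x|\to\infty$ for $|\alpha|\le 2l-1$, $D^\alpha u(\cdot,t)\in L_2(\mathbb{R}^N)$ for $|\alpha|\le 2l$, and $\hat u(\cdot,t)\in L_1(\mathbb{R}^N)$; moreover $\sup_{0<t\le T}\|u(\cdot,t)\|_{L_2(\mathbb{R}^N)}<\infty$. Statement. For all $\lambda_0>0$ and $\rho_0\in(0,1)$ there is a number $T_0=T_0(\lambda_0,\rho_0)>0$ with the following property. Let $N$, $l$, $A$ be as above, let $\tau>N/2$,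 let $\varphi\in L_2^\tau(\mathbb{R}^N)$ be continuous, let $\xi_0\ne0$ be such that $A(\xi_0)=\lambda_0$ and $\hat\varphi(\xi_0)$ exists and is nonzero, let $T_0\le t_0\le T$ and $d_0\in\mathbb{R}$. Consider the inverse problem of finding a pair $\{u,\rho\}$ with $\rho\in[\rho_0,1)$ such that $u$ solves the forward problem with order $\rho$, $\hat u(\xi_0,t_0)$ exists, and $|\hat u(\xi_0,t_0)|=d_0$. The inverse problem has a unique solution $\{u,\rho\}$ if and only if $$e^{-\lambda_0t_0}<\frac{d_0}{|\hat\varphi(\xi_0)|}\le E_{\rho_0}\bigl(-\lambda_0t_0^{\rho_0}\bigr).$$ -/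

import Mathlib

open MeasureTheory Set Filter Topology
open scoped FourierTransform

noncomputable section

namespace Subdiffusion

/-- `ℝ^N` with its Euclidean norm. -/
abbrev RN (N : ℕ) : Type := EuclideanSpace ℝ (Fin N)

/-- The Mittag-Leffler function `E_ρ(z) = ∑ z^k / Γ(ρ k + 1)` of a real argument. -/
def mittagLeffler (ρ z : ℝ) : ℝ :=
  ∑' k : ℕ, z ^ k / Real.Gamma (ρ * k + 1)

/-! ### The Caputo derivative -/

/-- The Caputo derivative of order `ρ ∈ (0, 1)`: the Riemann-Liouville integral of order `1 - ρ`
of the ordinary derivative. -/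
def caputoDeriv (ρ : ℝ) (h : ℝ → ℂ) (t : ℝ) : ℂ :=
  (1 / Real.Gamma (1 - ρ)) • ∫ s in (0 : ℝ)..t, ((t - s) ^ (-ρ)) • deriv h s

/-- The Caputo derivative of order `ρ` of `h : [0, T] → ℂ` exists on `(0, T]`: `h` is continuous on
`[0, T]`, differentiable on `(0, T)`, and the integral in `caputoDeriv` converges absolutely for
every `t ∈ (0, T]`. -/
structure CaputoDifferentiable (ρ T : ℝ) (h : ℝ → ℂ) : Prop where
  continuousOn : ContinuousOn h (Icc 0 T)
  differentiableAt : ∀ t ∈ Ioo 0 T, DifferentiableAt ℝ h t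
  intervalIntegrable : ∀ t ∈ Ioc 0 T,
    IntervalIntegrable (fun s => ((t - s) ^ (-ρ)) • deriv h s) volume 0 t

/-! ### Differential operators in the space variable -/

/-- `∂f / ∂x_j`. -/
def coordDeriv {N : ℕ} (j : Fin N) (f : RN N → ℂ) : RN N → ℂ :=
  fun x => lineDeriv ℝ f x (EuclideanSpace.single j 1)

/-- `∂^α f = ∂_1^{α_1} ⋯ ∂_N^{α_N} f` for a multi-index `α`. -/
def partialDeriv {N : ℕ} (α : Fin N →₀ ℕ) (f : RN N → ℂ) : RN N → ℂ :=
  (List.finRange N).foldr (fun j g => (coordDeriv j)^[α j] g) f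

/-- The order `|α|` of a multi-index. -/
def order {N : ℕ} (α : Fin N →₀ ℕ) : ℕ := ∑ j, α j

/-- `D^α f`, where `D_j = -i ∂_j`, so that `D^α e^{i x ξ} = ξ^α e^{i x ξ}`. -/
def multiD {N : ℕ} (α : Fin N →₀ ℕ) (f : RN N → ℂ) : RN N → ℂ :=
  fun x => (-Complex.I) ^ order α * partialDeriv α f x

/-- The value `A(ξ)` of a polynomial at a vector. -/
def symbol {N : ℕ} (A : MvPolynomial (Fin N) ℝ) (ξ : RN N) : ℝ :=
  MvPolynomial.eval (fun j => ξ j) A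

/-- `A(D) f = ∑ a_α D^α f` for the polynomial `A = ∑ a_α X^α`. -/
def diffOp {N : ℕ} (A : MvPolynomial (Fin N) ℝ) (f : RN N → ℂ) : RN N → ℂ :=
  fun x => ∑ α ∈ A.support, ((A.coeff α : ℝ) : ℂ) * multiD α f x

/-- `A` is the symbol of a homogeneous elliptic differential expression of even order `2 l`, with
real constant coefficients (hence symmetric): `A(ξ) > 0` for `ξ ≠ 0`. -/
structure IsEllipticSymbol {N : ℕ} (A : MvPolynomial (Fin N) ℝ) (l : ℕ) : Prop where
  order_pos : 0 < l
  homogeneous : A.IsHomogeneous (2 * l)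
  pos : ∀ ξ : RN N, ξ ≠ 0 → 0 < symbol A ξ

/-! ### The Fourier transform on `L_2` and the Sobolev class -/

/-- The Fourier transform `f̂(ξ) = (2π)^{-N} ∫ f(x) e^{-i x ξ} dx` of a function `f ∈ L_2(ℝ^N)`
(Plancherel's extension). Mathlib's transform `𝓕` has the kernel `e^{-2 π i x ξ}` and no constant
in front of the integral. -/
def fourierL2 {N : ℕ} (f : RN N → ℂ) (hf : MemLp f 2 (volume : Measure (RN N))) : RN N → ℂ :=
  fun ξ => (((2 * Real.pi) ^ N)⁻¹ : ℝ) •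
    (𝓕 (hf.toLp f) : Lp ℂ 2 (volume : Measure (RN N))) ((2 * Real.pi)⁻¹ • ξ)

/-- The function `f`, which is defined up to null sets, has the value `c` at the point `ξ`: `ξ` is
a Lebesgue point of `f` with value `c`. If `f` is locally integrable this determines `c`, does not
depend on the representative, holds with `c = f ξ` for almost every `ξ`, and holds with `c = f ξ`
wherever `f` is continuous. -/
def HasValueAt {N : ℕ} (f : RN N → ℂ) (ξ : RN N) (c : ℂ) : Prop :=
  Tendsto (fun r : ℝ => ⨍ η in Metric.ball ξ r, ‖f η - c‖) (𝓝[>] 0) (𝓝 0)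

/-- The Sobolev class `L_2^τ(ℝ^N)`: `f ∈ L_2` and `∫ (1 + |ξ|²)^τ |f̂(ξ)|² dξ < ∞`. -/
def MemSobolevL2 {N : ℕ} (τ : ℝ) (f : RN N → ℂ) : Prop :=
  ∃ hf : MemLp f 2 (volume : Measure (RN N)),
    Integrable (fun ξ : RN N => (1 + ‖ξ‖ ^ 2) ^ τ * ‖fourierL2 f hf ξ‖ ^ 2) volume

/-! ### The forward problem and the inverse problem -/

/-- `u` is a classical solution on `ℝ^N × [0, T]` of the forward problem
`D_t^ρ u + A(D) u = 0`, `D^α u → 0` as `|x| → ∞` for `|α| ≤ l - 1`, `u(x, 0) = φ(x)`.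
Values `u x t` with `t ∉ [0, T]` are irrelevant. -/
structure IsClassicalSolution {N : ℕ} (A : MvPolynomial (Fin N) ℝ) (l : ℕ) (T ρ : ℝ)
    (φ : RN N → ℂ) (u : RN N → ℝ → ℂ) : Prop where
  caputo_exists : ∀ x, CaputoDifferentiable ρ T (u x)
  contDiff : ∀ t ∈ Ioc 0 T, ContDiff ℝ ((2 * l : ℕ) : WithTop ℕ∞) (fun x => u x t)
  continuousOn_caputo :
    ContinuousOn (fun p : RN N × ℝ => caputoDeriv ρ (u p.1) p.2) (univ ×ˢ Ioc 0 T)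
  continuousOn_diffOp :
    ContinuousOn (fun p : RN N × ℝ => diffOp A (fun x => u x p.2) p.1) (univ ×ˢ Ioc 0 T)
  equation : ∀ x, ∀ t ∈ Ioc 0 T, caputoDeriv ρ (u x) t + diffOp A (fun y => u y t) x = 0
  boundary : ∀ t ∈ Ioc 0 T, ∀ α : Fin N →₀ ℕ, order α < l →
    Tendsto (multiD α (fun x => u x t)) (cocompact (RN N)) (𝓝 0)
  initial : ∀ x, u x 0 = φ x

/-- The class of functions in which the forward problem is solved: for every `t ∈ (0, T]`,
`D^α u → 0` at infinity for `l ≤ |α| ≤ 2 l - 1`, `D^α u ∈ L_2` for `|α| ≤ 2 l`, `û ∈ L_1`; and the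
`L_2` norm of `u(·, t)` is bounded on `(0, T]`. -/
structure IsRegular {N : ℕ} (l : ℕ) (T : ℝ) (u : RN N → ℝ → ℂ) : Prop where
  decay : ∀ t ∈ Ioc 0 T, ∀ α : Fin N →₀ ℕ, l ≤ order α → order α < 2 * l →
    Tendsto (multiD α (fun x => u x t)) (cocompact (RN N)) (𝓝 0)
  memLp : ∀ t ∈ Ioc 0 T, ∀ α : Fin N →₀ ℕ, order α ≤ 2 * l →
    MemLp (multiD α (fun x => u x t)) 2 volume
  fourier_integrable : ∀ t ∈ Ioc 0 T, ∃ hu : MemLp (fun x => u x t) 2 volume,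
    Integrable (fourierL2 (fun x => u x t) hu) volume
  bounded : ∃ C : ℝ, ∀ t ∈ Ioc 0 T, eLpNorm (fun x => u x t) 2 volume ≤ ENNReal.ofReal C

/-- `{u, ρ}` is a solution of the inverse problem with orders `ρ ∈ [ρ₀, 1)` and the datum
`|û(ξ₀, t₀)| = d₀`. -/
structure IsInverseSolution {N : ℕ} (A : MvPolynomial (Fin N) ℝ) (l : ℕ) (T ρ₀ : ℝ)
    (φ : RN N → ℂ) (ξ₀ : RN N) (t₀ d₀ : ℝ) (u : RN N → ℝ → ℂ) (ρ : ℝ) : Prop where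
  order_mem : ρ ∈ Ico ρ₀ 1
  classical : IsClassicalSolution A l T ρ φ u
  regular : IsRegular l T u
  datum : ∃ hu : MemLp (fun x => u x t₀) 2 volume, ∃ v : ℂ,
    HasValueAt (fourierL2 (fun x => u x t₀) hu) ξ₀ v ∧ ‖v‖ = d₀

/-- The inverse problem has exactly one solution `{u, ρ}`, where `u` is a function on
`ℝ^N × [0, T]`. -/
def HasUniqueInverseSolution {N : ℕ} (A : MvPolynomial (Fin N) ℝ) (l : ℕ) (T ρ₀ : ℝ)
    (φ : RN N → ℂ) (ξ₀ : RN N) (t₀ d₀ : ℝ) : Prop :=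
  (∃ u ρ, IsInverseSolution A l T ρ₀ φ ξ₀ t₀ d₀ u ρ) ∧
    ∀ u₁ ρ₁ u₂ ρ₂, IsInverseSolution A l T ρ₀ φ ξ₀ t₀ d₀ u₁ ρ₁ →
      IsInverseSolution A l T ρ₀ φ ξ₀ t₀ d₀ u₂ ρ₂ →
      ρ₁ = ρ₂ ∧ ∀ x, ∀ t ∈ Icc 0 T, u₁ x t = u₂ x t

end Subdiffusion

end

open Subdiffusion

/-! The Fourier transform diagonalises the equation: at frequency ξ it reads D_t^ρ y + A(ξ) y = 0,
whose solution is E_ρ(-A(ξ) t^ρ) y(0). Hence û(ξ, t) = E_ρ(-A(ξ) t^ρ) φ̂(ξ), and since the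
multiplier is continuous in ξ, Lebesgue points of φ̂ are Lebesgue points of û(·, t). The datum at
(ξ₀, t₀) therefore becomes the scalar equation |E_ρ(-λ₀ t₀^ρ)| = d₀ / |φ̂(ξ₀)| for ρ alone. If ρ ↦
E_ρ(-λ₀ t₀^ρ) is continuous and strictly decreasing on [ρ₀, 1], then on [ρ₀, 1) it takes, once each,
exactly the values above E_1(-λ₀ t₀) = e^{-λ₀ t₀} and up to the value at ρ₀; it is also positive
there, so the absolute value disappears. Together with unique solvability of the forward problem
this is the theorem.

Monotonicity (`exists_strictAntiOn_mittagLeffler`). Hankel's contour gives 2πi E_ρ(-z) as the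
integral of e^ζ ζ^{ρ-1} / (ζ^ρ + z) dζ. With ζ = e^w the contour consists of horizontal lines at
heights ± 2π/3 and the integrand is exp(e^w) p / (p + z), p = e^{ρw} (`mittagLeffler_eq_rayDiff`).
Splitting off the leading term gives λ E_ρ(-λ t^ρ) = t^{-ρ} / Γ(1-ρ) - remainder
(`mittagLeffler_eq_mlOrder`). Convexity of Γ bounds the ρ-derivative of the leading term above by -ρ
t^{-ρ}, uniformly up to ρ = 1; that of the remainder is O((1 + log t) t^{-2ρ} / λ), which is smaller
for large t (`exists_hasDerivAt_mlOrder`). The angle 2π/3 exceeds π/2, so exp(e^w) decays along the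
rays, yet is small enough that p + z has no zeros for ρ ≤ 5/4. This leaves room to differentiate at
ρ = 1 from both sides.

Existence (`exists_forward_solution`). The solution is the inverse Fourier integral of E_ρ(-A t^ρ)
φ̂. Since τ > N/2, A^δ φ̂ is integrable for some small δ > 0. The bound |∂_t E_ρ(-λ t^ρ)| ≤ C λ^δ
t^{ρδ-1} then allows the Caputo derivative to pass under the integral, while λ t^ρ |E_ρ(-λ t^ρ)| ≤ C
provides 2l space derivatives for every t > 0.

Uniqueness (`forward_solution_unique`). Let w be the difference of two solutions. Testing in x and
integrating once in time gives a weak equation that uses only L_2 bounds near t = 0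
(`weak_identity`). Test functions with compactly supported transform χ are then admissible, and the
time integral of the pairing with χ equals (-1)^n times a fractional integral, of order ρn + 1, of
the pairing with A^n χ. On the support of χ the symbol is bounded, by Λ say, so this is O((Λ t^ρ)^n
/ Γ(ρn + 2)), which tends to zero (`integral_pairing_fourierInv_eq_zero`). -/

noncomputable section

namespace Subdiffusion

/-! ### A Hankel contour in logarithmic coordinates -/

open Complex in
/-- The half-opening `2π/3` of the Hankel contour. -/
def ang : ℝ := 2 * Real.pi / 3

lemma ang_pos : 0 < ang := by unfold ang; positivity

lemma ang_le : ang ≤ 3 := by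
  unfold ang; have := Real.pi_lt_d2; linarith

lemma cos_ang : Real.cos ang = -1 / 2 := by
  have : ang = Real.pi - Real.pi / 3 := by unfold ang; ring
  rw [this, Real.cos_pi_sub, Real.cos_pi_div_three]; norm_num

/-- The points at height `± 2π/3`. -/
def IsRay (y : ℝ) : Prop := y = ang ∨ y = -ang

lemma IsRay.cos_eq {y : ℝ} (h : IsRay y) : Real.cos y = -1 / 2 := by
  rcases h with rfl | rfl
  · exact cos_ang
  · rw [Real.cos_neg]; exact cos_ang

lemma IsRay.abs_eq {y : ℝ} (h : IsRay y) : |y| = ang := by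
  rcases h with rfl | rfl
  · exact abs_of_pos ang_pos
  · rw [abs_neg]; exact abs_of_pos ang_pos

lemma norm_exp_exp (x y : ℝ) :
    ‖Complex.exp (Complex.exp (x + y * Complex.I))‖ = Real.exp (Real.exp x * Real.cos y) := by
  rw [Complex.norm_exp, Complex.exp_re]; simp

lemma IsRay.norm_exp_exp {y : ℝ} (h : IsRay y) (x : ℝ) :
    ‖Complex.exp (Complex.exp (x + y * Complex.I))‖ = Real.exp (-Real.exp x / 2) := by
  rw [Subdiffusion.norm_exp_exp, h.cos_eq]; congr 1; ring

/-- The substitution r = e^x gives r^{m-1} e^{-r/2} on (0, ∞), a Gamma integral; m > 0 is needed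
only at the end x → -∞. -/
lemma integrable_exp_mul_weight {m : ℝ} (hm : 0 < m) :
    Integrable (fun x : ℝ => Real.exp (m * x) * Real.exp (-Real.exp x / 2)) := by
  have h := integrableOn_image_iff_integrableOn_abs_deriv_smul (f := Real.exp) (f' := Real.exp)
      (s := univ) MeasurableSet.univ (fun x _ => (Real.hasDerivAt_exp x).hasDerivWithinAt)
      (Real.exp_injective.injOn) (fun r : ℝ => r ^ (m - 1) * Real.exp (-(1 / 2) * r))
  rw [image_univ, Real.range_exp] at h
  have h2 : IntegrableOn (fun r : ℝ => r ^ (m - 1) * Real.exp (-(1 / 2) * r)) (Ioi 0) := by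
    have := integrableOn_rpow_mul_exp_neg_mul_rpow (p := 1) (s := m - 1) (b := 1 / 2)
      (by linarith) one_pos (by norm_num)
    simpa using this
  have h3 := h.1 h2
  rw [integrableOn_univ] at h3
  refine h3.congr (Eventually.of_forall fun x => ?_)
  simp only [smul_eq_mul]
  rw [abs_of_pos (Real.exp_pos _), ← Real.exp_mul, ← mul_assoc, ← Real.exp_add]
  congr 2 <;> ring

/-- On a right half line any exponent is allowed: for x > a the factor e^{mx} is at most a constant
times e^{(|m|+1)x}, which has a positive exponent. -/
lemma integrableOn_exp_mul_weight (m a : ℝ) :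
    IntegrableOn (fun x : ℝ => Real.exp (m * x) * Real.exp (-Real.exp x / 2)) (Ioi a) := by
  have h := ((integrable_exp_mul_weight (m := |m| + 1) (by positivity)).const_mul
    (Real.exp ((m - (|m| + 1)) * a))).integrableOn (s := Ioi a)
  refine h.mono' (by fun_prop) ?_
  filter_upwards [ae_restrict_mem measurableSet_Ioi] with x hx
  rw [Real.norm_eq_abs, abs_of_pos (by positivity), ← mul_assoc]
  have h1 : m - (|m| + 1) ≤ 0 := by linarith [le_abs_self m]
  refine mul_le_mul_of_nonneg_right ?_ (Real.exp_pos _).le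
  rw [← Real.exp_add]
  refine Real.exp_le_exp.2 ?_
  nlinarith [mul_le_mul_of_nonpos_left (le_of_lt hx : a ≤ x) h1]

/-- The line at height `y`. -/
def lineAt (y x : ℝ) : ℂ := x + y * Complex.I

lemma continuous_lineAt (y : ℝ) : Continuous (lineAt y) := by unfold lineAt; fun_prop

@[simp] lemma lineAt_re (y x : ℝ) : (lineAt y x).re = x := by simp [lineAt]
@[simp] lemma lineAt_im (y x : ℝ) : (lineAt y x).im = y := by simp [lineAt]

/-- The strip swept by the contours that start at abscissas at least `a`. -/
def Strip (a : ℝ) : Set ℂ := {w | a ≤ w.re ∧ |w.im| ≤ ang}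

lemma IsRay.lineAt_mem {y : ℝ} (h : IsRay y) {a x : ℝ} (hx : a ≤ x) : lineAt y x ∈ Strip a := by
  simp [Strip, hx, h.abs_eq]

/-- The integrand `exp (e^w) q(w)`. -/
def kern (q : ℂ → ℂ) (w : ℂ) : ℂ := Complex.exp (Complex.exp w) * q w

lemma IsRay.norm_kern {y : ℝ} (h : IsRay y) (q : ℂ → ℂ) (x : ℝ) :
    ‖kern q (lineAt y x)‖ = Real.exp (-Real.exp x / 2) * ‖q (lineAt y x)‖ := by
  rw [kern, norm_mul, lineAt, h.norm_exp_exp]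

lemma norm_kern_le (q : ℂ → ℂ) (w : ℂ) :
    ‖kern q w‖ ≤ Real.exp (Real.exp w.re) * ‖q w‖ := by
  rw [kern, norm_mul, Complex.norm_exp, Complex.exp_re]
  gcongr
  have := Real.cos_le_one w.im
  nlinarith [Real.exp_pos w.re]

/-- The integral along the contour made of the two horizontal half lines at heights `± 2π/3` to the
right of `a` and the vertical segment between them. -/
def hankel (Q : ℂ → ℂ) (a : ℝ) : ℂ :=
  Complex.I * (∫ y in (-ang)..ang, Q (lineAt y a)) +
    ((∫ x in Ioi a, Q (lineAt ang x)) - ∫ x in Ioi a, Q (lineAt (-ang) x))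

/-- The integral along the two full horizontal lines at heights `± 2π/3`. -/
def rayDiff (Q : ℂ → ℂ) : ℂ := (∫ x, Q (lineAt ang x)) - ∫ x, Q (lineAt (-ang) x)

lemma isRay_ang : IsRay ang := Or.inl rfl
lemma isRay_neg_ang : IsRay (-ang) := Or.inr rfl

lemma continuousOn_kern {q : ℂ → ℂ} {s : Set ℂ} (hq : ContinuousOn q s) :
    ContinuousOn (kern q) s := by
  unfold kern
  exact (Complex.continuous_exp.comp Complex.continuous_exp).continuousOn.mul hq

lemma differentiableOn_kern {q : ℂ → ℂ} {s : Set ℂ} (hq : DifferentiableOn ℂ q s) :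
    DifferentiableOn ℂ (kern q) s :=
  (Complex.differentiable_exp.comp Complex.differentiable_exp).differentiableOn.mul hq

lemma IsRay.integrableOn_kern {y : ℝ} (h : IsRay y) {q : ℂ → ℂ} {m C a : ℝ}
    (hq : ContinuousOn q (Strip a))
    (hb : ∀ w ∈ Strip a, ‖q w‖ ≤ C * Real.exp (m * w.re)) :
    IntegrableOn (fun x => kern q (lineAt y x)) (Ioi a) := by
  refine ((integrableOn_exp_mul_weight m a).const_mul C).mono' ?_ ?_
  · refine ContinuousOn.aestronglyMeasurable ?_ measurableSet_Ioi
    exact (continuousOn_kern hq).comp (continuous_lineAt y).continuousOn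
      fun x hx => h.lineAt_mem (le_of_lt hx)
  · filter_upwards [ae_restrict_mem measurableSet_Ioi] with x hx
    rw [h.norm_kern]
    have := hb _ (h.lineAt_mem (le_of_lt hx))
    rw [lineAt_re] at this
    calc _ ≤ Real.exp (-Real.exp x / 2) * (C * Real.exp (m * x)) := by gcongr
      _ = _ := by ring

lemma IsRay.integrable_kern {y : ℝ} (h : IsRay y) {q : ℂ → ℂ} {m C : ℝ} (hm : 0 < m)
    (hq : Continuous (fun x => q (lineAt y x)))
    (hb : ∀ x, ‖q (lineAt y x)‖ ≤ C * Real.exp (m * x)) :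
    Integrable (fun x => kern q (lineAt y x)) := by
  refine ((integrable_exp_mul_weight hm).const_mul C).mono' ?_ ?_
  · refine Continuous.aestronglyMeasurable ?_
    exact (Complex.continuous_exp.comp (Complex.continuous_exp.comp (continuous_lineAt y))).mul hq
  · refine Eventually.of_forall fun x => ?_
    rw [h.norm_kern]
    calc _ ≤ Real.exp (-Real.exp x / 2) * (C * Real.exp (m * x)) := by gcongr; exact hb x
      _ = _ := by ring

/-- Cauchy's theorem on the rectangle between the abscissas a and b. The growth bound, with m of any
sign, serves only to make the two half lines integrable. -/
lemma hankel_eq_hankel {q : ℂ → ℂ} {m C a b : ℝ} (hab : a ≤ b)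
    (hq : DifferentiableOn ℂ q (Strip a))
    (hb : ∀ w ∈ Strip a, ‖q w‖ ≤ C * Real.exp (m * w.re)) :
    hankel (kern q) a = hankel (kern q) b := by
  have key := Complex.integral_boundary_rect_eq_zero_of_differentiableOn (kern q)
    (a + (-ang : ℝ) * Complex.I) (b + ang * Complex.I) ?_
  · simp only [Complex.add_re, Complex.ofReal_re, Complex.mul_re, Complex.I_re, mul_zero,
      Complex.ofReal_im, Complex.I_im, mul_one, sub_self, add_zero, Complex.add_im,
      Complex.mul_im, zero_add, smul_eq_mul] at key
    have hl : ∀ x y : ℝ, (x : ℂ) + y * Complex.I = lineAt y x := fun _ _ => rfl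
    simp only [hl] at key
    have hsplit : ∀ y, IsRay y → ∫ x in Ioi a, kern q (lineAt y x) =
        (∫ x in a..b, kern q (lineAt y x)) + ∫ x in Ioi b, kern q (lineAt y x) := by
      intro y hy
      have hi := hy.integrableOn_kern hq.continuousOn hb
      have hi' := hi.mono_set (Ioi_subset_Ioi hab)
      generalize (fun x => kern q (lineAt y x)) = G at hi hi' ⊢
      exact (intervalIntegral.integral_interval_add_Ioi hi hi').symm
    unfold hankel
    rw [hsplit _ isRay_ang, hsplit _ isRay_neg_ang]
    linear_combination (-1 : ℂ) * key
  · refine (differentiableOn_kern hq).mono fun w hw => ?_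
    · rw [Complex.mem_reProdIm] at hw
      simp only [Complex.add_re, Complex.ofReal_re, Complex.mul_re, Complex.I_re, mul_zero,
        Complex.ofReal_im, Complex.I_im, mul_one, sub_self, add_zero, Complex.add_im,
        Complex.mul_im, zero_add, uIcc_of_le hab,
        uIcc_of_le (by linarith [ang_pos] : -ang ≤ ang)] at hw
      exact ⟨hw.1.1, abs_le.2 hw.2⟩

lemma norm_integral_segment_le {q : ℂ → ℂ} {B a : ℝ}
    (hb : ∀ y, |y| ≤ ang → ‖q (lineAt y a)‖ ≤ B) :
    ‖∫ y in (-ang)..ang, kern q (lineAt y a)‖ ≤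
      Real.exp (Real.exp a) * B * (2 * ang) := by
  have := intervalIntegral.norm_integral_le_of_norm_le_const (a := -ang) (b := ang)
    (f := fun y : ℝ => kern q (lineAt y a)) (C := Real.exp (Real.exp a) * B) ?_
  · rwa [show |ang - -ang| = 2 * ang by rw [abs_of_pos] <;> linarith [ang_pos]] at this
  · intro y hy
    rw [uIoc_of_le (by linarith [ang_pos])] at hy
    have h1 := norm_kern_le q (lineAt y a)
    have h2 := hb y (abs_le.2 ⟨hy.1.le, hy.2⟩)
    rw [lineAt_re] at h1
    exact h1.trans (by gcongr)

/-- Let the abscissa tend to -∞, that is, shrink the arc around the origin of the ζ-plane. The decay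
e^{m Re w} with m > 0 kills the vertical segment and makes the full lines integrable. -/
lemma hankel_eq_rayDiff {q : ℂ → ℂ} {m C : ℝ} (hm : 0 < m)
    (hq : ∀ w : ℂ, |w.im| ≤ ang → DifferentiableAt ℂ q w)
    (hb : ∀ w : ℂ, |w.im| ≤ ang → ‖q w‖ ≤ C * Real.exp (m * w.re)) (a : ℝ) :
    hankel (kern q) a = rayDiff (kern q) := by
  have hC : 0 ≤ C := by
    have := (norm_nonneg _).trans (hb 0 (by simpa using ang_pos.le))
    simpa using this
  have hd : ∀ a, DifferentiableOn ℂ q (Strip a) := fun a w hw => (hq w hw.2).differentiableWithinAt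
  have hlim : Tendsto (fun a => hankel (kern q) a) atBot (𝓝 (rayDiff (kern q))) := by
    have hray : ∀ y, IsRay y → Tendsto (fun a => ∫ x in Ioi a, kern q (lineAt y x)) atBot
        (𝓝 (∫ x, kern q (lineAt y x))) := by
      intro y hy
      refine (aecover_Ioi tendsto_id).integral_tendsto_of_countably_generated
        (hy.integrable_kern (C := C) hm ?_ ?_)
      · refine continuous_iff_continuousAt.2 fun x => ?_
        have := hq (lineAt y x) (by simp [hy.abs_eq])
        exact this.continuousAt.comp (continuous_lineAt y).continuousAt
      · intro x
        simpa using hb (lineAt y x) (by simp [hy.abs_eq])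
    have hseg : Tendsto (fun a : ℝ => Complex.I * (∫ y in (-ang)..ang,
        kern q (lineAt y a))) atBot (𝓝 0) := by
      refine squeeze_zero_norm (a := fun a : ℝ =>
        Real.exp (Real.exp a) * (C * Real.exp (m * a)) * (2 * ang)) (fun a => ?_) ?_
      · rw [norm_mul, Complex.norm_I, one_mul]
        refine norm_integral_segment_le fun y hy => ?_
        simpa using hb (lineAt y a) (by simpa using hy)
      · have h1 : Tendsto (fun a : ℝ => Real.exp (Real.exp a)) atBot (𝓝 (Real.exp 0)) :=
          (Real.continuous_exp.tendsto 0).comp Real.tendsto_exp_atBot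
        have h2 : Tendsto (fun a : ℝ => Real.exp (m * a)) atBot (𝓝 0) :=
          Real.tendsto_exp_atBot.comp (tendsto_id.const_mul_atBot hm)
        simpa using (h1.mul (h2.const_mul C)).mul_const (2 * ang)
    have := hseg.add ((hray _ isRay_ang).sub (hray _ isRay_neg_ang))
    rw [zero_add] at this
    exact this
  refine tendsto_nhds_unique (tendsto_const_nhds.congr' ?_) hlim
  filter_upwards [eventually_le_atBot a] with a' ha'
  exact (hankel_eq_hankel ha' (hd a') fun w hw => hb w hw.2).symm

/-- The total mass that bounds `hankel (kern q) a` in terms of the supremum of `q`. -/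
def hankelMass (a : ℝ) : ℝ :=
  Real.exp (Real.exp a) * (2 * ang) + 2 * ∫ x in Ioi a, Real.exp (-Real.exp x / 2)

lemma norm_hankel_le {q : ℂ → ℂ} {B a : ℝ}
    (hb : ∀ w ∈ Strip a, ‖q w‖ ≤ B) :
    ‖hankel (kern q) a‖ ≤ B * hankelMass a := by
  have hw : IntegrableOn (fun x => Real.exp (-Real.exp x / 2)) (Ioi a) := by
    simpa using integrableOn_exp_mul_weight 0 a
  have hray : ∀ y, IsRay y → ‖∫ x in Ioi a, kern q (lineAt y x)‖ ≤
      B * ∫ x in Ioi a, Real.exp (-Real.exp x / 2) := by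
    intro y hy
    rw [← integral_const_mul]
    refine norm_integral_le_of_norm_le (hw.const_mul B) ?_
    filter_upwards [ae_restrict_mem measurableSet_Ioi] with x hx
    rw [hy.norm_kern, mul_comm]
    gcongr
    exact hb _ (hy.lineAt_mem (le_of_lt hx))
  unfold hankel hankelMass
  refine (norm_add_le _ _).trans ?_
  have h1 := norm_integral_segment_le (q := q) (B := B) (a := a) fun y hy =>
    hb _ ⟨by simp, by simpa using hy⟩
  have h2 := (norm_sub_le (∫ x in Ioi a, kern q (lineAt ang x))
    (∫ x in Ioi a, kern q (lineAt (-ang) x))).trans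
    (add_le_add (hray _ isRay_ang) (hray _ isRay_neg_ang))
  rw [norm_mul, Complex.norm_I, one_mul]
  nlinarith

lemma hankel_add {q₁ q₂ : ℂ → ℂ} {m₁ m₂ C₁ C₂ a : ℝ}
    (h₁ : ContinuousOn q₁ (Strip a)) (hb₁ : ∀ w ∈ Strip a, ‖q₁ w‖ ≤ C₁ * Real.exp (m₁ * w.re))
    (h₂ : ContinuousOn q₂ (Strip a)) (hb₂ : ∀ w ∈ Strip a, ‖q₂ w‖ ≤ C₂ * Real.exp (m₂ * w.re)) :
    hankel (kern fun w => q₁ w + q₂ w) a = hankel (kern q₁) a + hankel (kern q₂) a := by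
  have hseg : ∀ {q : ℂ → ℂ}, ContinuousOn q (Strip a) →
      IntervalIntegrable (fun y : ℝ => kern q (lineAt y a)) volume (-ang) ang := by
    intro q hq
    refine ContinuousOn.intervalIntegrable ?_
    refine (continuousOn_kern hq).comp (by unfold lineAt; fun_prop) fun y hy => ?_
    rw [uIcc_of_le (by linarith [ang_pos])] at hy
    exact ⟨by simp, by simpa using abs_le.2 hy⟩
  have hk : kern (fun w => q₁ w + q₂ w) = fun w => kern q₁ w + kern q₂ w := by
    funext w; simp [kern, mul_add]
  unfold hankel
  rw [hk, intervalIntegral.integral_add (hseg h₁) (hseg h₂),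
    integral_add (isRay_ang.integrableOn_kern h₁ hb₁) (isRay_ang.integrableOn_kern h₂ hb₂),
    integral_add (isRay_neg_ang.integrableOn_kern h₁ hb₁)
      (isRay_neg_ang.integrableOn_kern h₂ hb₂)]
  ring

lemma hankel_const_mul (c : ℂ) (q : ℂ → ℂ) (a : ℝ) :
    hankel (kern fun w => c * q w) a = c * hankel (kern q) a := by
  have hk : kern (fun w => c * q w) = fun w => c * kern q w := by
    funext w; simp only [kern]; ring
  unfold hankel
  rw [hk, intervalIntegral.integral_const_mul, integral_const_mul, integral_const_mul]
  ring

lemma norm_exp_ofReal_mul (m : ℝ) (w : ℂ) : ‖Complex.exp (m * w)‖ = Real.exp (m * w.re) := by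
  rw [Complex.norm_exp]; simp

/-! ### Hankel's formula for the reciprocal Gamma function -/

lemma integral_exp_mul_exp_neg_exp {b : ℝ} (hb : 0 < b) :
    ∫ x : ℝ, Real.exp (b * x) * Real.exp (-Real.exp x) = Real.Gamma b := by
  have h := integral_image_eq_integral_abs_deriv_smul (f := Real.exp) (f' := Real.exp)
      (s := univ) MeasurableSet.univ (fun x _ => (Real.hasDerivAt_exp x).hasDerivWithinAt)
      (Real.exp_injective.injOn) (fun r : ℝ => Real.exp (-r) * r ^ (b - 1))
  rw [image_univ, Real.range_exp, ← Real.Gamma_eq_integral hb, setIntegral_univ] at h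
  rw [h]
  refine integral_congr_ae (Eventually.of_forall fun x => ?_)
  simp only [smul_eq_mul]
  rw [abs_of_pos (Real.exp_pos _), ← Real.exp_mul, ← Real.exp_add, ← Real.exp_add, ← Real.exp_add]
  congr 1; ring

lemma norm_kern_exp_le (b x : ℝ) {y : ℝ} (hy : Real.cos y ≤ -1 / 2) :
    ‖kern (fun w => Complex.exp (b * w)) (lineAt y x)‖ ≤
      Real.exp (b * x) * Real.exp (-Real.exp x / 2) := by
  rw [kern, norm_mul, norm_exp_ofReal_mul, lineAt_re, lineAt, norm_exp_exp, mul_comm]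
  gcongr
  nlinarith [Real.exp_pos x]

lemma continuous_kern_exp (b : ℝ) : Continuous (kern (fun w => Complex.exp (b * w))) := by
  unfold kern; fun_prop

lemma integrable_kern_exp {b : ℝ} (hb : 0 < b) {y : ℝ} (hy : Real.cos y ≤ -1 / 2) :
    Integrable (fun x => kern (fun w => Complex.exp (b * w)) (lineAt y x)) :=
  (integrable_exp_mul_weight hb).mono'
    ((continuous_kern_exp b).comp (continuous_lineAt y)).aestronglyMeasurable
    (Eventually.of_forall fun x => norm_kern_exp_le b x hy)

lemma tendsto_exp_mul_weight_atTop (b : ℝ) :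
    Tendsto (fun x : ℝ => Real.exp (b * x) * Real.exp (-Real.exp x / 2)) atTop (𝓝 0) := by
  have h := (tendsto_rpow_mul_exp_neg_mul_atTop_nhds_zero b (1 / 2) (by norm_num)).comp
    Real.tendsto_exp_atTop
  refine h.congr fun x => ?_
  simp only [Function.comp]
  rw [← Real.exp_mul, mul_comm x b]
  congr 2; ring

lemma tendsto_exp_mul_weight_atBot {b : ℝ} (hb : 0 < b) :
    Tendsto (fun x : ℝ => Real.exp (b * x) * Real.exp (-Real.exp x / 2)) atBot (𝓝 0) := by
  have h1 : Tendsto (fun x : ℝ => Real.exp (b * x)) atBot (𝓝 0) :=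
    Real.tendsto_exp_atBot.comp (tendsto_id.const_mul_atBot hb)
  refine squeeze_zero (fun x => by positivity) (fun x => ?_) h1
  refine mul_le_of_le_one_right (Real.exp_pos _).le (Real.exp_le_one_iff.2 ?_)
  linarith [Real.exp_pos x]

/-- Cauchy's theorem on long rectangles. Between the two heights cos y ≤ -1/2, so the vertical sides
vanish at both ends. This moves the rays from ± 2π/3 to ± π, where the integrand becomes explicit.
-/
lemma integral_line_eq {b : ℝ} (hb : 0 < b) {y₁ y₂ : ℝ} (hy : y₁ ≤ y₂)
    (hcos : ∀ y ∈ Icc y₁ y₂, Real.cos y ≤ -1 / 2) :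
    ∫ x, kern (fun w => Complex.exp (b * w)) (lineAt y₁ x) =
      ∫ x, kern (fun w => Complex.exp (b * w)) (lineAt y₂ x) := by
  set Q := kern (fun w => Complex.exp (b * w)) with hQ
  have hdiff : Differentiable ℂ Q := by rw [hQ]; unfold kern; fun_prop
  have hrect : ∀ n : ℝ, (∫ x in (-n)..n, Q (lineAt y₁ x)) - (∫ x in (-n)..n, Q (lineAt y₂ x)) +
      Complex.I * (∫ y in y₁..y₂, Q (lineAt y n)) -
      Complex.I * (∫ y in y₁..y₂, Q (lineAt y (-n))) = 0 := by
    intro n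
    have key := Complex.integral_boundary_rect_eq_zero_of_differentiableOn Q
      (lineAt y₁ (-n)) (lineAt y₂ n) hdiff.differentiableOn
    simp only [lineAt_re, lineAt_im] at key
    exact key
  have hvert : ∀ x : ℝ, ‖Complex.I * ∫ y in y₁..y₂, Q (lineAt y x)‖ ≤
      Real.exp (b * x) * Real.exp (-Real.exp x / 2) * |y₂ - y₁| := by
    intro x
    rw [norm_mul, Complex.norm_I, one_mul]
    refine intervalIntegral.norm_integral_le_of_norm_le_const fun y hy' => ?_
    rw [uIoc_of_le hy] at hy'
    exact norm_kern_exp_le b x (hcos y ⟨hy'.1.le, hy'.2⟩)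
  have h1 : Tendsto (fun n : ℝ => Complex.I * ∫ y in y₁..y₂, Q (lineAt y n)) atTop (𝓝 0) :=
    squeeze_zero_norm (fun x => hvert x) (by
      simpa using (tendsto_exp_mul_weight_atTop b).mul_const |y₂ - y₁|)
  have h2 : Tendsto (fun n : ℝ => Complex.I * ∫ y in y₁..y₂, Q (lineAt y (-n))) atTop (𝓝 0) :=
    squeeze_zero_norm (fun x => hvert (-x)) (by
      simpa using ((tendsto_exp_mul_weight_atBot hb).comp tendsto_neg_atTop_atBot).mul_const
        |y₂ - y₁|)
  have h3 : ∀ y ∈ Icc y₁ y₂, Tendsto (fun n : ℝ => ∫ x in (-n)..n, Q (lineAt y x)) atTop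
      (𝓝 (∫ x, Q (lineAt y x))) := fun y hy' =>
    intervalIntegral_tendsto_integral (integrable_kern_exp hb (hcos y hy'))
      tendsto_neg_atTop_atBot tendsto_id
  have h4 := (((h3 y₁ ⟨le_rfl, hy⟩).sub (h3 y₂ ⟨hy, le_rfl⟩)).add h1).sub h2
  have h5 := tendsto_nhds_unique h4 (tendsto_const_nhds.congr fun n => (hrect n).symm)
  rw [add_zero, sub_zero] at h5
  exact sub_eq_zero.1 h5

/-- Here e^w = -e^x, so exp(e^w) is real and the integral is Γ(b) up to the phase of e^{bw}. -/
lemma integral_line_pi {b : ℝ} (hb : 0 < b) {y : ℝ} (hy : Complex.exp (y * Complex.I) = -1) :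
    ∫ x, kern (fun w => Complex.exp (b * w)) (lineAt y x) =
      Complex.exp (b * (y * Complex.I)) * Real.Gamma b := by
  rw [← integral_exp_mul_exp_neg_exp hb, ← integral_complex_ofReal, ← integral_const_mul]
  refine integral_congr_ae (Eventually.of_forall fun x => ?_)
  simp only [kern, lineAt]
  rw [Complex.exp_add, hy, mul_add, Complex.exp_add]
  push_cast
  rw [mul_neg_one]
  ring

lemma cos_le_of_mem_Icc {y : ℝ} (h1 : ang ≤ y) (h2 : y ≤ Real.pi) : Real.cos y ≤ -1 / 2 := by
  rw [← cos_ang]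
  exact Real.cos_le_cos_of_nonneg_of_le_pi ang_pos.le h2 h1

lemma ang_le_pi : ang ≤ Real.pi := by
  unfold ang; linarith [Real.pi_pos]

lemma rayDiff_kern_exp {b : ℝ} (hb : 0 < b) :
    rayDiff (kern fun w => Complex.exp (b * w)) =
      2 * Complex.I * (Real.Gamma b * Real.sin (Real.pi * b) : ℝ) := by
  have h1 := integral_line_eq hb ang_le_pi fun y hy => cos_le_of_mem_Icc hy.1 hy.2
  have h2 := integral_line_eq hb (neg_le_neg ang_le_pi) fun y hy => by
    rw [← Real.cos_neg]; exact cos_le_of_mem_Icc (by linarith [hy.2]) (by linarith [hy.1])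
  rw [rayDiff, h1, ← h2, integral_line_pi hb Complex.exp_pi_mul_I, integral_line_pi hb (by
    rw [Complex.ofReal_neg, neg_mul, Complex.exp_neg, Complex.exp_pi_mul_I]; norm_num)]
  rw [show (b : ℂ) * (Real.pi * Complex.I) = ((Real.pi * b : ℝ) : ℂ) * Complex.I by push_cast; ring,
    show (b : ℂ) * ((-Real.pi : ℝ) * Complex.I) = ((-(Real.pi * b) : ℝ) : ℂ) * Complex.I by
      push_cast; ring, Complex.exp_mul_I, Complex.exp_mul_I]
  simp only [Complex.ofReal_neg, Complex.cos_neg, Complex.sin_neg, Complex.ofReal_mul,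
    Complex.ofReal_sin]
  ring

lemma Gamma_mul_sin_eq {b : ℝ} (hb : 0 < b) :
    Real.Gamma b * Real.sin (Real.pi * b) = Real.pi / Real.Gamma (1 - b) := by
  have h := Real.Gamma_mul_Gamma_one_sub b
  -- If the sine vanishes, the reflection formula reads Γ(b) Γ(1-b) = π / 0 = 0, which forces the
  -- conventional value Γ(1-b) = 0 at the pole; both sides of the claim are then 0.
  by_cases hs : Real.sin (Real.pi * b) = 0
  · rw [hs, div_zero] at h
    rw [hs, mul_zero]
    rcases mul_eq_zero.1 h with h | h
    · exact absurd h (Real.Gamma_pos_of_pos hb).ne'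
    · rw [h, div_zero]
  · have : Real.Gamma (1 - b) ≠ 0 := by
      intro h0
      rw [h0, mul_zero] at h
      exact div_ne_zero Real.pi_ne_zero hs h.symm
    rw [eq_div_iff this]
    rw [eq_div_iff hs] at h
    linarith

/-- The Hankel integrand `exp (-β w)` gives the reciprocal Gamma function: case `-1 < β < 0`, and
more generally `β < 0`. -/
lemma hankel_exp_of_neg {β : ℝ} (hβ : β < 0) (a : ℝ) :
    hankel (kern fun w => Complex.exp (((-β : ℝ) : ℂ) * w)) a =
      2 * Real.pi * Complex.I * ((Real.Gamma (1 + β))⁻¹ : ℝ) := by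
  rw [hankel_eq_rayDiff (m := -β) (C := 1) (by linarith) (fun w _ => by fun_prop)
    (fun w _ => by rw [norm_exp_ofReal_mul, one_mul]), rayDiff_kern_exp (by linarith),
    Gamma_mul_sin_eq (by linarith)]
  rw [sub_neg_eq_add, div_eq_mul_inv]
  push_cast
  ring

lemma hankel_exp_bound (β a : ℝ) : ∀ w ∈ Strip a,
    ‖Complex.exp (((-β : ℝ) : ℂ) * w)‖ ≤ 1 * Real.exp (-β * w.re) := fun w _ => by
  rw [norm_exp_ofReal_mul, one_mul]

/-- Integration by parts, the contour form of Γ(1+β) = β Γ(β): the difference of the two integrands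
is the derivative of exp(e^w - βw), whose values at the two corners cancel and which vanishes at the
far ends of the rays. -/
lemma hankel_exp_recurrence (β a : ℝ) :
    hankel (kern fun w => Complex.exp (((-(β - 1) : ℝ) : ℂ) * w)) a =
      β * hankel (kern fun w => Complex.exp (((-β : ℝ) : ℂ) * w)) a := by
  set K := kern fun w => Complex.exp (((-β : ℝ) : ℂ) * w) with hK
  set K' := kern fun w => Complex.exp (((-(β - 1) : ℝ) : ℂ) * w) with hK'
  have hKc : Continuous K := continuous_kern_exp _
  have hKc' : Continuous K' := continuous_kern_exp _
  have hder : ∀ w, HasDerivAt K (K' w - β * K w) w := by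
    intro w
    have h1 := (Complex.hasDerivAt_exp (Complex.exp w)).comp w (Complex.hasDerivAt_exp w)
    have h2 := ((hasDerivAt_id w).const_mul ((-β : ℝ) : ℂ)).cexp
    have h3 := h1.mul h2
    convert! h3 using 1
    simp only [hK, hK', kern, Function.comp, id, mul_one]
    have : Complex.exp (((-(β - 1) : ℝ) : ℂ) * w) =
        Complex.exp w * Complex.exp (((-β : ℝ) : ℂ) * w) := by
      rw [← Complex.exp_add]; congr 1; push_cast; ring
    rw [this]; push_cast; ring
  have hseg : Complex.I * (∫ y in (-ang)..ang, K' (lineAt y a)) -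
      β * (Complex.I * (∫ y in (-ang)..ang, K (lineAt y a))) =
        K (lineAt ang a) - K (lineAt (-ang) a) := by
    have hl : Continuous fun y => lineAt y a := by unfold lineAt; fun_prop
    rw [← intervalIntegral.integral_const_mul, ← intervalIntegral.integral_const_mul,
      ← intervalIntegral.integral_const_mul,
      ← intervalIntegral.integral_sub (by apply Continuous.intervalIntegrable; fun_prop)
        (by apply Continuous.intervalIntegrable; fun_prop)]
    refine intervalIntegral.integral_eq_sub_of_hasDerivAt (f := fun y => K (lineAt y a))
      (fun y _ => ?_) (by apply Continuous.intervalIntegrable; fun_prop)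
    have hline : HasDerivAt (fun y : ℝ => lineAt y a) Complex.I y := by
      have := ((hasDerivAt_id y).ofReal_comp.mul_const Complex.I).const_add (a : ℂ)
      rw [Complex.ofReal_one, one_mul] at this
      exact this
    have := (hder (lineAt y a)).comp_of_eq y hline rfl
    convert! this using 1
    ring
  have hray : ∀ y, IsRay y → (∫ x in Ioi a, K' (lineAt y x)) -
      β * (∫ x in Ioi a, K (lineAt y x)) = -K (lineAt y a) := by
    intro y hy
    have hi := hy.integrableOn_kern (a := a) (by fun_prop) (hankel_exp_bound β a)
    have hi' := hy.integrableOn_kern (a := a) (by fun_prop) (hankel_exp_bound (β - 1) a)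
    rw [← integral_const_mul, ← integral_sub hi' (hi.const_mul _), ← zero_sub (K _)]
    refine integral_Ioi_of_hasDerivAt_of_tendsto' (f := fun x => K (lineAt y x))
      (f' := fun x => K' (lineAt y x) - β * K (lineAt y x)) (fun x _ => ?_)
      (hi'.sub (hi.const_mul _)) ?_
    · have hline : HasDerivAt (fun x : ℝ => lineAt y x) 1 x := by
        exact (hasDerivAt_id x).ofReal_comp.add_const (y * Complex.I)
      have := (hder (lineAt y x)).comp_of_eq x hline rfl
      convert! this using 1
      ring
    · refine squeeze_zero_norm (fun x => norm_kern_exp_le (-β) x (by rw [hy.cos_eq])) ?_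
      exact tendsto_exp_mul_weight_atTop _
  have h1 := hray _ isRay_ang
  have h2 := hray _ isRay_neg_ang
  unfold hankel
  linear_combination hseg + h1 - h2

/-- Both sides are continuous in β at 0, so the formula for β < 0 extends. On the rays the
integrands for |β| < 1 are dominated by the sum of the cases β = ± 1. -/
lemma hankel_exp_zero (a : ℝ) :
    hankel (kern fun w => Complex.exp (((-(0 : ℝ) : ℝ) : ℂ) * w)) a = 2 * Real.pi * Complex.I := by
  have hray : ∀ y, IsRay y → ContinuousAt (fun β : ℝ =>
      ∫ x in Ioi a, kern (fun w => Complex.exp (((-β : ℝ) : ℂ) * w)) (lineAt y x)) 0 := by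
    intro y hy
    refine continuousAt_of_dominated (bound := fun x =>
      Real.exp (1 * x) * Real.exp (-Real.exp x / 2) +
        Real.exp ((-1) * x) * Real.exp (-Real.exp x / 2)) (Eventually.of_forall fun β =>
      ((continuous_kern_exp _).comp (continuous_lineAt y)).aestronglyMeasurable) ?_
      ((integrableOn_exp_mul_weight _ _).add (integrableOn_exp_mul_weight _ _))
      (Eventually.of_forall fun x => ?_)
    · filter_upwards [Ioo_mem_nhds (show (-1 : ℝ) < 0 by norm_num) one_pos] with β hβ
      refine Eventually.of_forall fun x => ?_
      refine (norm_kern_exp_le _ _ (by rw [hy.cos_eq])).trans ?_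
      rw [← add_mul]
      gcongr
      rcases le_total 0 x with hx | hx
      · refine (Real.exp_le_exp.2 ?_).trans (le_add_of_nonneg_right (Real.exp_pos _).le)
        nlinarith [hβ.1]
      · refine (Real.exp_le_exp.2 ?_).trans (le_add_of_nonneg_left (Real.exp_pos _).le)
        nlinarith [hβ.2]
    · unfold kern
      fun_prop
  have hcont : ContinuousAt
      (fun β : ℝ => hankel (kern fun w => Complex.exp (((-β : ℝ) : ℂ) * w)) a) 0 := by
    unfold hankel
    refine ContinuousAt.add (ContinuousAt.mul continuousAt_const ?_) (ContinuousAt.sub ?_ ?_)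
    · refine Continuous.continuousAt ?_
      refine intervalIntegral.continuous_parametric_intervalIntegral_of_continuous' ?_ _ _
      unfold kern lineAt Function.uncurry
      fun_prop
    · exact hray _ isRay_ang
    · exact hray _ isRay_neg_ang
  have h1 : Tendsto (fun β : ℝ => hankel (kern fun w => Complex.exp (((-β : ℝ) : ℂ) * w)) a)
      (𝓝[<] 0) (𝓝 (2 * Real.pi * Complex.I * ((Real.Gamma (1 + 0))⁻¹ : ℝ))) := by
    have h2 : ContinuousAt (fun β : ℝ => Real.Gamma (1 + β)) 0 := by
      refine ContinuousAt.comp' (g := Real.Gamma) ?_ (by fun_prop)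
      exact (Real.differentiableAt_Gamma fun m => by
        have : (0 : ℝ) ≤ m := m.cast_nonneg
        intro h; linarith).continuousAt
    have h3 : ContinuousAt (fun β : ℝ => 2 * Real.pi * Complex.I *
        (((Real.Gamma (1 + β))⁻¹ : ℝ) : ℂ)) 0 :=
      continuousAt_const.mul (Complex.continuous_ofReal.continuousAt.comp
        (h2.inv₀ (by simp)))
    refine (h3.tendsto.mono_left nhdsWithin_le_nhds).congr' ?_
    filter_upwards [self_mem_nhdsWithin] with β hβ
    exact (hankel_exp_of_neg hβ a).symm
  have := tendsto_nhds_unique (hcont.tendsto.mono_left nhdsWithin_le_nhds) h1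
  rw [this]; simp

/-- Hankel's formula for the reciprocal Gamma function. -/
lemma hankel_exp {β : ℝ} (hβ : -1 < β) (a : ℝ) :
    hankel (kern fun w => Complex.exp (((-β : ℝ) : ℂ) * w)) a =
      2 * Real.pi * Complex.I * ((Real.Gamma (1 + β))⁻¹ : ℝ) := by
  -- Induction on an integer upper bound of β: for β > 0 the recurrence leads to β - 1 > -1, and β ≤
  -- 0 is already known.
  obtain ⟨n, hn⟩ := exists_nat_ge β
  induction n generalizing β with
  | zero =>
    rcases (show β ≤ 0 by simpa using hn).lt_or_eq with h | rfl
    · exact hankel_exp_of_neg h a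
    · rw [hankel_exp_zero]; simp
  | succ n ih =>
    rcases lt_trichotomy β 0 with h | rfl | h
    · exact hankel_exp_of_neg h a
    · rw [hankel_exp_zero]; simp
    · have h1 := hankel_exp_recurrence β a
      rw [ih (by linarith) (by push_cast at hn; linarith)] at h1
      have h2 : (β : ℂ) ≠ 0 := by exact_mod_cast h.ne'
      have h3 : Real.Gamma (1 + β) = β * Real.Gamma β := by
        rw [add_comm, Real.Gamma_add_one h.ne']
      rw [show 1 + (β - 1) = β by ring] at h1
      refine mul_left_cancel₀ h2 (h1.symm.trans ?_)
      rw [h3, mul_inv]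
      push_cast
      field_simp

/-! ### Power series with infinite radius of convergence -/

/-- The factor k + 1 ≤ 2^{k+1} is absorbed by enlarging the radius from R to 2(R + 1). -/
lemma summable_deriv_coeff {c : ℕ → ℝ} (hc : ∀ R : ℝ, 0 ≤ R → Summable fun k => |c k| * R ^ k)
    (R : ℝ) (hR : 0 ≤ R) : Summable fun k : ℕ => |(k + 1) * c (k + 1)| * R ^ k := by
  have h := (summable_nat_add_iff 1).2 (hc (2 * (R + 1)) (by positivity))
  refine Summable.of_nonneg_of_le (fun k => by positivity) (fun k => ?_) h
  rw [abs_mul, mul_pow, abs_of_nonneg (by positivity : (0 : ℝ) ≤ k + 1)]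
  have h1 : (k : ℝ) + 1 ≤ 2 ^ (k + 1) := by
    have : k + 1 ≤ 2 ^ (k + 1) := Nat.lt_two_pow_self.le
    exact_mod_cast this
  have h2 : R ^ k ≤ (R + 1) ^ (k + 1) :=
    (pow_le_pow_left₀ hR (by linarith) k).trans (pow_le_pow_right₀ (by linarith) (Nat.le_succ k))
  calc (k + 1 : ℝ) * |c (k + 1)| * R ^ k = |c (k + 1)| * ((k + 1) * R ^ k) := by ring
    _ ≤ |c (k + 1)| * (2 ^ (k + 1) * (R + 1) ^ (k + 1)) := by gcongr

lemma hasDerivAt_tsum_mul_pow {c : ℕ → ℝ}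
    (hc : ∀ R : ℝ, 0 ≤ R → Summable fun k => |c k| * R ^ k) (z : ℝ) :
    HasDerivAt (fun z => ∑' k, c k * z ^ k) (∑' k : ℕ, ((k + 1) * c (k + 1)) * z ^ k) z := by
  have hs := summable_deriv_coeff hc (|z| + 1) (by positivity)
  have hu : Summable fun k : ℕ => |k * c k| * (|z| + 1) ^ (k - 1) := by
    rw [← summable_nat_add_iff 1]
    simpa using hs
  have h := hasDerivAt_tsum_of_isPreconnected (g := fun k z => c k * z ^ k)
    (g' := fun k z => c k * (k * z ^ (k - 1))) (t := Metric.ball 0 (|z| + 1)) (y₀ := 0) (y := z)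
    hu Metric.isOpen_ball (convex_ball _ _).isPreconnected
    (fun k y _ => (hasDerivAt_pow k y).const_mul (c k)) (fun k y hy => ?_)
    (Metric.mem_ball_self (by positivity))
    (by
      refine summable_of_ne_finset_zero (s := {0}) fun k hk => ?_
      simp at hk; simp [hk])
    (by simp)
  · convert! h using 1
    have hsum : Summable fun k : ℕ => c k * (k * z ^ (k - 1)) := by
      refine Summable.of_norm_bounded hu fun k => ?_
      rw [← mul_assoc, norm_mul, Real.norm_eq_abs, mul_comm (c k), norm_pow, Real.norm_eq_abs]
      gcongr
      linarith
    rw [hsum.tsum_eq_zero_add]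
    simp only [Nat.cast_zero, zero_mul, mul_zero, zero_add, Nat.add_sub_cancel]
    refine tsum_congr fun k => ?_
    push_cast; ring
  · rw [mem_ball_zero_iff, Real.norm_eq_abs] at hy
    rw [← mul_assoc, norm_mul, Real.norm_eq_abs, mul_comm (c k), norm_pow, Real.norm_eq_abs]
    gcongr

/-! ### The Mittag-Leffler series -/

/-- Keep only the part t > R of the Gamma integral, where t^x ≥ R^x. As R is free, this shows that Γ
beats every geometric sequence. -/
lemma rpow_mul_exp_neg_le_Gamma {x R : ℝ} (hx : 0 ≤ x) (hR : 0 < R) :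
    R ^ x * Real.exp (-R) ≤ Real.Gamma (x + 1) := by
  have hint := Real.GammaIntegral_convergent (show 0 < x + 1 by linarith)
  rw [add_sub_cancel_right] at hint
  rw [Real.Gamma_eq_integral (by linarith), add_sub_cancel_right]
  have h1 : ∫ t in Ioi R, Real.exp (-t) * R ^ x = R ^ x * Real.exp (-R) := by
    rw [integral_mul_const, integral_exp_neg_Ioi, mul_comm]
  rw [← h1]
  refine (setIntegral_mono_on ((integrableOn_exp_neg_Ioi R).mul_const _)
    (hint.mono_set (Ioi_subset_Ioi hR.le)) measurableSet_Ioi fun t ht => ?_).trans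
    (setIntegral_mono_set hint ?_ (Ioi_subset_Ioi hR.le).eventuallyLE)
  · gcongr
    exact le_of_lt ht
  · filter_upwards [ae_restrict_mem measurableSet_Ioi] with t ht
    have : (0 : ℝ) < t := ht
    positivity

lemma summable_mittagLeffler {ρ γ : ℝ} (hρ : 0 < ρ) (hγ : 0 < γ) (R : ℝ) (hR : 0 ≤ R) :
    Summable fun k : ℕ => |(Real.Gamma (ρ * k + γ))⁻¹| * R ^ k := by
  suffices h : Summable fun k : ℕ => |(Real.Gamma (ρ * (k + ⌈1 / ρ⌉₊ : ℕ) + γ))⁻¹| *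
      R ^ (k + ⌈1 / ρ⌉₊) from (summable_nat_add_iff ⌈1 / ρ⌉₊).1 h
  set n := ⌈1 / ρ⌉₊
  have hn : 1 ≤ ρ * n := by
    have := Nat.le_ceil (1 / ρ)
    rw [div_le_iff₀ hρ] at this
    linarith
  -- With S^ρ = 2(R + 1), the lower bound for Γ at radius S contains (2(R + 1))^k, which leaves a
  -- geometric series of ratio 1/2.
  set S : ℝ := (2 * (R + 1)) ^ (1 / ρ) with hS
  have hS0 : 0 < S := by positivity
  have hgeo : Summable fun k : ℕ => Real.exp S * S ^ (1 - γ) * (1 / 2 : ℝ) ^ (k + n) :=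
    ((summable_nat_add_iff n).2 summable_geometric_two).mul_left _
  refine Summable.of_nonneg_of_le (fun k => by positivity) (fun k => ?_) hgeo
  have hk : 1 ≤ ρ * ((k + n : ℕ) : ℝ) := by
    push_cast
    nlinarith [mul_nonneg hρ.le (k.cast_nonneg : (0 : ℝ) ≤ k)]
  have h1 := rpow_mul_exp_neg_le_Gamma (x := ρ * ((k + n : ℕ) : ℝ) + γ - 1) (by linarith) hS0
  rw [sub_add_cancel] at h1
  have h2 : S ^ (ρ * ((k + n : ℕ) : ℝ) + γ - 1) = (2 * (R + 1)) ^ (k + n) * S ^ (γ - 1) := by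
    rw [add_sub_assoc, Real.rpow_add hS0]
    congr 1
    rw [hS, ← Real.rpow_mul (by positivity), ← mul_assoc, one_div_mul_cancel hρ.ne', one_mul,
      Real.rpow_natCast]
  have h3 : 0 < S ^ (ρ * ((k + n : ℕ) : ℝ) + γ - 1) * Real.exp (-S) := by positivity
  have h4 : R ^ (k + n) ≤ (R + 1) ^ (k + n) := pow_le_pow_left₀ hR (by linarith) _
  rw [abs_of_pos (inv_pos.2 (h3.trans_le h1))]
  calc _ ≤ (S ^ (ρ * ((k + n : ℕ) : ℝ) + γ - 1) * Real.exp (-S))⁻¹ * (R + 1) ^ (k + n) := by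
        gcongr
    _ = _ := by
        rw [h2, mul_pow, Real.exp_neg, show (1 - γ) = -(γ - 1) by ring, Real.rpow_neg hS0.le,
          div_pow, one_pow]
        have : (R + 1) ^ (k + n) ≠ 0 := by positivity
        field_simp

lemma mittagLeffler_eq (ρ : ℝ) :
    mittagLeffler ρ = fun z => ∑' k : ℕ, (Real.Gamma (ρ * k + 1))⁻¹ * z ^ k := by
  funext z
  exact tsum_congr fun k => by rw [div_eq_inv_mul]

lemma mittagLeffler_one (z : ℝ) : mittagLeffler 1 z = Real.exp z := by
  rw [Real.exp_eq_exp_ℝ, NormedSpace.exp_eq_tsum_div]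
  refine tsum_congr fun k => ?_
  rw [one_mul, Real.Gamma_nat_eq_factorial]

/-- The derivative of the Mittag-Leffler function, as a power series. -/
def mittagLefflerDeriv (ρ z : ℝ) : ℝ :=
  ∑' k : ℕ, ((k + 1) * (Real.Gamma (ρ * (k + 1 : ℕ) + 1))⁻¹) * z ^ k

lemma hasDerivAt_mittagLeffler {ρ : ℝ} (hρ : 0 < ρ) (z : ℝ) :
    HasDerivAt (mittagLeffler ρ) (mittagLefflerDeriv ρ z) z := by
  rw [mittagLeffler_eq]
  exact hasDerivAt_tsum_mul_pow (summable_mittagLeffler hρ one_pos) z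

lemma continuous_mittagLeffler {ρ : ℝ} (hρ : 0 < ρ) : Continuous (mittagLeffler ρ) :=
  continuous_iff_continuousAt.2 fun z => (hasDerivAt_mittagLeffler hρ z).continuousAt

lemma continuous_mittagLefflerDeriv {ρ : ℝ} (hρ : 0 < ρ) : Continuous (mittagLefflerDeriv ρ) :=
  continuous_iff_continuousAt.2 fun z => (hasDerivAt_tsum_mul_pow
    (summable_deriv_coeff (summable_mittagLeffler hρ one_pos)) z).continuousAt

lemma mittagLeffler_zero (ρ : ℝ) : mittagLeffler ρ 0 = 1 := by
  rw [mittagLeffler, tsum_eq_single 0 fun k hk => by simp [hk]]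
  simp

/-! ### The contour representation of the Mittag-Leffler function -/

/-- The argument of p = e^{ρw} is at most (5/4)(2π/3) = 5π/6 in absolute value, so its cosine is at
least -√3/2 ≥ -7/8. With X = |p| this gives |p + z|² ≥ X² - (7/4) X z + z² = (X + z)²/16 + (15/16)(X
- z)². -/
lemma norm_exp_add_ge {ρ z : ℝ} (hρ : 0 ≤ ρ) (hρ' : ρ ≤ 5 / 4) (hz : 0 ≤ z) {w : ℂ}
    (hw : |w.im| ≤ ang) :
    (Real.exp (ρ * w.re) + z) / 4 ≤ ‖Complex.exp (ρ * w) + z‖ := by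
  have hcos : -7 / 8 ≤ Real.cos (ρ * w.im) := by
    have h1 : |ρ * w.im| ≤ Real.pi - Real.pi / 6 := by
      rw [abs_mul, abs_of_nonneg hρ]
      calc ρ * |w.im| ≤ 5 / 4 * ang := by gcongr
        _ = _ := by unfold ang; ring
    rw [← Real.cos_abs]
    have h2 := Real.cos_le_cos_of_nonneg_of_le_pi (abs_nonneg (ρ * w.im))
      (by linarith [Real.pi_pos]) h1
    rw [Real.cos_pi_sub, Real.cos_pi_div_six] at h2
    have h3 : Real.sqrt 3 ≤ 7 / 4 := Real.sqrt_le_iff.2 ⟨by norm_num, by norm_num⟩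
    linarith
  set X := Real.exp (ρ * w.re) with hX
  have hX0 : 0 < X := Real.exp_pos _
  have hre : (Complex.exp (ρ * w) + z).re = X * Real.cos (ρ * w.im) + z := by
    rw [Complex.add_re, Complex.exp_re]; simp [hX]
  have him : (Complex.exp (ρ * w) + z).im = X * Real.sin (ρ * w.im) := by
    rw [Complex.add_im, Complex.exp_im]; simp [hX]
  refine abs_le_of_sq_le_sq' ?_ (norm_nonneg _) |>.2
  rw [Complex.sq_norm, Complex.normSq_apply, hre, him]
  have hcs := Real.sin_sq_add_cos_sq (ρ * w.im)
  have hexp : (X * Real.cos (ρ * w.im) + z) * (X * Real.cos (ρ * w.im) + z) +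
      X * Real.sin (ρ * w.im) * (X * Real.sin (ρ * w.im)) =
      X ^ 2 + 2 * (X * z) * Real.cos (ρ * w.im) + z ^ 2 := by linear_combination X ^ 2 * hcs
  rw [hexp]
  nlinarith [mul_nonneg hX0.le hz, sq_nonneg (X - z), mul_le_mul_of_nonneg_left hcos
    (mul_nonneg hX0.le hz)]

lemma exp_add_ne_zero {ρ z : ℝ} (hρ : 0 ≤ ρ) (hρ' : ρ ≤ 5 / 4) (hz : 0 ≤ z) {w : ℂ}
    (hw : |w.im| ≤ ang) : Complex.exp (ρ * w) + z ≠ 0 := by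
  have h := norm_exp_add_ge hρ hρ' hz hw
  have : 0 < Real.exp (ρ * w.re) := Real.exp_pos _
  exact norm_pos_iff.1 (by linarith)

/-- `p / (p + z)` with `p = e^{ρ w}`. -/
def mlKern (ρ z : ℝ) (w : ℂ) : ℂ := Complex.exp (ρ * w) / (Complex.exp (ρ * w) + z)

lemma norm_mlKern_le {ρ z : ℝ} (hρ : 0 ≤ ρ) (hρ' : ρ ≤ 5 / 4) (hz : 0 ≤ z) {w : ℂ}
    (hw : |w.im| ≤ ang) : ‖mlKern ρ z w‖ ≤ 4 := by
  have h := norm_exp_add_ge hρ hρ' hz hw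
  have h0 : 0 < Real.exp (ρ * w.re) := Real.exp_pos _
  rw [mlKern, norm_div, norm_exp_ofReal_mul, div_le_iff₀ (by linarith)]
  linarith

lemma norm_mlKern_le' {ρ z : ℝ} (hρ : 0 ≤ ρ) (hρ' : ρ ≤ 5 / 4) (hz : 0 < z) {w : ℂ}
    (hw : |w.im| ≤ ang) : ‖mlKern ρ z w‖ ≤ 4 / z * Real.exp (ρ * w.re) := by
  have h := norm_exp_add_ge hρ hρ' hz.le hw
  have h0 : 0 < Real.exp (ρ * w.re) := Real.exp_pos _
  rw [mlKern, norm_div, norm_exp_ofReal_mul, div_le_iff₀ (by linarith)]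
  calc Real.exp (ρ * w.re) = 4 / z * Real.exp (ρ * w.re) * (z / 4) := by field_simp
    _ ≤ _ := by gcongr; linarith

lemma differentiableAt_mlKern {ρ z : ℝ} (hρ : 0 ≤ ρ) (hρ' : ρ ≤ 5 / 4) (hz : 0 ≤ z) {w : ℂ}
    (hw : |w.im| ≤ ang) : DifferentiableAt ℂ (mlKern ρ z) w := by
  unfold mlKern
  exact DifferentiableAt.div (by fun_prop) (by fun_prop) (exp_add_ne_zero hρ hρ' hz hw)

lemma hankel_congr {q₁ q₂ : ℂ → ℂ} {a : ℝ} (h : ∀ w ∈ Strip a, q₁ w = q₂ w) :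
    hankel (kern q₁) a = hankel (kern q₂) a := by
  have hray : ∀ y, IsRay y → ∫ x in Ioi a, kern q₁ (lineAt y x) =
      ∫ x in Ioi a, kern q₂ (lineAt y x) := fun y hy =>
    setIntegral_congr_fun measurableSet_Ioi fun x hx => by
      simp only [kern]; rw [h _ (hy.lineAt_mem (le_of_lt hx))]
  unfold hankel
  rw [hray _ isRay_ang, hray _ isRay_neg_ang]
  congr 2
  refine intervalIntegral.integral_congr fun y hy => ?_
  rw [uIcc_of_le (by linarith [ang_pos])] at hy
  simp only [kern]
  rw [h _ ⟨by simp, by simpa using abs_le.2 hy⟩]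

/-- Iterate p/(p+z) = 1 - z p^{-1} · p/(p+z). The powers p^{-k} = e^{-ρkw} integrate to 2πi / Γ(ρk +
1) by Hankel's formula and produce the partial sums of the series. -/
lemma hankel_mlKern_expand {ρ z : ℝ} (hρ : 0 < ρ) (hρ' : ρ ≤ 1) (hz : 0 < z) (a : ℝ) (n : ℕ) :
    hankel (kern (mlKern ρ z)) a =
      2 * Real.pi * Complex.I * ((∑ k ∈ Finset.range n,
        (Real.Gamma (ρ * k + 1))⁻¹ * (-z) ^ k : ℝ) : ℂ) +
      hankel (kern fun w => (-z : ℂ) ^ n *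
        (Complex.exp (((-(ρ * n) : ℝ) : ℂ) * w) * mlKern ρ z w)) a := by
  induction n with
  | zero => simp
  | succ n ih =>
    have hid : ∀ w : ℂ, |w.im| ≤ ang → (-z : ℂ) ^ n *
        (Complex.exp (((-(ρ * n) : ℝ) : ℂ) * w) * mlKern ρ z w) =
        (-z : ℂ) ^ n * Complex.exp (((-(ρ * n) : ℝ) : ℂ) * w) + (-z : ℂ) ^ (n + 1) *
        (Complex.exp (((-(ρ * (n + 1 : ℕ)) : ℝ) : ℂ) * w) * mlKern ρ z w) := by
      intro w hw
      have h0 := exp_add_ne_zero hρ.le (by linarith : ρ ≤ 5 / 4) hz.le hw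
      have h1 : Complex.exp (((-(ρ * n) : ℝ) : ℂ) * w) =
          Complex.exp (((-(ρ * (n + 1 : ℕ)) : ℝ) : ℂ) * w) * Complex.exp (ρ * w) := by
        rw [← Complex.exp_add]; congr 1; push_cast; ring
      rw [h1, mlKern]
      generalize Complex.exp (ρ * w) = p at h0 ⊢
      field_simp
      ring
    have hexp : ∀ w ∈ Strip a, ‖(-z : ℂ) ^ n * Complex.exp (((-(ρ * n) : ℝ) : ℂ) * w)‖ ≤
        z ^ n * Real.exp (-(ρ * n) * w.re) := fun w _ => by
      rw [norm_mul, norm_exp_ofReal_mul, norm_pow, norm_neg, Complex.norm_real, Real.norm_eq_abs,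
        abs_of_pos hz]
    have hrem : ∀ w ∈ Strip a, ‖(-z : ℂ) ^ (n + 1) *
        (Complex.exp (((-(ρ * (n + 1 : ℕ)) : ℝ) : ℂ) * w) * mlKern ρ z w)‖ ≤
        (4 * z ^ (n + 1)) * Real.exp (-(ρ * (n + 1 : ℕ)) * w.re) := fun w hw => by
      rw [norm_mul, norm_mul, norm_exp_ofReal_mul, norm_pow, norm_neg, Complex.norm_real,
        Real.norm_eq_abs, abs_of_pos hz]
      have := norm_mlKern_le hρ.le (by linarith : ρ ≤ 5 / 4) hz.le hw.2
      calc _ ≤ z ^ (n + 1) * (Real.exp (-(ρ * (n + 1 : ℕ)) * w.re) * 4) := by gcongr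
        _ = _ := by ring
    have hcont : ContinuousOn (mlKern ρ z) (Strip a) := fun w hw =>
      (differentiableAt_mlKern hρ.le (by linarith) hz.le hw.2).continuousAt.continuousWithinAt
    rw [ih, hankel_congr fun w hw => hid w hw.2, hankel_add (by fun_prop) hexp (by fun_prop) hrem,
      hankel_const_mul, hankel_exp (by have : 0 ≤ ρ * n := by positivity
                                       linarith),
      Finset.sum_range_succ, add_comm 1]
    push_cast
    ring

/-- The contour representation of `E_ρ(-z)`, `z > 0`, `0 < ρ ≤ 1`. -/
lemma mittagLeffler_eq_rayDiff {ρ z : ℝ} (hρ : 0 < ρ) (hρ' : ρ ≤ 1) (hz : 0 < z) :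
    rayDiff (kern (mlKern ρ z)) = 2 * Real.pi * Complex.I * (mittagLeffler ρ (-z) : ℂ) := by
  -- This abscissa makes |z / p| ≤ 1/2 on the whole contour, so the remainder of the geometric
  -- expansion tends to zero. The contour is afterwards moved to -∞.
  set a : ℝ := Real.log (2 * z) / ρ with ha
  have hexpa : ∀ w ∈ Strip a, z * Real.exp (-ρ * w.re) ≤ 1 / 2 := by
    intro w hw
    have h1 : Real.log (2 * z) ≤ ρ * w.re := by
      have := hw.1
      rw [ha, div_le_iff₀ hρ] at this
      linarith
    rw [neg_mul, Real.exp_neg, ← div_eq_mul_inv, div_le_iff₀ (Real.exp_pos _)]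
    have h2 := Real.exp_le_exp.2 h1
    rw [Real.exp_log (by positivity)] at h2
    linarith
  have h1 : hankel (kern (mlKern ρ z)) a = rayDiff (kern (mlKern ρ z)) :=
    hankel_eq_rayDiff hρ (fun w hw => differentiableAt_mlKern hρ.le (by linarith) hz.le hw)
      (fun w hw => norm_mlKern_le' hρ.le (by linarith) hz hw) a
  rw [← h1]
  have hrem : Tendsto (fun n : ℕ => hankel (kern fun w => (-z : ℂ) ^ n *
        (Complex.exp (((-(ρ * n) : ℝ) : ℂ) * w) * mlKern ρ z w)) a) atTop (𝓝 0) := by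
    refine squeeze_zero_norm (a := fun n : ℕ => (1 / 2 : ℝ) ^ n * 4 * hankelMass a)
      (fun n => norm_hankel_le fun w hw => ?_) ?_
    · rw [norm_mul, norm_mul, norm_exp_ofReal_mul, norm_pow, norm_neg, Complex.norm_real,
        Real.norm_eq_abs, abs_of_pos hz, ← mul_assoc]
      have h2 : z ^ n * Real.exp (-(ρ * n) * w.re) = (z * Real.exp (-ρ * w.re)) ^ n := by
        rw [mul_pow, ← Real.exp_nat_mul]; congr 2; ring
      rw [h2]
      gcongr
      · exact hexpa w hw
      · exact norm_mlKern_le hρ.le (by linarith) hz.le hw.2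
    · have := (tendsto_pow_atTop_nhds_zero_of_lt_one (by norm_num : (0 : ℝ) ≤ 1 / 2)
        (by norm_num)).mul_const 4 |>.mul_const (hankelMass a)
      simpa using this
  have hsum : Tendsto (fun n : ℕ => ∑ k ∈ Finset.range n,
        (Real.Gamma (ρ * k + 1))⁻¹ * (-z) ^ k) atTop (𝓝 (mittagLeffler ρ (-z))) := by
    rw [mittagLeffler_eq]
    refine (Summable.of_norm ?_).hasSum.tendsto_sum_nat
    simpa [abs_of_pos hz] using summable_mittagLeffler hρ one_pos z hz.le
  have h2 := (((Complex.continuous_ofReal.tendsto _).comp hsum).const_mul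
    (2 * Real.pi * Complex.I)).add hrem
  rw [add_zero] at h2
  exact tendsto_nhds_unique (tendsto_const_nhds.congr fun n =>
    hankel_mlKern_expand hρ hρ' hz a n) h2

/-! ### Bounds and derivatives of contour integrals -/

/-- The mass of the weight `e^{m x} exp(-e^x / 2)`. -/
def rayMass (m : ℝ) : ℝ := ∫ x : ℝ, Real.exp (m * x) * Real.exp (-Real.exp x / 2)

lemma norm_rayDiff_le {q : ℂ → ℂ} {B : ℝ → ℝ}
    (hB : Integrable B)
    (hb : ∀ y, IsRay y → ∀ x, Real.exp (-Real.exp x / 2) * ‖q (lineAt y x)‖ ≤ B x) :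
    ‖rayDiff (kern q)‖ ≤ 2 * ∫ x, B x := by
  have hray : ∀ y, IsRay y → ‖∫ x, kern q (lineAt y x)‖ ≤ ∫ x, B x := fun y hy =>
    norm_integral_le_of_norm_le hB (Eventually.of_forall fun x => by
      rw [hy.norm_kern]; exact hb y hy x)
  refine (norm_sub_le _ _).trans ?_
  linarith [hray _ isRay_ang, hray _ isRay_neg_ang]

lemma hasDerivAt_rayDiff {q q' : ℝ → ℂ → ℂ} {s₀ : ℝ} {S : Set ℝ} (hS : S ∈ 𝓝 s₀) {B : ℝ → ℝ}
    (hq : ∀ y, IsRay y → ∀ s ∈ S, Continuous fun x => q s (lineAt y x))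
    (hint : ∀ y, IsRay y → Integrable fun x => kern (q s₀) (lineAt y x))
    (hq' : ∀ y, IsRay y → Continuous fun x => q' s₀ (lineAt y x))
    (hB : Integrable B)
    (hb : ∀ y, IsRay y → ∀ x, ∀ s ∈ S,
      Real.exp (-Real.exp x / 2) * ‖q' s (lineAt y x)‖ ≤ B x)
    (hder : ∀ y, IsRay y → ∀ x, ∀ s ∈ S,
      HasDerivAt (fun s => q s (lineAt y x)) (q' s (lineAt y x)) s) :
    HasDerivAt (fun s => rayDiff (kern (q s))) (rayDiff (kern (q' s₀))) s₀ := by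
  have hk : ∀ {f : ℂ → ℂ} y, Continuous (fun x => f (lineAt y x)) →
      Continuous fun x => kern f (lineAt y x) := fun y hf =>
    (Complex.continuous_exp.comp (Complex.continuous_exp.comp (continuous_lineAt y))).mul hf
  have hray : ∀ y, IsRay y → HasDerivAt (fun s => ∫ x, kern (q s) (lineAt y x))
      (∫ x, kern (q' s₀) (lineAt y x)) s₀ := fun y hy =>
    (hasDerivAt_integral_of_dominated_loc_of_deriv_le (F := fun s x => kern (q s) (lineAt y x))
      (F' := fun s x => kern (q' s) (lineAt y x)) hS
      (by filter_upwards [hS] with s hs; exact (hk y (hq y hy s hs)).aestronglyMeasurable)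
      (hint y hy) (hk y (hq' y hy)).aestronglyMeasurable
      (Eventually.of_forall fun x s hs => by rw [hy.norm_kern]; exact hb y hy x s hs) hB
      (Eventually.of_forall fun x s hs => (hder y hy x s hs).const_mul _)).2
  exact (hray _ isRay_ang).sub (hray _ isRay_neg_ang)

lemma IsRay.continuous_exp_mul_line {y : ℝ} (m : ℝ) :
    Continuous fun x => Complex.exp (m * lineAt y x) := by
  have := continuous_lineAt y
  fun_prop

lemma IsRay.abs_im_le {y : ℝ} (hy : IsRay y) (x : ℝ) : |(lineAt y x).im| ≤ ang := by
  rw [lineAt_im, hy.abs_eq]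

lemma abs_mittagLeffler_neg_le {ρ : ℝ} (hρ : 0 < ρ) (hρ' : ρ ≤ 1) {z : ℝ} (hz : 0 < z) :
    |mittagLeffler ρ (-z)| ≤ (4 * rayMass ρ) / z := by
  have h := norm_rayDiff_le (q := mlKern ρ z) ((integrable_exp_mul_weight hρ).const_mul (4 / z))
    fun y hy x => ?_
  · rw [mittagLeffler_eq_rayDiff hρ hρ' hz, integral_const_mul] at h
    change _ ≤ 2 * (4 / z * rayMass ρ) at h
    simp only [norm_mul, Complex.norm_real, Complex.norm_I, Complex.norm_ofNat, mul_one,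
      Real.norm_eq_abs, abs_of_pos Real.pi_pos] at h
    have h1 : 1 ≤ Real.pi := by linarith [Real.pi_gt_three]
    have h2 : |mittagLeffler ρ (-z)| ≤ Real.pi * |mittagLeffler ρ (-z)| :=
      le_mul_of_one_le_left (abs_nonneg _) h1
    calc _ ≤ 4 / z * rayMass ρ := by linarith
      _ = _ := by ring
  · have := norm_mlKern_le' hρ.le (by linarith : ρ ≤ 5 / 4) hz (hy.abs_im_le x)
    rw [lineAt_re] at this
    calc _ ≤ Real.exp (-Real.exp x / 2) * (4 / z * Real.exp (ρ * x)) := by gcongr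
      _ = _ := by ring

/-- Differentiating p/(p+s) in s gives -p/(p+s)², hence one more power of decay than for the
function itself. For s > z/2 one has |p + s| ≥ s/4 ≥ z/8, whence the constant 64. -/
lemma abs_mittagLefflerDeriv_neg_le {ρ : ℝ} (hρ : 0 < ρ) (hρ' : ρ ≤ 1) {z : ℝ} (hz : 0 < z) :
    |mittagLefflerDeriv ρ (-z)| ≤ (64 * rayMass ρ) / z ^ 2 := by
  set q' : ℝ → ℂ → ℂ := fun s w => -Complex.exp (ρ * w) / (Complex.exp (ρ * w) + s) ^ 2 with hq'
  have hne : ∀ y, IsRay y → ∀ x s, 0 < s → Complex.exp (ρ * lineAt y x) + (s : ℝ) ≠ 0 :=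
    fun y hy x s hs => exp_add_ne_zero hρ.le (by linarith) hs.le (hy.abs_im_le x)
  have hb : ∀ y, IsRay y → ∀ x, ∀ s ∈ Ioi (z / 2), Real.exp (-Real.exp x / 2) *
      ‖q' s (lineAt y x)‖ ≤ 64 / z ^ 2 * (Real.exp (ρ * x) * Real.exp (-Real.exp x / 2)) := by
    intro y hy x s hs
    have hs' : z / 2 < s := hs
    have h0 := norm_exp_add_ge hρ.le (by linarith : ρ ≤ 5 / 4) (by linarith : 0 ≤ s)
      (hy.abs_im_le x)
    rw [lineAt_re] at h0
    have h1 : z / 8 ≤ ‖Complex.exp (ρ * lineAt y x) + s‖ := by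
      linarith [Real.exp_pos (ρ * x)]
    rw [hq', norm_div, norm_neg, norm_exp_ofReal_mul, norm_pow, lineAt_re]
    calc _ ≤ Real.exp (-Real.exp x / 2) * (Real.exp (ρ * x) / (z / 8) ^ 2) := by gcongr
      _ = _ := by field_simp; norm_num
  have hB := (integrable_exp_mul_weight hρ).const_mul (64 / z ^ 2)
  have hd : HasDerivAt (fun s => rayDiff (kern (mlKern ρ s))) (rayDiff (kern (q' z))) z := by
    refine hasDerivAt_rayDiff (S := Ioi (z / 2)) (Ioi_mem_nhds (by linarith)) (fun y hy s hs => ?_)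
      (fun y hy => ?_) (fun y hy => ?_) hB hb fun y hy x s hs => ?_
    · have hs' : z / 2 < s := hs
      have := IsRay.continuous_exp_mul_line (y := y) ρ
      unfold mlKern
      exact this.div (by fun_prop) fun x => hne y hy x s (by linarith)
    · refine hy.integrable_kern (C := 4 / z) hρ ?_ fun x => ?_
      · have := IsRay.continuous_exp_mul_line (y := y) ρ
        unfold mlKern
        exact this.div (by fun_prop) fun x => hne y hy x z hz
      · simpa using norm_mlKern_le' hρ.le (by linarith : ρ ≤ 5 / 4) hz (hy.abs_im_le x)
    · have := IsRay.continuous_exp_mul_line (y := y) ρ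
      exact this.neg.div (by fun_prop) fun x => pow_ne_zero 2 (hne y hy x z hz)
    · have hs' : z / 2 < s := hs
      have h1 : HasDerivAt (fun s : ℝ => Complex.exp (ρ * lineAt y x) + (s : ℂ)) 1 s :=
        (hasDerivAt_id s).ofReal_comp.const_add _
      have h2 := (hasDerivAt_const s (Complex.exp (ρ * lineAt y x))).div h1
        (hne y hy x s (by linarith))
      convert! h2 using 1
      simp [hq']
  have hd2 : HasDerivAt (fun s : ℝ => 2 * Real.pi * Complex.I * (mittagLeffler ρ (-s) : ℂ))
      (2 * Real.pi * Complex.I * ((mittagLefflerDeriv ρ (-z) * -1 : ℝ) : ℂ)) z :=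
    ((hasDerivAt_mittagLeffler hρ (-z)).comp z (hasDerivAt_neg z)).ofReal_comp.const_mul _
  have heq : rayDiff (kern (q' z)) =
      2 * Real.pi * Complex.I * ((mittagLefflerDeriv ρ (-z) * -1 : ℝ) : ℂ) := by
    refine hd.unique (hd2.congr_of_eventuallyEq ?_)
    filter_upwards [Ioi_mem_nhds hz] with s hs
    exact mittagLeffler_eq_rayDiff hρ hρ' hs
  have h := norm_rayDiff_le hB fun y hy x => hb y hy x z (by change z / 2 < z; linarith)
  rw [heq, integral_const_mul] at h
  change _ ≤ 2 * (64 / z ^ 2 * rayMass ρ) at h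
  simp only [norm_mul, Complex.norm_real, Complex.norm_I, Complex.norm_ofNat, mul_one,
    Real.norm_eq_abs, abs_of_pos Real.pi_pos, abs_neg, abs_one] at h
  have h1 : 1 ≤ Real.pi := by linarith [Real.pi_gt_three]
  have h2 : |mittagLefflerDeriv ρ (-z)| ≤ Real.pi * |mittagLefflerDeriv ρ (-z)| :=
    le_mul_of_one_le_left (abs_nonneg _) h1
  calc _ ≤ 64 / z ^ 2 * rayMass ρ := by linarith
    _ = _ := by ring

/-- `|E_ρ(-z)| ≤ C` and `z |E_ρ(-z)| ≤ C` for `z ≥ 0`. -/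
lemma exists_mittagLeffler_bound {ρ : ℝ} (hρ : 0 < ρ) (hρ' : ρ ≤ 1) :
    ∃ C, 0 < C ∧ ∀ z, 0 ≤ z → |mittagLeffler ρ (-z)| ≤ C ∧ z * |mittagLeffler ρ (-z)| ≤ C := by
  obtain ⟨K, hK⟩ := (isCompact_Icc (a := (0 : ℝ)) (b := 1)).exists_bound_of_continuousOn
    (f := fun z => mittagLeffler ρ (-z)) ((continuous_mittagLeffler hρ).comp
      continuous_neg).continuousOn
  have hK0 : 0 ≤ K := (norm_nonneg _).trans (hK 0 (by simp))
  have hm : 0 ≤ rayMass ρ := integral_nonneg fun x => by positivity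
  refine ⟨K + 4 * rayMass ρ + 1, by positivity, fun z hz => ?_⟩
  rcases le_total z 1 with h | h
  · have := hK z ⟨hz, h⟩
    rw [Real.norm_eq_abs] at this
    exact ⟨by linarith, by nlinarith [abs_nonneg (mittagLeffler ρ (-z))]⟩
  · have h0 : 0 < z := by linarith
    have h1 := abs_mittagLeffler_neg_le hρ hρ' h0
    rw [le_div_iff₀ h0] at h1
    exact ⟨by nlinarith [abs_nonneg (mittagLeffler ρ (-z))], by linarith⟩

/-- `z |E_ρ'(-z)| ≤ C z^δ` for `z ≥ 0` and `0 ≤ δ ≤ 1`. -/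
lemma exists_mittagLefflerDeriv_bound {ρ : ℝ} (hρ : 0 < ρ) (hρ' : ρ ≤ 1) :
    ∃ C, 0 < C ∧ ∀ δ ∈ Icc (0 : ℝ) 1, ∀ z, 0 < z → z * |mittagLefflerDeriv ρ (-z)| ≤ C * z ^ δ := by
  obtain ⟨K, hK⟩ := (isCompact_Icc (a := (0 : ℝ)) (b := 1)).exists_bound_of_continuousOn
    (f := fun z => mittagLefflerDeriv ρ (-z)) ((continuous_mittagLefflerDeriv hρ).comp
      continuous_neg).continuousOn
  have hK0 : 0 ≤ K := (norm_nonneg _).trans (hK 0 (by simp))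
  have hm : 0 ≤ rayMass ρ := integral_nonneg fun x => by positivity
  refine ⟨K + 64 * rayMass ρ + 1, by positivity, fun δ hδ z hz => ?_⟩
  rcases le_total z 1 with h | h
  · have h1 := hK z ⟨hz.le, h⟩
    rw [Real.norm_eq_abs] at h1
    have h2 : z ≤ z ^ δ := by
      simpa using Real.rpow_le_rpow_of_exponent_ge hz h hδ.2
    calc _ ≤ z ^ δ * K := by gcongr
      _ ≤ _ := by rw [mul_comm]; gcongr; linarith
  · have h1 := abs_mittagLefflerDeriv_neg_le hρ hρ' hz
    rw [le_div_iff₀ (by positivity)] at h1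
    have h2 : 1 ≤ z ^ δ := Real.one_le_rpow h hδ.1
    have h3 : z * |mittagLefflerDeriv ρ (-z)| ≤ 64 * rayMass ρ := by
      nlinarith [abs_nonneg (mittagLefflerDeriv ρ (-z)), mul_nonneg hz.le
        (abs_nonneg (mittagLefflerDeriv ρ (-z)))]
    nlinarith

/-! ### Monotonicity of the Mittag-Leffler function in its order -/

lemma Gamma_le_one_of_mem_Icc {x : ℝ} (h1 : 1 ≤ x) (h2 : x ≤ 2) : Real.Gamma x ≤ 1 := by
  have := Real.convexOn_Gamma.le_max_of_mem_Icc (show (1 : ℝ) ∈ Ioi 0 by simp)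
    (show (2 : ℝ) ∈ Ioi 0 by simp) ⟨h1, h2⟩
  simpa using this

/-- By convexity the derivative is at most the slope over [x, x+1], which is Γ(x+1) - Γ(x) = (x - 1)
Γ(x). -/
lemma deriv_Gamma_le {x : ℝ} (hx : 0 < x) : deriv Real.Gamma x ≤ (x - 1) * Real.Gamma x := by
  have hd : DifferentiableAt ℝ Real.Gamma x := Real.differentiableAt_Gamma fun m => by
    have : (0 : ℝ) ≤ m := m.cast_nonneg
    intro h; linarith
  have := Real.convexOn_Gamma.deriv_le_slope (x := x) (y := x + 1) hx
    (show 0 < x + 1 by linarith) (by linarith) hd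
  rw [slope_def_field, Real.Gamma_add_one hx.ne'] at this
  calc _ ≤ _ := this
    _ = _ := by field_simp; ring

/-- The leading term `t^{-ρ} / Γ(1 - ρ)` of `λ E_ρ(-λ t^ρ)`; here `L = log t`. -/
def mlLead (L ρ : ℝ) : ℝ := Real.exp (-(ρ * L)) * ((1 - ρ) * (Real.Gamma (2 - ρ))⁻¹)

/-- Writing 1/Γ(1-ρ) as (1-ρ)/g with g = Γ(2-ρ) removes the singularity at ρ = 1. The derivative of
e^{-ρL} contributes a nonpositive term. For the other factor, g' ≤ (1-ρ) g and g ≤ 1 give -1/g +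
(1-ρ) g'/g² ≤ -(1 - (1-ρ)²)/g = -ρ(2-ρ)/g ≤ -ρ. -/
lemma exists_hasDerivAt_mlLead {L ρ : ℝ} (hL : 0 ≤ L) (hρ : 0 < ρ) (hρ' : ρ ≤ 1) :
    ∃ D, HasDerivAt (mlLead L) D ρ ∧ D ≤ -ρ * Real.exp (-(ρ * L)) := by
  have hd : DifferentiableAt ℝ Real.Gamma (2 - ρ) := Real.differentiableAt_Gamma fun m => by
    have : (0 : ℝ) ≤ m := m.cast_nonneg
    intro h; linarith
  have hG : 0 < Real.Gamma (2 - ρ) := Real.Gamma_pos_of_pos (by linarith)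
  have h1 : HasDerivAt (fun ρ => Real.Gamma (2 - ρ)) (deriv Real.Gamma (2 - ρ) * -1) ρ :=
    hd.hasDerivAt.comp ρ ((hasDerivAt_id ρ).const_sub 2)
  have h2 : HasDerivAt (fun ρ => Real.exp (-(ρ * L))) (Real.exp (-(ρ * L)) * (-(1 * L))) ρ :=
    ((hasDerivAt_id ρ).mul_const L).neg.exp
  have h3 := h2.mul (((hasDerivAt_id ρ).const_sub 1).mul (h1.inv hG.ne'))
  refine ⟨_, h3, ?_⟩
  have h4 := deriv_Gamma_le (show 0 < 2 - ρ by linarith)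
  have h5 := Gamma_le_one_of_mem_Icc (x := 2 - ρ) (by linarith) (by linarith)
  set g := Real.Gamma (2 - ρ)
  set g' := deriv Real.Gamma (2 - ρ)
  have h6 : 1 ≤ g⁻¹ := (one_le_inv₀ hG).2 h5
  have h7 : g' / g ^ 2 ≤ (1 - ρ) * g⁻¹ := by
    rw [div_le_iff₀ (by positivity)]
    calc g' ≤ (2 - ρ - 1) * g := h4
      _ = _ := by field_simp; ring
  simp only [id, Pi.mul_apply, Pi.inv_apply]
  have h8 : Real.exp (-(ρ * L)) * -(1 * L) * ((1 - ρ) * g⁻¹) ≤ 0 := by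
    have : 0 ≤ Real.exp (-(ρ * L)) * L * ((1 - ρ) * g⁻¹) :=
      mul_nonneg (mul_nonneg (Real.exp_pos _).le hL) (mul_nonneg (by linarith) (by linarith))
    linarith
  have h9 : -1 * g⁻¹ + (1 - ρ) * (-(g' * -1) / g ^ 2) ≤ -ρ := by
    have : (1 - ρ) * (-(g' * -1) / g ^ 2) ≤ (1 - ρ) * ((1 - ρ) * g⁻¹) := by
      refine mul_le_mul_of_nonneg_left ?_ (by linarith)
      simpa using h7
    nlinarith [mul_nonneg hρ.le (by linarith : (0 : ℝ) ≤ 1 - ρ)]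
  have h10 := mul_le_mul_of_nonneg_left h9 (Real.exp_pos (-(ρ * L))).le
  linarith

/-- `e^{ρ (w - L)}`. -/
def shiftExp (L ρ : ℝ) (w : ℂ) : ℂ := Complex.exp (ρ * (w - L))

/-- The contour integrand of the remainder of `λ E_ρ(-λ t^ρ)` after its leading term. -/
def mlRem (lam L ρ : ℝ) (w : ℂ) : ℂ := shiftExp L ρ w ^ 2 / (shiftExp L ρ w + lam)

/-- The derivative of `mlRem` in `ρ`. -/
def mlRemDeriv (lam L ρ : ℝ) (w : ℂ) : ℂ :=
  (w - L) * (2 * shiftExp L ρ w ^ 2 / (shiftExp L ρ w + lam) -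
    shiftExp L ρ w ^ 3 / (shiftExp L ρ w + lam) ^ 2)

lemma norm_shiftExp (L ρ : ℝ) (w : ℂ) : ‖shiftExp L ρ w‖ = Real.exp (ρ * (w.re - L)) := by
  rw [shiftExp, norm_exp_ofReal_mul]; simp

lemma norm_shiftExp_add_ge {lam L ρ : ℝ} (hlam : 0 < lam) (hρ : 0 ≤ ρ) (hρ' : ρ ≤ 5 / 4) {w : ℂ}
    (hw : |w.im| ≤ ang) : (‖shiftExp L ρ w‖ + lam) / 4 ≤ ‖shiftExp L ρ w + lam‖ := by
  have := norm_exp_add_ge hρ hρ' hlam.le (w := w - L) (by simpa using hw)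
  rw [norm_shiftExp]
  simpa [shiftExp] using this

lemma shiftExp_add_ne_zero {lam L ρ : ℝ} (hlam : 0 < lam) (hρ : 0 ≤ ρ) (hρ' : ρ ≤ 5 / 4) {w : ℂ}
    (hw : |w.im| ≤ ang) : shiftExp L ρ w + lam ≠ 0 :=
  norm_pos_iff.1 (lt_of_lt_of_le (by positivity) (norm_shiftExp_add_ge hlam hρ hρ' hw))

lemma hasDerivAt_mlRem {lam L ρ : ℝ} (hlam : 0 < lam) (hρ : 0 ≤ ρ) (hρ' : ρ ≤ 5 / 4) {w : ℂ}
    (hw : |w.im| ≤ ang) :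
    HasDerivAt (fun ρ => mlRem lam L ρ w) (mlRemDeriv lam L ρ w) ρ := by
  have h0 := shiftExp_add_ne_zero (L := L) hlam hρ hρ' hw
  have h1 : HasDerivAt (fun ρ => shiftExp L ρ w) (shiftExp L ρ w * (1 * (w - L))) ρ :=
    ((hasDerivAt_id ρ).ofReal_comp.mul_const (w - L)).cexp
  have h2 := (h1.pow 2).div (h1.add_const (lam : ℂ)) h0
  convert! h2 using 1
  simp only [mlRemDeriv, Pi.pow_apply]
  generalize shiftExp L ρ w = p at h0 ⊢
  field_simp
  push_cast
  ring

/-- A function that dominates `mlRemDeriv` along the contour, up to constants. -/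
def remBound (κ x : ℝ) : ℝ :=
  ((Real.exp (κ * x) + Real.exp (-κ * x)) / κ + 3) * (Real.exp (2 * κ * x) + Real.exp (3 * x)) *
    Real.exp (-Real.exp x / 2)

lemma integrable_remBound {κ : ℝ} (hκ : 0 < κ) (hκ' : κ < 1) : Integrable (remBound κ) := by
  have h1 := ((integrable_exp_mul_weight (m := 3 * κ) (by linarith)).add
    (integrable_exp_mul_weight (m := κ + 3) (by linarith))).const_mul κ⁻¹
  have h2 := ((integrable_exp_mul_weight (m := κ) (by linarith)).add
    (integrable_exp_mul_weight (m := 3 - κ) (by linarith))).const_mul κ⁻¹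
  have h3 := ((integrable_exp_mul_weight (m := 2 * κ) (by linarith)).add
    (integrable_exp_mul_weight (m := 3) (by linarith))).const_mul 3
  refine ((h1.add h2).add h3).congr (Eventually.of_forall fun x => ?_)
  simp only [Pi.add_apply, remBound]
  have e1 : Real.exp (3 * κ * x) = Real.exp (κ * x) * Real.exp (2 * κ * x) := by
    rw [← Real.exp_add]; congr 1; ring
  have e2 : Real.exp ((κ + 3) * x) = Real.exp (κ * x) * Real.exp (3 * x) := by
    rw [← Real.exp_add]; congr 1; ring
  have e3 : Real.exp (κ * x) = Real.exp (-κ * x) * Real.exp (2 * κ * x) := by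
    rw [← Real.exp_add]; congr 1; ring
  have e4 : Real.exp ((3 - κ) * x) = Real.exp (-κ * x) * Real.exp (3 * x) := by
    rw [← Real.exp_add]; congr 1; ring
  rw [e1, e2, e4]
  nth_rw 3 [e3]
  field_simp

/-- The remainder is quadratic in s = e^{ρ(w-L)}, so its derivative carries |s|², that is e^{-2ρL} =
t^{-2ρ}, against t^{-ρ} for the leading term. The factor 1 + L comes from differentiating the
exponent ρ(w - L). -/
lemma norm_mlRemDeriv_le {lam L ρ κ : ℝ} (hlam : 0 < lam) (hL : 0 ≤ L) (hκ : 0 < κ) (hρ : κ ≤ ρ)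
    (hρ' : ρ ≤ 5 / 4) {y : ℝ} (hy : IsRay y) (x : ℝ) :
    Real.exp (-Real.exp x / 2) * ‖mlRemDeriv lam L ρ (lineAt y x)‖ ≤
      (24 / lam * (1 + L) * Real.exp (-(2 * ρ * L))) * remBound κ x := by
  have hge := norm_shiftExp_add_ge (L := L) hlam (by linarith) hρ' (hy.abs_im_le x)
  have hnorm := norm_shiftExp L ρ (lineAt y x)
  rw [lineAt_re] at hnorm
  set p := shiftExp L ρ (lineAt y x) with hp
  have hp0 : 0 < ‖p‖ := by rw [hnorm]; positivity
  have hd0 : 0 < ‖p + lam‖ := by linarith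
  have h1 : ‖2 * p ^ 2 / (p + lam) - p ^ 3 / (p + lam) ^ 2‖ ≤ 24 / lam * ‖p‖ ^ 2 := by
    have hinv : 1 / ‖p + lam‖ ≤ 4 / lam := by
      rw [div_le_div_iff₀ hd0 hlam]; linarith
    have hquo : ‖p‖ / ‖p + lam‖ ≤ 4 := by
      rw [div_le_iff₀ hd0]; linarith
    refine (norm_sub_le _ _).trans ?_
    simp only [norm_div, norm_mul, norm_pow, Complex.norm_ofNat]
    calc 2 * ‖p‖ ^ 2 / ‖p + lam‖ + ‖p‖ ^ 3 / ‖p + lam‖ ^ 2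
        = ‖p‖ ^ 2 * (2 * (1 / ‖p + lam‖) + ‖p‖ / ‖p + lam‖ * (1 / ‖p + lam‖)) := by
          field_simp
      _ ≤ ‖p‖ ^ 2 * (2 * (4 / lam) + 4 * (4 / lam)) := by gcongr
      _ = _ := by ring
  have h2 : ‖lineAt y x - L‖ ≤
      ((Real.exp (κ * x) + Real.exp (-κ * x)) / κ + 3) * (1 + L) := by
    have h3 : ‖lineAt y x - L‖ ≤ |x| + 3 + L := by
      have : lineAt y x - L = ((x : ℝ) : ℂ) + (y : ℂ) * Complex.I - ((L : ℝ) : ℂ) := rfl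
      rw [this]
      refine (norm_sub_le _ _).trans (add_le_add ((norm_add_le _ _).trans (add_le_add ?_ ?_)) ?_)
      · rw [Complex.norm_real, Real.norm_eq_abs]
      · rw [norm_mul, Complex.norm_I, mul_one, Complex.norm_real, Real.norm_eq_abs, hy.abs_eq]
        exact ang_le
      · rw [Complex.norm_real, Real.norm_eq_abs, abs_of_nonneg hL]
    have h4 : |x| ≤ (Real.exp (κ * x) + Real.exp (-κ * x)) / κ := by
      rw [le_div_iff₀ hκ]
      rcases abs_cases x with ⟨h, _⟩ | ⟨h, _⟩ <;> rw [h]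
      · linarith [Real.add_one_le_exp (κ * x), Real.exp_pos (-κ * x)]
      · linarith [Real.add_one_le_exp (-κ * x), Real.exp_pos (κ * x)]
    nlinarith [abs_nonneg x]
  have h3 : ‖p‖ ^ 2 ≤ Real.exp (-(2 * ρ * L)) * (Real.exp (2 * κ * x) + Real.exp (3 * x)) := by
    -- This makes the bound uniform over κ ≤ ρ ≤ 5/4: the first term dominates for x ≤ 0 and the
    -- second, as 2ρ ≤ 3, for x ≥ 0.
    have h4 : Real.exp (2 * ρ * x) ≤ Real.exp (2 * κ * x) + Real.exp (3 * x) := by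
      rcases le_total 0 x with hx | hx
      · refine (Real.exp_le_exp.2 ?_).trans (le_add_of_nonneg_left (Real.exp_pos _).le)
        nlinarith
      · refine (Real.exp_le_exp.2 ?_).trans (le_add_of_nonneg_right (Real.exp_pos _).le)
        nlinarith
    rw [hnorm, ← Real.exp_nat_mul]
    calc _ = Real.exp (-(2 * ρ * L)) * Real.exp (2 * ρ * x) := by
          rw [← Real.exp_add]; congr 1; push_cast; ring
      _ ≤ _ := by gcongr
  rw [mlRemDeriv, ← hp, norm_mul]
  calc _ ≤ Real.exp (-Real.exp x / 2) * ((((Real.exp (κ * x) + Real.exp (-κ * x)) / κ + 3) *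
        (1 + L)) * (24 / lam * (Real.exp (-(2 * ρ * L)) *
          (Real.exp (2 * κ * x) + Real.exp (3 * x))))) := by
        gcongr
        exact h1.trans (by gcongr)
    _ = _ := by rw [remBound]; ring

lemma IsRay.continuous_shiftExp {y : ℝ} (L ρ : ℝ) :
    Continuous fun x => shiftExp L ρ (lineAt y x) := by
  have := continuous_lineAt y
  unfold shiftExp
  fun_prop

lemma IsRay.continuous_mlRem {y : ℝ} (hy : IsRay y) {lam L ρ : ℝ} (hlam : 0 < lam) (hρ : 0 ≤ ρ)
    (hρ' : ρ ≤ 5 / 4) : Continuous fun x => mlRem lam L ρ (lineAt y x) := by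
  have := IsRay.continuous_shiftExp (y := y) L ρ
  unfold mlRem
  exact (this.pow 2).div (this.add continuous_const) fun x =>
    shiftExp_add_ne_zero hlam hρ hρ' (hy.abs_im_le x)

lemma IsRay.integrable_mlRem {y : ℝ} (hy : IsRay y) {lam L ρ : ℝ} (hlam : 0 < lam) (hρ : 0 < ρ)
    (hρ' : ρ ≤ 5 / 4) : Integrable fun x => kern (mlRem lam L ρ) (lineAt y x) := by
  refine hy.integrable_kern (C := 4 * Real.exp (-(ρ * L))) hρ
    (hy.continuous_mlRem hlam hρ.le hρ') fun x => ?_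
  have hge := norm_shiftExp_add_ge (L := L) hlam hρ.le hρ' (hy.abs_im_le x)
  have h0 := norm_nonneg (shiftExp L ρ (lineAt y x))
  have hnorm := norm_shiftExp L ρ (lineAt y x)
  rw [lineAt_re] at hnorm
  rw [mlRem, norm_div, norm_pow, div_le_iff₀ (by linarith)]
  have : 4 * Real.exp (-(ρ * L)) * Real.exp (ρ * x) = 4 * ‖shiftExp L ρ (lineAt y x)‖ := by
    rw [hnorm, mul_assoc, ← Real.exp_add]; congr 2; ring
  rw [this]
  nlinarith

/-- `λ E_ρ(-λ t^ρ)`, in a form that is differentiable in `ρ` beyond `ρ = 1`; here `L = log t`. -/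
def mlOrder (lam L ρ : ℝ) : ℝ :=
  mlLead L ρ - (rayDiff (kern (mlRem lam L ρ)) / (2 * Real.pi * Complex.I)).re

/-- With s = p / t^ρ the contour integrand satisfies λ p/(p + λ t^ρ) = λ s/(s + λ) = s - s²/(s + λ),
and by the reflection formula s integrates to 2πi t^{-ρ} / Γ(1-ρ). -/
lemma mittagLeffler_eq_mlOrder {lam t ρ : ℝ} (hlam : 0 < lam) (ht : 0 < t) (hρ : 0 < ρ)
    (hρ' : ρ ≤ 1) :
    lam * mittagLeffler ρ (-(lam * t ^ ρ)) = mlOrder lam (Real.log t) ρ := by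
  set L := Real.log t with hL
  have htρ : t ^ ρ = Real.exp (ρ * L) := by rw [Real.rpow_def_of_pos ht, mul_comm]
  have hz : 0 < lam * t ^ ρ := by positivity
  have h1 := mittagLeffler_eq_rayDiff hρ hρ' hz
  have hid : ∀ y, IsRay y → ∀ x, kern (mlKern ρ (lam * t ^ ρ)) (lineAt y x) =
      (lam : ℂ)⁻¹ * ((Real.exp (-(ρ * L)) : ℝ) * kern (fun w => Complex.exp (ρ * w)) (lineAt y x) -
        kern (mlRem lam L ρ) (lineAt y x)) := by
    intro y hy x
    have hne := shiftExp_add_ne_zero (L := L) hlam hρ.le (by linarith) (hy.abs_im_le x)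
    have hp : Complex.exp (ρ * lineAt y x) =
        shiftExp L ρ (lineAt y x) * (Real.exp (ρ * L) : ℝ) := by
      rw [shiftExp, Complex.ofReal_exp, ← Complex.exp_add]; congr 1; push_cast; ring
    have he : (Real.exp (-(ρ * L)) : ℝ) * (Real.exp (ρ * L) : ℝ) = (1 : ℂ) := by
      rw [← Complex.ofReal_mul, ← Real.exp_add]; simp
    have he0 : ((Real.exp (ρ * L) : ℝ) : ℂ) ≠ 0 := by
      exact_mod_cast (Real.exp_pos (ρ * L)).ne'
    have hl0 : (lam : ℂ) ≠ 0 := by exact_mod_cast hlam.ne'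
    simp only [kern, mlKern, mlRem]
    rw [htρ, hp, Complex.ofReal_mul]
    generalize shiftExp L ρ (lineAt y x) = p at hne ⊢
    generalize ((Real.exp (ρ * L) : ℝ) : ℂ) = e at he he0 ⊢
    rw [show p * e + lam * e = e * (p + lam) by ring, mul_comm p e, mul_div_mul_left _ _ he0,
      show ((Real.exp (-(ρ * L)) : ℝ) : ℂ) * (Complex.exp (Complex.exp (lineAt y x)) * (e * p)) =
        ((Real.exp (-(ρ * L)) : ℝ) * e) * (Complex.exp (Complex.exp (lineAt y x)) * p) by ring, he]
    field_simp
    ring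
  have hray : ∀ y, IsRay y → ∫ x, kern (mlKern ρ (lam * t ^ ρ)) (lineAt y x) =
      (lam : ℂ)⁻¹ * ((Real.exp (-(ρ * L)) : ℝ) *
        (∫ x, kern (fun w => Complex.exp (ρ * w)) (lineAt y x)) -
        ∫ x, kern (mlRem lam L ρ) (lineAt y x)) := by
    intro y hy
    rw [← integral_const_mul, ← integral_sub ((integrable_kern_exp hρ (by rw [hy.cos_eq])).const_mul
      _) (hy.integrable_mlRem hlam hρ (by linarith)), ← integral_const_mul]
    exact integral_congr_ae (Eventually.of_forall (hid y hy))
  have h2 : rayDiff (kern (mlKern ρ (lam * t ^ ρ))) = (lam : ℂ)⁻¹ * ((Real.exp (-(ρ * L)) : ℝ) *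
      rayDiff (kern fun w => Complex.exp (ρ * w)) - rayDiff (kern (mlRem lam L ρ))) := by
    unfold rayDiff
    rw [hray _ isRay_ang, hray _ isRay_neg_ang]
    ring
  -- At ρ = 1 both sides are 0; on the left this uses the conventions Γ(0) = 0 and π / 0 = 0, which
  -- agree with the limit.
  have hG : Real.pi / Real.Gamma (1 - ρ) = Real.pi * ((1 - ρ) * (Real.Gamma (2 - ρ))⁻¹) := by
    rcases hρ'.lt_or_eq with h | rfl
    · rw [show (2 : ℝ) - ρ = (1 - ρ) + 1 by ring, Real.Gamma_add_one (by linarith)]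
      have := (Real.Gamma_pos_of_pos (show 0 < 1 - ρ by linarith)).ne'
      have : 1 - ρ ≠ 0 := by linarith
      field_simp
    · simp
  rw [h1, rayDiff_kern_exp hρ, Gamma_mul_sin_eq hρ, hG] at h2
  have hpi : (2 * Real.pi * Complex.I : ℂ) ≠ 0 := Complex.two_pi_I_ne_zero
  have hl0 : (lam : ℂ) ≠ 0 := by exact_mod_cast hlam.ne'
  have h3 : ((lam * mittagLeffler ρ (-(lam * t ^ ρ)) : ℝ) : ℂ) = (mlLead L ρ : ℝ) -
      rayDiff (kern (mlRem lam L ρ)) / (2 * Real.pi * Complex.I) := by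
    rw [eq_sub_iff_add_eq, ← eq_sub_iff_add_eq', div_eq_iff hpi]
    have h4 := congrArg (fun v => (lam : ℂ) * v) h2
    simp only [mul_inv_cancel_left₀ hl0] at h4
    rw [mlLead]
    push_cast at h4 ⊢
    linear_combination h4
  have h5 := congrArg Complex.re h3
  rw [Complex.ofReal_re, Complex.sub_re, Complex.ofReal_re] at h5
  exact h5

lemma exists_hasDerivAt_mlOrder {κ : ℝ} (hκ : 0 < κ) (hκ' : κ < 1) :
    ∃ K, 0 < K ∧ ∀ lam L ρ : ℝ, 0 < lam → 0 ≤ L → κ < ρ → ρ ≤ 1 →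
      ∃ D, HasDerivAt (mlOrder lam L) D ρ ∧ D ≤ Real.exp (-(ρ * L)) *
        (-ρ + K * (1 + L) * Real.exp (-(ρ * L)) / lam) := by
  have hI : 0 ≤ ∫ x, remBound κ x := integral_nonneg fun x => by unfold remBound; positivity
  refine ⟨24 * (∫ x, remBound κ x) + 1, by positivity, fun lam L ρ hlam hL hρ hρ' => ?_⟩
  obtain ⟨D, hD, hD'⟩ := exists_hasDerivAt_mlLead hL (hκ.trans hρ) hρ'
  have hR : HasDerivAt (fun s => rayDiff (kern (mlRem lam L s)))
      (rayDiff (kern (mlRemDeriv lam L ρ))) ρ := by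
    -- The interval extends beyond 1 so as to be a neighbourhood of ρ even when ρ = 1. The decay
    -- e^{-2ρL} is dropped from the dominating function, which must not depend on ρ, and recovered
    -- below at the single value of ρ.
    refine hasDerivAt_rayDiff (S := Ioo κ (5 / 4)) (Ioo_mem_nhds hρ (by linarith))
      (B := fun x => (24 / lam * (1 + L)) * remBound κ x) (fun y hy s hs => ?_) (fun y hy => ?_)
      (fun y hy => ?_) ((integrable_remBound hκ hκ').const_mul _) (fun y hy x s hs => ?_)
      (fun y hy x s hs => ?_)
    · exact hy.continuous_mlRem hlam (by linarith [hs.1]) hs.2.le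
    · exact hy.integrable_mlRem hlam (by linarith) (by linarith)
    · have h := IsRay.continuous_shiftExp (y := y) L ρ
      have hne := fun x => shiftExp_add_ne_zero (L := L) hlam (by linarith : 0 ≤ ρ)
        (by linarith) (hy.abs_im_le x)
      unfold mlRemDeriv
      refine ((continuous_lineAt y).sub continuous_const).mul (Continuous.sub ?_ ?_)
      · exact (continuous_const.mul (h.pow 2)).div (h.add continuous_const) hne
      · exact (h.pow 3).div ((h.add continuous_const).pow 2) fun x => pow_ne_zero 2 (hne x)
    · refine (norm_mlRemDeriv_le hlam hL hκ hs.1.le hs.2.le hy x).trans ?_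
      have hB : 0 ≤ remBound κ x := by unfold remBound; positivity
      refine mul_le_mul_of_nonneg_right (mul_le_of_le_one_right (by positivity) ?_) hB
      rw [Real.exp_le_one_iff]
      nlinarith [hs.1]
    · exact hasDerivAt_mlRem hlam (by linarith [hs.1]) hs.2.le (hy.abs_im_le x)
  have hnorm := norm_rayDiff_le ((integrable_remBound hκ hκ').const_mul _)
    fun y hy x => norm_mlRemDeriv_le hlam hL hκ hρ.le (by linarith : ρ ≤ 5 / 4) hy x
  rw [integral_const_mul] at hnorm
  have hR' := (Complex.reCLM.hasFDerivAt.comp_hasDerivAt ρ (hR.div_const (2 * Real.pi * Complex.I)))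
  refine ⟨_, hD.sub hR', ?_⟩
  have hre : |(rayDiff (kern (mlRemDeriv lam L ρ)) / (2 * Real.pi * Complex.I)).re| ≤
      (24 / lam * (1 + L) * Real.exp (-(2 * ρ * L))) * ∫ x, remBound κ x := by
    refine (Complex.abs_re_le_norm _).trans ?_
    have hpi : (1 : ℝ) ≤ Real.pi := by linarith [Real.pi_gt_three]
    simp only [norm_div, norm_mul, Complex.norm_ofNat, Complex.norm_real, Complex.norm_I, mul_one,
      Real.norm_eq_abs, abs_of_pos Real.pi_pos]
    rw [div_le_iff₀ (by positivity)]
    refine hnorm.trans ?_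
    have : 0 ≤ 24 / lam * (1 + L) * Real.exp (-(2 * ρ * L)) * ∫ x, remBound κ x := by positivity
    nlinarith
  have hexp : Real.exp (-(2 * ρ * L)) = Real.exp (-(ρ * L)) * Real.exp (-(ρ * L)) := by
    rw [← Real.exp_add]; congr 1; ring
  have h1 := (abs_le.1 hre).1
  change D - (rayDiff (kern (mlRemDeriv lam L ρ)) / (2 * Real.pi * Complex.I)).re ≤ _
  calc _ ≤ -ρ * Real.exp (-(ρ * L)) +
        (24 / lam * (1 + L) * Real.exp (-(2 * ρ * L))) * ∫ x, remBound κ x := by linarith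
    _ = Real.exp (-(ρ * L)) * (-ρ + (24 * ∫ x, remBound κ x) * (1 + L) *
          Real.exp (-(ρ * L)) / lam) := by rw [hexp]; ring
    _ ≤ _ := by gcongr; linarith

/-- For large `t` the function `ρ ↦ E_ρ(-λ t^ρ)` is continuous and strictly decreasing on
`[ρ₀, 1]`. -/
theorem exists_strictAntiOn_mittagLeffler {lam ρ₀ : ℝ} (hlam : 0 < lam) (hρ₀ : 0 < ρ₀)
    (hρ₀' : ρ₀ < 1) :
    ∃ T₀ : ℝ, 1 ≤ T₀ ∧ ∀ t, T₀ ≤ t →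
      ContinuousOn (fun ρ => mittagLeffler ρ (-(lam * t ^ ρ))) (Icc ρ₀ 1) ∧
      StrictAntiOn (fun ρ => mittagLeffler ρ (-(lam * t ^ ρ))) (Icc ρ₀ 1) := by
  -- Any κ strictly below ρ₀ would do, so that ρ₀ itself is an interior point.
  obtain ⟨K, hK, hder⟩ := exists_hasDerivAt_mlOrder (κ := ρ₀ / 2) (by linarith) (by linarith)
  have hlim : Tendsto (fun t : ℝ => K / lam * ((1 + Real.log t) * Real.exp (-(ρ₀ * Real.log t))))
      atTop (𝓝 0) := by
    have h1 : Tendsto (fun x : ℝ => (1 + x) * Real.exp (-(ρ₀ * x))) atTop (𝓝 0) := by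
      have h2 := tendsto_rpow_mul_exp_neg_mul_atTop_nhds_zero 0 ρ₀ hρ₀
      have h3 := tendsto_rpow_mul_exp_neg_mul_atTop_nhds_zero 1 ρ₀ hρ₀
      have h4 := h2.add h3
      rw [add_zero] at h4
      refine h4.congr fun x => ?_
      rw [Real.rpow_zero, Real.rpow_one, neg_mul]; ring
    simpa using (h1.comp Real.tendsto_log_atTop).const_mul (K / lam)
  -- Beyond this time the remainder term, which is largest at ρ = ρ₀, is below ρ₀ ≤ ρ, so the
  -- derivative is negative on the whole interval. The maximum with 1 ensures log t ≥ 0.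
  obtain ⟨T₁, hT₁⟩ := eventually_atTop.1 (hlim.eventually_lt_const hρ₀)
  refine ⟨max T₁ 1, le_max_right _ _, fun t ht => ?_⟩
  have ht1 : 1 ≤ t := (le_max_right _ _).trans ht
  have hL : 0 ≤ Real.log t := Real.log_nonneg ht1
  have hlt := hT₁ t ((le_max_left _ _).trans ht)
  have heq : EqOn (fun ρ => mittagLeffler ρ (-(lam * t ^ ρ)))
      (fun ρ => lam⁻¹ * mlOrder lam (Real.log t) ρ) (Icc ρ₀ 1) := fun ρ hρ => by
    simp only
    rw [← mittagLeffler_eq_mlOrder hlam (by linarith) (by linarith [hρ.1]) hρ.2,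
      inv_mul_cancel_left₀ hlam.ne']
  have hcont : ContinuousOn (mlOrder lam (Real.log t)) (Icc ρ₀ 1) := fun ρ hρ => by
    obtain ⟨D, hD, -⟩ := hder lam (Real.log t) ρ hlam hL (by linarith [hρ.1]) hρ.2
    exact hD.continuousAt.continuousWithinAt
  have hanti : StrictAntiOn (mlOrder lam (Real.log t)) (Icc ρ₀ 1) := by
    refine strictAntiOn_of_deriv_neg (convex_Icc _ _) hcont fun ρ hρ => ?_
    rw [interior_Icc] at hρ
    obtain ⟨D, hD, hD'⟩ := hder lam (Real.log t) ρ hlam hL (by linarith [hρ.1]) hρ.2.le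
    rw [hD.deriv]
    refine hD'.trans_lt (mul_neg_of_pos_of_neg (Real.exp_pos _) ?_)
    have h1 : Real.exp (-(ρ * Real.log t)) ≤ Real.exp (-(ρ₀ * Real.log t)) :=
      Real.exp_le_exp.2 (by nlinarith [hρ.1])
    have h2 : K * (1 + Real.log t) * Real.exp (-(ρ * Real.log t)) / lam ≤
        K / lam * ((1 + Real.log t) * Real.exp (-(ρ₀ * Real.log t))) := by
      calc _ = K / lam * ((1 + Real.log t) * Real.exp (-(ρ * Real.log t))) := by ring
        _ ≤ _ := by gcongr
    linarith [hρ.1]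
  refine ⟨(hcont.const_smul lam⁻¹).congr heq, fun a ha b hb hab => ?_⟩
  rw [heq ha, heq hb]
  exact mul_lt_mul_of_pos_left (hanti ha hb hab) (inv_pos.2 hlam)

/-! ### Fractional integrals of powers -/

lemma integral_sub_rpow_mul_rpow {a b t : ℝ} (ha : 0 < a) (hb : 0 < b) (ht : 0 < t) :
    ∫ s in (0 : ℝ)..t, (t - s) ^ (b - 1) * s ^ (a - 1) =
      t ^ (a + b - 1) * (Real.Gamma a * Real.Gamma b / Real.Gamma (a + b)) := by
  have h1 := Complex.betaIntegral_scaled a b ht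
  have h2 := Complex.Gamma_mul_Gamma_eq_betaIntegral (s := a) (t := b) (by simpa) (by simpa)
  have h3 : (Complex.Gamma (a + b : ℂ)) ≠ 0 := Complex.Gamma_ne_zero_of_re_pos (by simp; linarith)
  apply Complex.ofReal_injective
  rw [← intervalIntegral.integral_ofReal]
  have h4 : ∫ s in (0 : ℝ)..t, (((t - s) ^ (b - 1) * s ^ (a - 1) : ℝ) : ℂ) =
      ∫ x in (0 : ℝ)..t, (x : ℂ) ^ ((a : ℂ) - 1) * ((t : ℂ) - x) ^ ((b : ℂ) - 1) := by
    refine intervalIntegral.integral_congr fun s hs => ?_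
    rw [uIcc_of_le ht.le] at hs
    rw [Complex.ofReal_mul, Complex.ofReal_cpow (by linarith [hs.2]), Complex.ofReal_cpow hs.1]
    push_cast
    ring
  rw [h4, h1, Complex.ofReal_mul, Complex.ofReal_cpow ht.le]
  push_cast
  rw [← Complex.Gamma_ofReal, ← Complex.Gamma_ofReal, ← Complex.Gamma_ofReal]
  push_cast
  rw [h2]
  field_simp

/-- The integral of a non-integrable function is 0 by convention, so the nonzero Beta value already
implies integrability. -/
lemma intervalIntegrable_sub_rpow_mul_rpow {a b t : ℝ} (ha : 0 < a) (hb : 0 < b) (ht : 0 < t) :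
    IntervalIntegrable (fun s => (t - s) ^ (b - 1) * s ^ (a - 1)) volume 0 t := by
  refine intervalIntegral.intervalIntegrable_of_integral_ne_zero ?_
  rw [integral_sub_rpow_mul_rpow ha hb ht]
  have := Real.Gamma_pos_of_pos ha
  have := Real.Gamma_pos_of_pos hb
  have := Real.Gamma_pos_of_pos (add_pos ha hb)
  positivity

/-! ### The time factor `E_ρ(-λ t^ρ)` -/

/-- The time factor `E_ρ(-λ t^ρ)`. -/
def mlTime (ρ lam t : ℝ) : ℝ := mittagLeffler ρ (-(lam * t ^ ρ))

/-- The derivative in `t` of the time factor. -/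
def mlTimeDeriv (ρ lam t : ℝ) : ℝ :=
  mittagLefflerDeriv ρ (-(lam * t ^ ρ)) * -(lam * (ρ * t ^ (ρ - 1)))

lemma hasDerivAt_mlTime {ρ : ℝ} (hρ : 0 < ρ) (lam : ℝ) {t : ℝ} (ht : 0 < t) :
    HasDerivAt (mlTime ρ lam) (mlTimeDeriv ρ lam t) t :=
  (hasDerivAt_mittagLeffler hρ _).comp t
    ((Real.hasDerivAt_rpow_const (Or.inl ht.ne')).const_mul lam).neg

lemma mlTime_zero {ρ : ℝ} (hρ : 0 < ρ) (lam : ℝ) : mlTime ρ lam 0 = 1 := by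
  rw [mlTime, Real.zero_rpow hρ.ne', mul_zero, neg_zero, mittagLeffler_zero]

lemma continuous_mlTime {ρ : ℝ} (hρ : 0 < ρ) :
    Continuous (fun p : ℝ × ℝ => mlTime ρ p.1 p.2) := by
  refine (continuous_mittagLeffler hρ).comp (Continuous.neg (continuous_fst.mul ?_))
  exact continuous_snd.rpow_const fun _ => Or.inr hρ.le

lemma measurable_mlTimeDeriv {ρ : ℝ} (hρ : 0 < ρ) :
    Measurable (fun p : ℝ × ℝ => mlTimeDeriv ρ p.1 p.2) := by
  have := (continuous_mittagLefflerDeriv hρ).measurable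
  unfold mlTimeDeriv
  fun_prop

lemma exists_mlTime_bound {ρ : ℝ} (hρ : 0 < ρ) (hρ' : ρ ≤ 1) :
    ∃ C, 0 < C ∧ ∀ lam t, 0 ≤ lam → 0 ≤ t →
      |mlTime ρ lam t| ≤ C ∧ lam * t ^ ρ * |mlTime ρ lam t| ≤ C := by
  obtain ⟨C, hC, h⟩ := exists_mittagLeffler_bound hρ hρ'
  exact ⟨C, hC, fun lam t hl ht => h _ (by positivity)⟩

/-- A trade-off between frequency and time: a small δ > 0 costs only λ^δ, which the transform of a
Sobolev function can bear, and yet leaves t^{ρδ-1} integrable at t = 0. -/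
lemma exists_mlTimeDeriv_bound {ρ : ℝ} (hρ : 0 < ρ) (hρ' : ρ ≤ 1) :
    ∃ C, 0 < C ∧ ∀ δ ∈ Icc (0 : ℝ) 1, ∀ lam t, 0 < lam → 0 < t →
      |mlTimeDeriv ρ lam t| ≤ C * lam ^ δ * t ^ (ρ * δ - 1) := by
  obtain ⟨C, hC, h⟩ := exists_mittagLefflerDeriv_bound hρ hρ'
  refine ⟨C, hC, fun δ hδ lam t hl ht => ?_⟩
  have h1 := h δ hδ (lam * t ^ ρ) (by positivity)
  rw [Real.mul_rpow hl.le (by positivity), ← Real.rpow_mul ht.le] at h1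
  have h2 : 0 ≤ lam * (ρ * t ^ (ρ - 1)) := by positivity
  rw [mlTimeDeriv, abs_mul, abs_neg, abs_of_nonneg h2, Real.rpow_sub_one ht.ne',
    Real.rpow_sub_one ht.ne']
  calc _ = ρ / t * (lam * t ^ ρ * |mittagLefflerDeriv ρ (-(lam * t ^ ρ))|) := by ring
    _ ≤ 1 / t * (C * (lam ^ δ * t ^ (ρ * δ))) := by gcongr
    _ = _ := by ring

/-- The Caputo derivative of the time factor: `D_t^ρ E_ρ(-λ t^ρ) = -λ E_ρ(-λ t^ρ)`. -/
lemma integral_mlTimeDeriv {ρ : ℝ} (hρ : 0 < ρ) (hρ' : ρ < 1) {lam t : ℝ} (hlam : 0 ≤ lam)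
    (ht : 0 < t) :
    ∫ s in (0 : ℝ)..t, (t - s) ^ (-ρ) * mlTimeDeriv ρ lam s =
      Real.Gamma (1 - ρ) * -(lam * mlTime ρ lam t) := by
  set c : ℕ → ℝ := fun k => -lam * (-lam) ^ k * (Real.Gamma (ρ * (k + 1)))⁻¹ with hc
  -- The derivative of the series, term by term, times the kernel. Each term is a Beta integral,
  -- which lowers the power of t by ρ and so shifts the series by one index; the norms sum to the
  -- series at +λ t^ρ, which justifies the interchange.
  set F : ℕ → ℝ → ℝ := fun k s => c k * ((t - s) ^ ((1 - ρ) - 1) * s ^ (ρ * (k + 1) - 1)) with hF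
  have hpos : ∀ k : ℕ, 0 < ρ * ((k : ℝ) + 1) := fun k => by positivity
  have hint : ∀ k, ∫ s in Ioc 0 t, (t - s) ^ ((1 - ρ) - 1) * s ^ (ρ * ((k : ℕ) + 1) - 1) =
      Real.Gamma (1 - ρ) * (Real.Gamma (ρ * (k + 1)) * ((Real.Gamma (ρ * k + 1))⁻¹ *
        (t ^ ρ) ^ k)) := by
    intro k
    rw [← intervalIntegral.integral_of_le ht.le,
      integral_sub_rpow_mul_rpow (hpos k) (by linarith) ht, ← Real.rpow_natCast, ← Real.rpow_mul
      ht.le, show ρ * ((k : ℝ) + 1) + (1 - ρ) = ρ * k + 1 by ring, add_sub_cancel_right]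
    ring
  have hG : ∀ k : ℕ, Real.Gamma (ρ * ((k : ℝ) + 1)) ≠ 0 := fun k =>
    (Real.Gamma_pos_of_pos (hpos k)).ne'
  have hFint : ∀ k, Integrable (F k) (volume.restrict (Ioc 0 t)) := fun k =>
    (((intervalIntegrable_iff_integrableOn_Ioc_of_le ht.le).1
      (intervalIntegrable_sub_rpow_mul_rpow (hpos k) (by linarith) ht))).const_mul _
  have hFval : ∀ k, ∫ s in Ioc 0 t, F k s =
      Real.Gamma (1 - ρ) * -lam * ((Real.Gamma (ρ * k + 1))⁻¹ * (-(lam * t ^ ρ)) ^ k) := by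
    intro k
    rw [hF, integral_const_mul, hint, hc]
    simp only
    have := hG k
    rw [neg_mul_eq_neg_mul, mul_pow]
    field_simp
  have hFnorm : ∀ k, ∫ s in Ioc 0 t, ‖F k s‖ =
      Real.Gamma (1 - ρ) * lam * ((Real.Gamma (ρ * k + 1))⁻¹ * (lam * t ^ ρ) ^ k) := by
    intro k
    have h1 : ∫ s in Ioc 0 t, ‖F k s‖ = ∫ s in Ioc 0 t,
        |c k| * ((t - s) ^ ((1 - ρ) - 1) * s ^ (ρ * (k + 1) - 1)) := by
      refine setIntegral_congr_fun measurableSet_Ioc fun s hs => ?_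
      simp only [hF]
      rw [norm_mul, Real.norm_eq_abs, Real.norm_eq_abs, abs_of_nonneg
        (mul_nonneg (Real.rpow_nonneg (by linarith [hs.2]) _) (Real.rpow_nonneg hs.1.le _))]
    have h2 : |c k| = lam * lam ^ k * (Real.Gamma (ρ * (k + 1)))⁻¹ := by
      rw [hc, abs_mul, abs_mul, abs_pow, abs_neg, abs_of_nonneg hlam,
        abs_of_pos (inv_pos.2 (Real.Gamma_pos_of_pos (hpos k)))]
    rw [h1, integral_const_mul, hint, h2]
    have := hG k
    rw [mul_pow]
    field_simp
  have hsum := hasSum_integral_of_summable_integral_norm hFint (by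
    simp_rw [hFnorm]
    refine Summable.mul_left _ ?_
    refine (summable_mittagLeffler hρ one_pos (lam * t ^ ρ) (by positivity)).congr fun k => ?_
    rw [abs_of_pos (inv_pos.2 (Real.Gamma_pos_of_pos (by positivity)))])
  have hlhs : ∫ s in (0 : ℝ)..t, (t - s) ^ (-ρ) * mlTimeDeriv ρ lam s =
      ∫ s in Ioc 0 t, ∑' k, F k s := by
    rw [intervalIntegral.integral_of_le ht.le]
    refine setIntegral_congr_fun measurableSet_Ioc fun s hs => ?_
    simp only [hF, mlTimeDeriv, mittagLefflerDeriv]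
    rw [← tsum_mul_right, ← tsum_mul_left]
    refine tsum_congr fun k => ?_
    have hs0 : 0 < s := hs.1
    have h1 : Real.Gamma (ρ * ((k + 1 : ℕ) : ℝ) + 1) =
        ρ * (k + 1) * Real.Gamma (ρ * (k + 1)) := by
      push_cast
      rw [Real.Gamma_add_one (hpos k).ne']
    have h2 : s ^ (ρ * ((k : ℝ) + 1) - 1) = (s ^ ρ) ^ k * s ^ (ρ - 1) := by
      rw [← Real.rpow_natCast, ← Real.rpow_mul hs0.le, ← Real.rpow_add hs0]; congr 1; ring
    rw [h1, h2, hc, show (1 - ρ) - 1 = -ρ by ring, neg_mul_eq_neg_mul lam (s ^ ρ), mul_pow]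
    have := hG k
    have : (k : ℝ) + 1 ≠ 0 := by positivity
    field_simp
  rw [hlhs, ← hsum.tsum_eq]
  simp_rw [hFval]
  rw [tsum_mul_left, mlTime, mittagLeffler_eq]
  ring

/-! ### Words of coordinate derivatives -/

/-- The iterated derivative `∂_{j₁} ⋯ ∂_{jₖ} f` along a word `j₁ … jₖ` of coordinates. -/
def wordDeriv {N : ℕ} (L : List (Fin N)) (f : RN N → ℂ) : RN N → ℂ :=
  L.foldr coordDeriv f

/-- The word in which each `j` occurs `α j` times. -/
def multiWord {N : ℕ} (α : Fin N →₀ ℕ) : List (Fin N) :=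
  (List.finRange N).flatMap fun j => List.replicate (α j) j

lemma wordDeriv_append {N : ℕ} (L M : List (Fin N)) (f : RN N → ℂ) :
    wordDeriv (L ++ M) f = wordDeriv L (wordDeriv M f) := by
  simp [wordDeriv, List.foldr_append]

lemma wordDeriv_replicate {N : ℕ} (n : ℕ) (j : Fin N) (f : RN N → ℂ) :
    wordDeriv (List.replicate n j) f = (coordDeriv j)^[n] f := by
  induction n with
  | zero => rfl
  | succ n ih =>
    rw [List.replicate_succ, Function.iterate_succ_apply', ← ih]
    rfl

/-- Words permit induction on one derivative at a time, which multi-indices make awkward. -/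
lemma partialDeriv_eq_wordDeriv {N : ℕ} (α : Fin N →₀ ℕ) (f : RN N → ℂ) :
    partialDeriv α f = wordDeriv (multiWord α) f := by
  unfold partialDeriv multiWord
  induction List.finRange N with
  | nil => rfl
  | cons j L ih => rw [List.foldr_cons, List.flatMap_cons, wordDeriv_append, wordDeriv_replicate, ih]

lemma prod_map_multiWord {N : ℕ} {M : Type*} [CommMonoid M] (α : Fin N →₀ ℕ) (f : Fin N → M) :
    ((multiWord α).map f).prod = ∏ j, f j ^ α j := by
  rw [multiWord, List.map_flatMap, List.flatMap_def, List.prod_flatten, List.map_map,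
    ← List.ofFn_eq_map, List.prod_ofFn]
  simp

lemma length_multiWord {N : ℕ} (α : Fin N →₀ ℕ) : (multiWord α).length = order α := by
  rw [multiWord, List.length_flatMap, ← List.ofFn_eq_map, List.sum_ofFn]
  simp [order]

/-! ### The Fourier transform on `L_1 ∩ L_2` -/

/-- `⟨f, 𝓕⁻ ψ⟩ = ⟨𝓕⁻ f, ψ⟩` for Schwartz functions `ψ`. -/
lemma integral_fourierInv_smul_eq {N : ℕ} (ψ : SchwartzMap (RN N) ℂ) {h : RN N → ℂ}
    (h1 : Integrable h) : ∫ ξ, (𝓕⁻ ψ : SchwartzMap (RN N) ℂ) ξ • h ξ = ∫ x, ψ x • 𝓕⁻ h x := by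
  rw [SchwartzMap.fourierInv_coe]
  have := VectorFourier.integral_fourierIntegral_smul_eq_flip (μ := (volume : Measure (RN N)))
    (ν := (volume : Measure (RN N))) (e := Real.fourierChar)
    (L := -innerₗ (RN N)) (f := ψ) (g := h) Real.continuous_fourierChar ?_ ψ.integrable h1
  · rw [show (-innerₗ (RN N)).flip = -innerₗ (RN N) by
      ext; simp [real_inner_comm]] at this
    exact this
  · simp only [LinearMap.neg_apply, innerₗ_apply_apply]
    fun_prop

lemma continuous_fourierInv {N : ℕ} {h : RN N → ℂ} (h1 : Integrable h) : Continuous (𝓕⁻ h) :=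
  VectorFourier.fourierIntegral_continuous (L := -innerₗ (RN N)) Real.continuous_fourierChar
    (by simp only [LinearMap.neg_apply, innerₗ_apply_apply]; fun_prop) h1

/-- Both sides have the same pairing with every smooth compactly supported function: on the left by
the distributional description of the L_2 transform, on the right by Fubini. -/
lemma fourierInv_toLp_ae_eq {N : ℕ} {h : RN N → ℂ} (h1 : Integrable h) (h2 : MemLp h 2 volume) :
    ((𝓕⁻ (h2.toLp h) : Lp ℂ 2 (volume : Measure (RN N))) : RN N → ℂ) =ᵐ[volume] 𝓕⁻ h := by
  apply ae_eq_of_integral_contDiff_smul_eq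
  · exact (Lp.memLp _).locallyIntegrable (by norm_num)
  · exact (continuous_fourierInv h1).locallyIntegrable
  intro g hg hgs
  have hg₁ : HasCompactSupport (Complex.ofRealCLM ∘ g) := hgs.comp_left rfl
  have hg₂ : ContDiff ℝ (⊤ : ℕ∞) (Complex.ofRealCLM ∘ g) := by fun_prop
  set ψ := hg₁.toSchwartzMap hg₂
  have hψ : ∀ x (z : ℂ), g x • z = ψ x • z := fun x z => by simp [ψ]
  simp only [hψ]
  rw [← integral_fourierInv_smul_eq ψ h1,
    ← Lp.toTemperedDistribution_apply, ← Lp.fourierInv_toTemperedDistribution_eq,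
    TemperedDistribution.fourierInv_apply, Lp.toTemperedDistribution_apply]
  apply integral_congr_ae
  filter_upwards [h2.coeFn_toLp] with x hx
  rw [hx]

lemma memLp_fourierInv {N : ℕ} {h : RN N → ℂ} (h1 : Integrable h) (h2 : MemLp h 2 volume) :
    MemLp (𝓕⁻ h) 2 volume :=
  (memLp_congr_ae (fourierInv_toLp_ae_eq h1 h2)).1 (Lp.memLp _)

lemma fourier_toLp_fourierInv {N : ℕ} {h : RN N → ℂ} (h1 : Integrable h) (h2 : MemLp h 2 volume)
    (h3 : MemLp (𝓕⁻ h) 2 volume) :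
    (𝓕 (h3.toLp (𝓕⁻ h)) : Lp ℂ 2 (volume : Measure (RN N))) = h2.toLp h := by
  have : h3.toLp (𝓕⁻ h) = (𝓕⁻ (h2.toLp h) : Lp ℂ 2 (volume : Measure (RN N))) := by
    rw [← Lp.toLp_coeFn (𝓕⁻ (h2.toLp h) : Lp ℂ 2 (volume : Measure (RN N))) (Lp.memLp _)]
    exact (MemLp.toLp_eq_toLp_iff _ _).2 (fourierInv_toLp_ae_eq h1 h2).symm
  rw [this, FourierTransform.fourier_fourierInv_eq]

lemma eLpNorm_fourierInv {N : ℕ} {h : RN N → ℂ} (h1 : Integrable h) (h2 : MemLp h 2 volume) :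
    eLpNorm (𝓕⁻ h) 2 volume = eLpNorm h 2 volume := by
  have h3 := memLp_fourierInv h1 h2
  have := Lp.norm_fourier_eq (h3.toLp (𝓕⁻ h))
  rw [fourier_toLp_fourierInv h1 h2 h3, Lp.norm_toLp, Lp.norm_toLp,
    ENNReal.toReal_eq_toReal_iff' h2.eLpNorm_ne_top h3.eLpNorm_ne_top] at this
  exact this.symm

/-- A continuous `L_2` function with integrable transform is given by the inversion integral. -/
lemma eq_fourierInv_of_integrable {N : ℕ} {f : RN N → ℂ} (hf : Continuous f)
    (h2 : MemLp f 2 volume)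
    (h1 : Integrable (𝓕 (h2.toLp f) : Lp ℂ 2 (volume : Measure (RN N)))) :
    f = 𝓕⁻ ((𝓕 (h2.toLp f) : Lp ℂ 2 (volume : Measure (RN N))) : RN N → ℂ) := by
  refine Continuous.ae_eq_iff_eq (μ := (volume : Measure (RN N))) hf (continuous_fourierInv h1) |>.1 ?_
  refine EventuallyEq.trans ?_ (fourierInv_toLp_ae_eq h1 (Lp.memLp _))
  rw [Lp.toLp_coeFn, FourierTransform.fourierInv_fourier_eq]
  exact h2.coeFn_toLp.symm

/-- A square integrable function which is orthogonal to the inverse transforms of all test functions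
vanishes almost everywhere. -/
lemma ae_eq_zero_of_integral_fourierInv_eq_zero {N : ℕ} {f : RN N → ℂ} (hf : MemLp f 2 volume)
    (h : ∀ χ : SchwartzMap (RN N) ℂ, HasCompactSupport χ →
      ∫ x, (𝓕⁻ χ : SchwartzMap (RN N) ℂ) x * f x = 0) : f =ᵐ[volume] 0 := by
  have key : (𝓕⁻ (hf.toLp f) : Lp ℂ 2 (volume : Measure (RN N))) = 0 := by
    rw [Lp.eq_zero_iff_ae_eq_zero]
    apply ae_eq_zero_of_integral_contDiff_smul_eq_zero
    · exact (Lp.memLp _).locallyIntegrable (by norm_num)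
    intro g hg hgs
    have hg₁ : HasCompactSupport (Complex.ofRealCLM ∘ g) := hgs.comp_left rfl
    have hg₂ : ContDiff ℝ (⊤ : ℕ∞) (Complex.ofRealCLM ∘ g) := by fun_prop
    set ψ := hg₁.toSchwartzMap hg₂
    have hψ : ∀ x (z : ℂ), g x • z = ψ x • z := fun x z => by simp [ψ]
    simp only [hψ]
    rw [← Lp.toTemperedDistribution_apply, ← Lp.fourierInv_toTemperedDistribution_eq,
      TemperedDistribution.fourierInv_apply, Lp.toTemperedDistribution_apply, ← h ψ hg₁]
    apply integral_congr_ae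
    filter_upwards [hf.coeFn_toLp] with x hx
    rw [hx, smul_eq_mul]
  have h0 : hf.toLp f = 0 := by
    rw [← FourierTransform.fourier_fourierInv_eq (E := Lp ℂ 2 (volume : Measure (RN N)))
      (F := Lp ℂ 2 (volume : Measure (RN N))) (hf.toLp f), key, ← norm_eq_zero, Lp.norm_fourier_eq, norm_zero]
  exact (hf.coeFn_toLp.symm.trans (by rw [h0])).trans (Lp.coeFn_zero _ _ _)

/-! ### Differentiation under the inverse Fourier integral -/

lemma hasFDerivAt_fourierInv {N : ℕ} {h : RN N → ℂ} (h0 : Integrable h)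
    (h1 : Integrable fun v : RN N => ‖v‖ * ‖h v‖) (x : RN N) :
    HasFDerivAt (𝓕⁻ h)
      (𝓕⁻ (VectorFourier.fourierSMulRight (-innerSL ℝ : RN N →L[ℝ] RN N →L[ℝ] ℝ) h) x) x :=
  VectorFourier.hasFDerivAt_fourierIntegral (-innerSL ℝ : RN N →L[ℝ] RN N →L[ℝ] ℝ) h0 h1 x

lemma coordDeriv_fourierInv {N : ℕ} {h : RN N → ℂ} (h0 : Integrable h)
    (h1 : Integrable fun v : RN N => ‖v‖ * ‖h v‖) (j : Fin N) :
    coordDeriv j (𝓕⁻ h) = 𝓕⁻ (fun v => (2 * Real.pi * Complex.I * v j : ℂ) * h v) := by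
  ext x
  rw [coordDeriv, ((hasFDerivAt_fourierInv h0 h1 x).hasLineDerivAt _).lineDeriv]
  have hi : Integrable (VectorFourier.fourierSMulRight
      (-innerSL ℝ : RN N →L[ℝ] RN N →L[ℝ] ℝ) h) := by
    refine (h1.const_mul (2 * Real.pi)).mono' h0.1.fourierSMulRight (ae_of_all _ fun v => ?_)
    rw [VectorFourier.norm_fourierSMulRight]
    have : ‖(-innerSL ℝ : RN N →L[ℝ] RN N →L[ℝ] ℝ) v‖ = ‖v‖ := by
      rw [neg_apply, norm_neg]
      exact innerSL_apply_norm ℝ v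
    rw [this, mul_assoc]
  have := Real.fourierIntegral_continuousLinearMap_apply' (μ := volume)
    (L := (-innerSL ℝ : RN N →L[ℝ] RN N →L[ℝ] ℝ)) (a := EuclideanSpace.single j (1 : ℝ)) (w := x) hi
  refine this.trans ?_
  congr 1
  ext v
  have : (-innerSL ℝ : RN N →L[ℝ] RN N →L[ℝ] ℝ) v (EuclideanSpace.single j 1) = -v j := by
    rw [neg_apply, neg_apply]
    change -inner ℝ v (EuclideanSpace.single j (1 : ℝ)) = _
    simp [EuclideanSpace.inner_single_right]
  rw [VectorFourier.fourierSMulRight_apply, this, Complex.real_smul, smul_eq_mul]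
  push_cast
  ring

lemma norm_prod_map_le {N : ℕ} (L : List (Fin N)) (v : RN N) :
    ‖(L.map fun j => (2 * Real.pi * Complex.I * v j : ℂ)).prod‖ ≤ (2 * Real.pi * ‖v‖) ^ L.length := by
  induction L with
  | nil => simp
  | cons j L ih =>
    rw [List.map_cons, List.prod_cons, norm_mul, List.length_cons, pow_succ']
    gcongr
    rw [norm_mul, norm_mul, Complex.norm_I, mul_one, Complex.norm_real]
    have : ‖(2 * Real.pi : ℂ)‖ = 2 * Real.pi := by
      rw [norm_mul, Complex.norm_real, Real.norm_of_nonneg Real.pi_pos.le]; simp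
    rw [this]
    gcongr
    exact PiLp.norm_apply_le v j

lemma continuous_prod_map {N : ℕ} (L : List (Fin N)) :
    Continuous fun v : RN N => (L.map fun j => (2 * Real.pi * Complex.I * v j : ℂ)).prod := by
  induction L with
  | nil => simpa using continuous_const
  | cons j L ih =>
    simp only [List.map_cons, List.prod_cons]
    exact (by fun_prop : Continuous fun v : RN N => (2 * Real.pi * Complex.I * v j : ℂ)).mul ih

lemma integrable_pow_mul_prod_map {N : ℕ} (L : List (Fin N)) {h : RN N → ℂ} (n : ℕ)
    (hm : AEStronglyMeasurable h) (hn : Integrable fun v : RN N => ‖v‖ ^ (n + L.length) * ‖h v‖) :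
    Integrable fun v : RN N => ‖v‖ ^ n *
      ‖(L.map fun j => (2 * Real.pi * Complex.I * v j : ℂ)).prod * h v‖ := by
  refine (hn.const_mul ((2 * Real.pi) ^ L.length)).mono' ?_ (ae_of_all _ fun v => ?_)
  · exact (by fun_prop : Continuous fun v : RN N => ‖v‖ ^ n).aestronglyMeasurable.mul
      ((continuous_prod_map L).aestronglyMeasurable.mul hm).norm
  · rw [norm_mul, norm_pow, norm_norm, norm_norm, norm_mul]
    calc _ ≤ ‖v‖ ^ n * ((2 * Real.pi * ‖v‖) ^ L.length * ‖h v‖) := by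
          gcongr
          exact norm_prod_map_le L v
      _ = _ := by rw [mul_pow, pow_add]; ring

lemma wordDeriv_fourierInv {N : ℕ} (L : List (Fin N)) {h : RN N → ℂ} (hm : AEStronglyMeasurable h)
    (hn : ∀ n ≤ L.length, Integrable fun v : RN N => ‖v‖ ^ n * ‖h v‖) :
    wordDeriv L (𝓕⁻ h) =
      𝓕⁻ (fun v => (L.map fun j => (2 * Real.pi * Complex.I * v j : ℂ)).prod * h v) := by
  induction L with
  | nil => simp [wordDeriv]
  | cons j L ih =>
    have h0 := integrable_pow_mul_prod_map L 0 hm (hn _ (by simp))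
    have h1 := integrable_pow_mul_prod_map L 1 hm (hn _ (by simp [add_comm]))
    simp only [pow_zero, one_mul, pow_one] at h0 h1
    change coordDeriv j (wordDeriv L (𝓕⁻ h)) = _
    rw [ih fun n hn' => hn n (by simp; omega), coordDeriv_fourierInv _ h1]
    · congr 1
      ext v
      rw [List.map_cons, List.prod_cons, mul_assoc _ _ (h v)]
    · exact (integrable_norm_iff ((continuous_prod_map L).aestronglyMeasurable.mul hm)).1 h0

/-- Each derivative brings down 2πi v_j, and the factor -i of D_j cancels the i, so the multiplier
is real. -/
lemma multiD_fourierInv {N : ℕ} (α : Fin N →₀ ℕ) {h : RN N → ℂ} (hm : AEStronglyMeasurable h)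
    (hn : ∀ n ≤ order α, Integrable fun v : RN N => ‖v‖ ^ n * ‖h v‖) :
    multiD α (𝓕⁻ h) = 𝓕⁻ (fun v => ((∏ j, (2 * Real.pi * v j) ^ α j : ℝ) : ℂ) * h v) := by
  ext x
  rw [multiD, partialDeriv_eq_wordDeriv, wordDeriv_fourierInv _ hm (by rwa [length_multiWord]),
    Real.fourierInv_eq, Real.fourierInv_eq, ← integral_const_mul]
  congr 1
  ext v
  rw [prod_map_multiWord, mul_smul_comm]
  congr 1
  rw [← mul_assoc]
  congr 1
  rw [order, ← Finset.prod_pow_eq_pow_sum, ← Finset.prod_mul_distrib]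
  push_cast
  refine Finset.prod_congr rfl fun j _ => ?_
  rw [← mul_pow]
  congr 1
  linear_combination (-(2 * Real.pi * v j) : ℂ) * Complex.I_mul_I

/-- The Riemann-Lebesgue lemma. Integrability is not required, because otherwise the integral is
identically 0 by convention. -/
lemma tendsto_fourierInv_cocompact {N : ℕ} (h : RN N → ℂ) :
    Tendsto (𝓕⁻ h) (cocompact (RN N)) (𝓝 0) := by
  rw [Real.fourierInv_eq_fourier_comp_neg]
  exact tendsto_integral_exp_inner_smul_cocompact _

lemma contDiff_fourierInv {N : ℕ} {h : RN N → ℂ} {k : ℕ}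
    (hn : ∀ n ≤ k, Integrable fun v : RN N => ‖v‖ ^ n * ‖h v‖) :
    ContDiff ℝ (k : WithTop ℕ∞) (𝓕⁻ h) := by
  have := VectorFourier.contDiff_fourierIntegral (μ := volume) (N := (k : ℕ∞)) (f := h)
    (-innerSL ℝ : RN N →L[ℝ] RN N →L[ℝ] ℝ) (fun n hn' => hn n (by exact_mod_cast hn'))
  exact_mod_cast this

/-! ### The symbol -/

lemma symbol_eq_sum {N : ℕ} (A : MvPolynomial (Fin N) ℝ) (ξ : RN N) :
    symbol A ξ = ∑ α ∈ A.support, A.coeff α * ∏ j, ξ j ^ α j :=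
  MvPolynomial.eval_eq' _ _

lemma continuous_symbol {N : ℕ} (A : MvPolynomial (Fin N) ℝ) : Continuous (symbol A) := by
  have : symbol A = fun ξ => ∑ α ∈ A.support, A.coeff α * ∏ j, ξ j ^ α j :=
    funext (symbol_eq_sum A)
  rw [this]
  fun_prop

lemma order_eq_of_mem_support {N m : ℕ} {A : MvPolynomial (Fin N) ℝ} (hA : A.IsHomogeneous m)
    {α : Fin N →₀ ℕ} (hα : α ∈ A.support) : order α = m := by
  have := hA (MvPolynomial.mem_support_iff.1 hα)
  rw [← this, order, Finsupp.weight_apply, Finsupp.sum_fintype] <;> simp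

lemma symbol_smul {N m : ℕ} {A : MvPolynomial (Fin N) ℝ} (hA : A.IsHomogeneous m) (c : ℝ)
    (ξ : RN N) : symbol A (c • ξ) = c ^ m * symbol A ξ := by
  rw [symbol_eq_sum, symbol_eq_sum, Finset.mul_sum]
  refine Finset.sum_congr rfl fun α hα => ?_
  have : (∏ j, (c • ξ) j ^ α j) = c ^ m * ∏ j, ξ j ^ α j := by
    rw [← order_eq_of_mem_support hA hα, order, ← Finset.prod_pow_eq_pow_sum,
      ← Finset.prod_mul_distrib]
    refine Finset.prod_congr rfl fun j _ => ?_
    rw [PiLp.smul_apply, smul_eq_mul, mul_pow]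
  rw [this]
  ring

lemma symbol_nonneg {N l : ℕ} {A : MvPolynomial (Fin N) ℝ} (hA : IsEllipticSymbol A l) (ξ : RN N) :
    0 ≤ symbol A ξ := by
  rcases eq_or_ne ξ 0 with rfl | h
  · have := symbol_smul hA.homogeneous 0 (0 : RN N)
    rw [zero_smul, zero_pow (by have := hA.order_pos; omega), zero_mul] at this
    exact this.ge
  · exact (hA.pos ξ h).le

/-- Ellipticity: `c |ξ|^{2l} ≤ A(ξ) ≤ C |ξ|^{2l}`. -/
lemma exists_symbol_bounds {N l : ℕ} {A : MvPolynomial (Fin N) ℝ} (hA : IsEllipticSymbol A l) :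
    ∃ c C : ℝ, 0 < c ∧ 0 < C ∧ ∀ ξ : RN N,
      c * ‖ξ‖ ^ (2 * l) ≤ symbol A ξ ∧ symbol A ξ ≤ C * ‖ξ‖ ^ (2 * l) := by
  have key : ∃ c C : ℝ, 0 < c ∧ 0 < C ∧ ∀ ξ ∈ Metric.sphere (0 : RN N) 1,
      c ≤ symbol A ξ ∧ symbol A ξ ≤ C := by
    -- The sphere is empty when N = 0. Otherwise compactness gives the extrema, and homogeneity
    -- carries them to all ξ.
    rcases (Metric.sphere (0 : RN N) 1).eq_empty_or_nonempty with h | h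
    · exact ⟨1, 1, one_pos, one_pos, fun ξ hξ => by simp [h] at hξ⟩
    · obtain ⟨x, hx, hx'⟩ := (isCompact_sphere (0 : RN N) 1).exists_isMinOn h
        (continuous_symbol A).continuousOn
      obtain ⟨y, hy, hy'⟩ := (isCompact_sphere (0 : RN N) 1).exists_isMaxOn h
        (continuous_symbol A).continuousOn
      have hne : ∀ z ∈ Metric.sphere (0 : RN N) 1, z ≠ 0 := fun z hz h0 => by simp [h0] at hz
      exact ⟨_, _, hA.pos x (hne x hx), hA.pos y (hne y hy), fun ξ hξ => ⟨hx' hξ, hy' hξ⟩⟩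
  obtain ⟨c, C, hc, hC, h⟩ := key
  refine ⟨c, C, hc, hC, fun ξ => ?_⟩
  rcases eq_or_ne ξ 0 with rfl | h0
  · have := symbol_smul hA.homogeneous 0 (0 : RN N)
    have hl : 2 * l ≠ 0 := by have := hA.order_pos; omega
    rw [zero_smul, zero_pow hl, zero_mul] at this
    simp [this, hl]
  · have hn : 0 < ‖ξ‖ := norm_pos_iff.2 h0
    have h1 := h (‖ξ‖⁻¹ • ξ) (by simp [norm_smul, hn.ne'])
    have h2 := symbol_smul hA.homogeneous ‖ξ‖ (‖ξ‖⁻¹ • ξ)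
    rw [smul_inv_smul₀ hn.ne'] at h2
    have hp : 0 < ‖ξ‖ ^ (2 * l) := by positivity
    rw [h2]
    constructor <;> nlinarith

lemma diffOp_fourierInv {N m : ℕ} {A : MvPolynomial (Fin N) ℝ} (hA : A.IsHomogeneous m)
    {h : RN N → ℂ} (hm : AEStronglyMeasurable h)
    (hn : ∀ n ≤ m, Integrable fun v : RN N => ‖v‖ ^ n * ‖h v‖) :
    diffOp A (𝓕⁻ h) = 𝓕⁻ (fun v => ((symbol A ((2 * Real.pi) • v) : ℝ) : ℂ) * h v) := by
  ext x
  have hi : ∀ α ∈ A.support, Integrable fun v : RN N =>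
      Real.fourierChar (inner ℝ v x) • (((A.coeff α : ℝ) : ℂ) *
        (((∏ j, (2 * Real.pi * v j) ^ α j : ℝ) : ℂ) * h v)) := by
    intro α hα
    have h0 := integrable_pow_mul_prod_map (multiWord α) 0 hm
      (hn _ (by rw [length_multiWord, order_eq_of_mem_support hA hα, zero_add]))
    simp only [pow_zero, one_mul] at h0
    refine (h0.const_mul |A.coeff α|).mono' ?_ (ae_of_all _ fun v => ?_)
    · have hc : Continuous fun v : RN N => ((∏ j, (2 * Real.pi * v j) ^ α j : ℝ) : ℂ) := by fun_prop
      have he : Continuous fun v : RN N => Real.fourierChar (inner ℝ v x) := by fun_prop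
      exact he.aestronglyMeasurable.smul ((hc.aestronglyMeasurable.mul hm).const_mul _)
    · rw [Circle.norm_smul, norm_mul, norm_mul, norm_mul, prod_map_multiWord, Complex.norm_real,
        Complex.norm_real, Real.norm_eq_abs]
      gcongr
      simp [norm_prod]
  unfold diffOp
  rw [Real.fourierInv_eq]
  have : ∀ v : RN N, Real.fourierChar (inner ℝ v x) •
      (((symbol A ((2 * Real.pi) • v) : ℝ) : ℂ) * h v) =
      ∑ α ∈ A.support, Real.fourierChar (inner ℝ v x) • (((A.coeff α : ℝ) : ℂ) *
        (((∏ j, (2 * Real.pi * v j) ^ α j : ℝ) : ℂ) * h v)) := by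
    intro v
    rw [symbol_eq_sum, ← Finset.smul_sum]
    push_cast
    rw [Finset.sum_mul]
    congr 1
    refine Finset.sum_congr rfl fun α _ => ?_
    simp [mul_assoc]
  simp only [this]
  rw [integral_finsetSum _ hi]
  refine Finset.sum_congr rfl fun α hα => ?_
  rw [multiD_fourierInv α hm (by rwa [order_eq_of_mem_support hA hα]), Real.fourierInv_eq,
    ← integral_const_mul]
  congr 1
  ext v
  rw [mul_smul_comm]

/-! ### Change of variables between the two normalisations of the transform -/

lemma ae_comp_smul {N : ℕ} {f g : RN N → ℂ} (h : f =ᵐ[volume] g) {c : ℝ} (hc : c ≠ 0) :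
    (fun ξ => f (c • ξ)) =ᵐ[volume] fun ξ => g (c • ξ) :=
  (Measure.quasiMeasurePreserving_smul (volume : Measure (RN N)) hc).ae_eq_comp h

lemma fourierL2_ae_eq {N : ℕ} {f : RN N → ℂ} (hf : MemLp f 2 volume) {h : RN N → ℂ}
    (hh : ((𝓕 (hf.toLp f) : Lp ℂ 2 (volume : Measure (RN N))) : RN N → ℂ) =ᵐ[volume] h) :
    fourierL2 f hf =ᵐ[volume]
      fun ξ => (((2 * Real.pi) ^ N)⁻¹ : ℝ) • h ((2 * Real.pi)⁻¹ • ξ) := by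
  filter_upwards [ae_comp_smul hh (inv_ne_zero Real.two_pi_pos.ne')] with ξ hξ
  rw [fourierL2, hξ]

lemma integrable_fourierL2_iff {N : ℕ} {f : RN N → ℂ} (hf : MemLp f 2 volume) :
    Integrable (fourierL2 f hf) ↔
      Integrable (𝓕 (hf.toLp f) : Lp ℂ 2 (volume : Measure (RN N))) := by
  unfold fourierL2
  rw [integrable_fun_smul_iff (inv_ne_zero (pow_ne_zero _ Real.two_pi_pos.ne')),
    integrable_comp_smul_iff volume _ (inv_ne_zero Real.two_pi_pos.ne')]

lemma locallyIntegrable_fourierL2 {N : ℕ} {f : RN N → ℂ} (hf : MemLp f 2 volume) :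
    LocallyIntegrable (fourierL2 f hf) := by
  set g := (𝓕 (hf.toLp f) : Lp ℂ 2 (volume : Measure (RN N)))
  have hm : AEStronglyMeasurable (fun ξ : RN N => g ((2 * Real.pi)⁻¹ • ξ)) volume :=
    ((Lp.stronglyMeasurable g).comp_measurable (measurable_const_smul _)).aestronglyMeasurable
  have : MemLp (fun ξ : RN N => g ((2 * Real.pi)⁻¹ • ξ)) 2 volume := by
    rw [memLp_two_iff_integrable_sq_norm hm]
    exact (integrable_comp_smul_iff volume (fun ξ : RN N => ‖g ξ‖ ^ 2)
      (inv_ne_zero Real.two_pi_pos.ne')).2 ((memLp_two_iff_integrable_sq_norm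
        (Lp.aestronglyMeasurable g)).1 (Lp.memLp g))
  exact (this.const_smul (((2 * Real.pi) ^ N)⁻¹ : ℝ)).locallyIntegrable (by norm_num)

/-! ### Values at Lebesgue points -/

lemma HasValueAt.congr_ae {N : ℕ} {f g : RN N → ℂ} {ξ : RN N} {c : ℂ} (h : HasValueAt f ξ c)
    (hfg : f =ᵐ[volume] g) : HasValueAt g ξ c := by
  unfold HasValueAt at h ⊢
  refine h.congr fun r => ?_
  rw [setAverage_eq, setAverage_eq]
  congr 1
  refine integral_congr_ae (ae_restrict_of_ae ?_)
  filter_upwards [hfg] with x hx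
  rw [hx]

lemma integrableOn_ball_norm_sub {N : ℕ} {f : RN N → ℂ} (hf : LocallyIntegrable f) (ξ : RN N)
    (c : ℂ) (r : ℝ) : IntegrableOn (fun η => ‖f η - c‖) (Metric.ball ξ r) := by
  have h1 : IntegrableOn f (Metric.ball ξ r) :=
    (hf.integrableOn_isCompact (isCompact_closedBall ξ r)).mono_set Metric.ball_subset_closedBall
  have h2 : IntegrableOn (fun _ : RN N => c) (Metric.ball ξ r) :=
    integrableOn_const (measure_ball_lt_top.ne)
  exact (Integrable.sub h1 h2).norm

lemma setAverage_mono {N : ℕ} {f g : RN N → ℝ} {s : Set (RN N)} (hs : MeasurableSet s)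
    (hf : IntegrableOn f s) (hg : IntegrableOn g s)
    (h : ∀ x ∈ s, f x ≤ g x) : ⨍ x in s, f x ≤ ⨍ x in s, g x := by
  rw [setAverage_eq, setAverage_eq, smul_eq_mul, smul_eq_mul]
  exact mul_le_mul_of_nonneg_left (setIntegral_mono_on hf hg hs h) (inv_nonneg.2 measureReal_nonneg)

lemma setAverage_ball_const {N : ℕ} (ξ : RN N) {r : ℝ} (hr : 0 < r) (c : ℝ) :
    ⨍ _ in Metric.ball ξ r, c = c :=
  setAverage_const (Metric.measure_ball_pos _ _ hr).ne' measure_ball_lt_top.ne c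

lemma setAverage_linear {N : ℕ} {f g : RN N → ℝ} {s : Set (RN N)}
    (hf : IntegrableOn f s) (hg : IntegrableOn g s) (a : ℝ) :
    ⨍ x in s, (a * f x + g x) = a * (⨍ x in s, f x) + ⨍ x in s, g x := by
  simp only [setAverage_eq, smul_eq_mul]
  rw [integral_add (hf.const_mul a) hg, integral_const_mul]
  ring

/-- Average the triangle inequality ‖c - d‖ ≤ ‖f - c‖ + ‖f - d‖ over small balls. Local
integrability matters, since averages of non-integrable functions are 0 by convention. -/
lemma HasValueAt.unique {N : ℕ} {f : RN N → ℂ} (hf : LocallyIntegrable f) {ξ : RN N} {c d : ℂ}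
    (hc : HasValueAt f ξ c) (hd : HasValueAt f ξ d) : c = d := by
  have h := hc.add hd
  rw [add_zero] at h
  have : ‖c - d‖ ≤ 0 := by
    refine ge_of_tendsto h ?_
    filter_upwards [self_mem_nhdsWithin] with r hr
    have h1 := integrableOn_ball_norm_sub hf ξ c r
    have h2 := integrableOn_ball_norm_sub hf ξ d r
    have h3 := setAverage_linear h1 h2 1
    simp only [one_mul] at h3
    rw [← h3, ← setAverage_ball_const ξ hr ‖c - d‖]
    refine setAverage_mono Metric.isOpen_ball.measurableSet
      (integrableOn_const measure_ball_lt_top.ne) (h1.add h2) fun x _ => ?_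
    have := norm_sub_le (f x - d) (f x - c)
    rw [sub_sub_sub_cancel_left] at this
    linarith
  exact sub_eq_zero.1 (norm_le_zero_iff.1 this)

lemma HasValueAt.continuous_mul {N : ℕ} {f : RN N → ℂ} (hf : LocallyIntegrable f) {ξ : RN N}
    {c : ℂ} (hc : HasValueAt f ξ c) {m : RN N → ℂ} (hm : Continuous m) :
    HasValueAt (fun η => m η * f η) ξ (m ξ * c) := by
  unfold HasValueAt
  rw [Metric.tendsto_nhds]
  intro ε hε
  -- In m f - m(ξ) c = m (f - c) + (m - m(ξ)) c the last term must stay below ε/2; the added 1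
  -- covers c = 0.
  set δ := ε / (2 * (‖c‖ + 1)) with hδ
  have hδ0 : 0 < δ := by positivity
  have hδ1 : δ * ‖c‖ ≤ ε / 2 := by
    rw [hδ, div_mul_eq_mul_div, div_le_div_iff₀ (by positivity) (by positivity)]
    nlinarith [norm_nonneg c]
  obtain ⟨r₀, hr₀, hball⟩ := Metric.continuousAt_iff.1 hm.continuousAt (min δ 1)
    (lt_min hδ0 one_pos)
  have h2 : ∀ᶠ r in 𝓝[>] (0 : ℝ), (‖m ξ‖ + 1) * ⨍ η in Metric.ball ξ r, ‖f η - c‖ < ε / 2 := by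
    have := (hc.const_mul (‖m ξ‖ + 1))
    rw [mul_zero] at this
    exact this.eventually_lt_const (half_pos hε)
  filter_upwards [h2, Ioo_mem_nhdsGT hr₀] with r hr hr'
  have hmf : LocallyIntegrable fun η => m η * f η := by
    have := hf.continuous_smul hm
    simpa [Pi.smul_apply', smul_eq_mul] using! this
  have hi := integrableOn_ball_norm_sub hf ξ c r
  have hconst : IntegrableOn (fun _ : RN N => δ * ‖c‖) (Metric.ball ξ r) :=
    integrableOn_const measure_ball_lt_top.ne
  have key : ⨍ η in Metric.ball ξ r, ‖m η * f η - m ξ * c‖ ≤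
      (‖m ξ‖ + 1) * (⨍ η in Metric.ball ξ r, ‖f η - c‖) + δ * ‖c‖ := by
    rw [← setAverage_ball_const ξ hr'.1 (δ * ‖c‖), ← setAverage_linear hi hconst]
    refine setAverage_mono Metric.isOpen_ball.measurableSet
      (integrableOn_ball_norm_sub hmf ξ _ r) ((hi.const_mul _).add hconst) fun η hη => ?_
    have h1 := hball (lt_trans (Metric.mem_ball.1 hη) hr'.2)
    rw [dist_eq_norm] at h1
    have h3 : ‖m η‖ ≤ ‖m ξ‖ + 1 := by
      have := norm_add_le (m ξ) (m η - m ξ)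
      rw [add_sub_cancel] at this
      linarith [min_le_right δ 1]
    calc ‖m η * f η - m ξ * c‖ = ‖m η * (f η - c) + (m η - m ξ) * c‖ := by congr 1; ring
      _ ≤ ‖m η‖ * ‖f η - c‖ + ‖m η - m ξ‖ * ‖c‖ := by
        rw [← norm_mul, ← norm_mul]
        exact norm_add_le _ _
      _ ≤ _ := by
        gcongr
        exact h1.le.trans (min_le_left _ _)
  rw [Real.dist_eq, sub_zero, abs_of_nonneg]
  · linarith
  · rw [setAverage_eq, smul_eq_mul]
    exact mul_nonneg (inv_nonneg.2 measureReal_nonneg)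
      (integral_nonneg fun _ => norm_nonneg _)

/-! ### Integrability of the transform of a Sobolev function -/

/-- With w = 1 + |ξ|², the arithmetic-geometric mean inequality bounds w^{τ/2} |g| · w^{-(τ+N/2)/4}
by half the sum of w^τ |g|² and w^{-(τ+N/2)/2}. The latter is integrable because τ + N/2 > N, and
the exponents leave τ/2 - (τ+N/2)/4 = (τ-N/2)/4 to spare. -/
lemma integrable_rpow_mul_fourier {N : ℕ} {τ : ℝ} (hτ : (N : ℝ) / 2 < τ) {f : RN N → ℂ}
    (hf : MemSobolevL2 τ f) (h2 : MemLp f 2 volume) {σ : ℝ} (hσ : σ ≤ (τ - N / 2) / 4) :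
    Integrable fun η : RN N => (1 + ‖(2 * Real.pi) • η‖ ^ 2) ^ σ *
      ‖(𝓕 (h2.toLp f) : Lp ℂ 2 (volume : Measure (RN N))) η‖ := by
  obtain ⟨h2', hi⟩ := hf
  set g := (𝓕 (h2.toLp f) : Lp ℂ 2 (volume : Measure (RN N)))
  set w : RN N → ℝ := fun η => 1 + ‖(2 * Real.pi) • η‖ ^ 2
  have hw : ∀ η, 1 ≤ w η := fun η => by simp only [w]; nlinarith [sq_nonneg ‖(2 * Real.pi) • η‖]
  have hwc : Continuous w := by fun_prop
  have h1 : Integrable fun η : RN N => w η ^ τ * ‖g η‖ ^ 2 := by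
    have h0 := hi.comp_smul (R := 2 * Real.pi) Real.two_pi_pos.ne'
    have h3 := h0.const_mul ((2 * Real.pi) ^ N * (2 * Real.pi) ^ N)
    convert! h3 using 2 with η
    rw [fourierL2, smul_smul, inv_mul_cancel₀ Real.two_pi_pos.ne', one_smul]
    have e : ‖(((2 * Real.pi) ^ N)⁻¹ : ℝ) • g η‖ = ((2 * Real.pi) ^ N)⁻¹ * ‖g η‖ := by
      rw [norm_smul, Real.norm_of_nonneg (by positivity)]
    change _ = _ * _ * (_ * ‖(((2 * Real.pi) ^ N)⁻¹ : ℝ) • g η‖ ^ 2)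
    rw [e]
    change _ = (2 * Real.pi) ^ N * (2 * Real.pi) ^ N * (w η ^ τ * _)
    have : (2 * Real.pi) ^ N ≠ 0 := pow_ne_zero _ Real.two_pi_pos.ne'
    field_simp
  have h3 : Integrable fun η : RN N => w η ^ (-(τ + N / 2) / 2) := by
    have h0 : Integrable fun ξ : RN N => (1 + ‖ξ‖ ^ 2) ^ (-(τ + N / 2) / 2) :=
      integrable_rpow_neg_one_add_norm_sq (by simp; linarith)
    exact h0.comp_smul Real.two_pi_pos.ne'
  have hwm : ∀ s : ℝ, Continuous fun η => w η ^ s := fun s =>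
    hwc.rpow_const fun η => Or.inl (by linarith [hw η])
  refine ((h1.add h3).const_mul (1 / 2)).mono'
    ((hwm σ).aestronglyMeasurable.mul (Lp.aestronglyMeasurable g).norm) (ae_of_all _ fun η => ?_)
  have hp : 0 < w η := by linarith [hw η]
  have e1 : w η ^ τ = w η ^ (τ / 2) * w η ^ (τ / 2) := by
    rw [← Real.rpow_add hp]; ring_nf
  have e2 : w η ^ (-(τ + N / 2) / 2) =
      w η ^ (-(τ + N / 2) / 4) * w η ^ (-(τ + N / 2) / 4) := by
    rw [← Real.rpow_add hp]; ring_nf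
  have e3 : w η ^ σ ≤ w η ^ (τ / 2) * w η ^ (-(τ + N / 2) / 4) := by
    rw [← Real.rpow_add hp]
    refine Real.rpow_le_rpow_of_exponent_le (hw η) (by linarith)
  rw [Real.norm_of_nonneg (by positivity)]
  simp only [Pi.add_apply]
  have := mul_le_mul_of_nonneg_right e3 (norm_nonneg (g η))
  rw [e1, e2]
  nlinarith [sq_nonneg (w η ^ (τ / 2) * ‖g η‖ - w η ^ (-(τ + N / 2) / 4))]

lemma integrable_fourier_of_memSobolev {N : ℕ} {τ : ℝ} (hτ : (N : ℝ) / 2 < τ) {f : RN N → ℂ}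
    (hf : MemSobolevL2 τ f) (h2 : MemLp f 2 volume) :
    Integrable (𝓕 (h2.toLp f) : Lp ℂ 2 (volume : Measure (RN N))) := by
  have := integrable_rpow_mul_fourier hτ hf h2 (σ := 0) (by linarith)
  simp only [Real.rpow_zero, one_mul] at this
  exact (integrable_norm_iff (Lp.aestronglyMeasurable _)).1 this

/-- The spare exponent σ pays for a power of the symbol: A^δ ≤ C^δ (1 + |ξ|²)^{lδ}, and δ = min(1,
σ/l) keeps lδ ≤ σ. -/
lemma exists_integrable_symbol_rpow_mul_fourier {N l : ℕ} {A : MvPolynomial (Fin N) ℝ}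
    (hA : IsEllipticSymbol A l) {τ : ℝ} (hτ : (N : ℝ) / 2 < τ) {f : RN N → ℂ}
    (hf : MemSobolevL2 τ f) (h2 : MemLp f 2 volume) :
    ∃ δ ∈ Ioc (0 : ℝ) 1, Integrable fun η : RN N => symbol A ((2 * Real.pi) • η) ^ δ *
      ‖(𝓕 (h2.toLp f) : Lp ℂ 2 (volume : Measure (RN N))) η‖ := by
  obtain ⟨_, C, _, hC, hb⟩ := exists_symbol_bounds hA
  have hl : (0 : ℝ) < l := by exact_mod_cast hA.order_pos
  set σ := (τ - N / 2) / 4 with hσ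
  have hσ0 : 0 < σ := by rw [hσ]; linarith
  refine ⟨min 1 (σ / l), ⟨lt_min one_pos (by positivity), min_le_left _ _⟩, ?_⟩
  set δ := min 1 (σ / l)
  have hδ : 0 ≤ δ := le_min one_pos.le (by positivity)
  have hδl : l * δ ≤ σ := by
    have := min_le_right 1 (σ / l)
    calc l * δ ≤ l * (σ / l) := by gcongr
      _ = σ := by field_simp
  refine ((integrable_rpow_mul_fourier hτ hf h2 hσ.le).const_mul (C ^ δ)).mono' ?_
    (ae_of_all _ fun η => ?_)
  · exact (((continuous_symbol A).comp (continuous_const_smul _)).rpow_const fun _ =>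
      Or.inr hδ).aestronglyMeasurable.mul (Lp.aestronglyMeasurable _).norm
  · set ξ := (2 * Real.pi) • η
    have h0 := symbol_nonneg hA ξ
    rw [Real.norm_of_nonneg (by positivity), ← mul_assoc]
    gcongr
    have hw : (1 : ℝ) ≤ 1 + ‖ξ‖ ^ 2 := by nlinarith [sq_nonneg ‖ξ‖]
    calc symbol A ξ ^ δ ≤ (C * (1 + ‖ξ‖ ^ 2) ^ l) ^ δ := by
          gcongr
          refine (hb ξ).2.trans ?_
          rw [pow_mul]
          gcongr
          linarith
      _ = C ^ δ * (1 + ‖ξ‖ ^ 2) ^ (l * δ) := by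
          rw [Real.mul_rpow hC.le (by positivity), ← Real.rpow_natCast, ← Real.rpow_mul (by positivity)]
      _ ≤ _ := by
          gcongr

/-! ### The Fourier multiplier `E_ρ(-a t^ρ)` -/

/-- The function whose transform is `E_ρ(-a t^ρ) g`. -/
def mlEvolution {N : ℕ} (ρ : ℝ) (a : RN N → ℝ) (g : RN N → ℂ) (x : RN N) (t : ℝ) : ℂ :=
  𝓕⁻ (fun η => ((mlTime ρ (a η) t : ℝ) : ℂ) * g η) x

section
variable {N : ℕ} {ρ : ℝ} {a : RN N → ℝ} {g : RN N → ℂ}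

lemma continuous_mlTime_comp (hρ : 0 < ρ) (ha : Continuous a) (t : ℝ) :
    Continuous fun η => ((mlTime ρ (a η) t : ℝ) : ℂ) :=
  Complex.continuous_ofReal.comp ((continuous_mlTime hρ).comp (ha.prodMk continuous_const))

lemma integrable_bdd_mul {b : RN N → ℂ} (hb : Continuous b) {C : ℝ} (hC : ∀ η, ‖b η‖ ≤ C)
    (hg : Integrable g) : Integrable fun η => b η * g η :=
  hg.bdd_mul hb.aestronglyMeasurable (ae_of_all _ hC)

lemma memLp_bdd_mul {b : RN N → ℂ} (hb : Continuous b) {C : ℝ} (hC : ∀ η, ‖b η‖ ≤ C)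
    (hg : MemLp g 2 volume) : MemLp (fun η => b η * g η) 2 volume :=
  hg.of_le_mul (hb.aestronglyMeasurable.mul hg.1) (c := C) (ae_of_all _ fun η => by
    rw [norm_mul]
    exact mul_le_mul_of_nonneg_right (hC η) (norm_nonneg _))

lemma norm_fourierChar_smul_mul (η x : RN N) (r : ℝ) (z : ℂ) :
    ‖Real.fourierChar (inner ℝ η x) • ((r : ℂ) * z)‖ = |r| * ‖z‖ := by
  rw [Circle.norm_smul, norm_mul, Complex.norm_real, Real.norm_eq_abs]

lemma mlEvolution_zero (hρ : 0 < ρ) (x : RN N) : mlEvolution ρ a g x 0 = 𝓕⁻ g x := by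
  simp [mlEvolution, mlTime_zero hρ]

lemma continuousOn_mlEvolution (hρ : 0 < ρ) (hρ' : ρ ≤ 1) (ha : Continuous a) (ha0 : ∀ η, 0 ≤ a η)
    (hg : Integrable g) (x : RN N) : ContinuousOn (mlEvolution ρ a g x) (Ici 0) := by
  obtain ⟨C, hC, hb⟩ := exists_mlTime_bound hρ hρ'
  have : mlEvolution ρ a g x = fun t => ∫ η, Real.fourierChar (inner ℝ η x) •
      (((mlTime ρ (a η) t : ℝ) : ℂ) * g η) := by
    ext t
    rw [mlEvolution, Real.fourierInv_eq]
  rw [this]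
  refine continuousOn_of_dominated (bound := fun η => C * ‖g η‖) (fun t _ => ?_) (fun t ht => ?_)
    (hg.norm.const_mul _) (ae_of_all _ fun η => ?_)
  · have he : Continuous fun v : RN N => Real.fourierChar (inner ℝ v x) := by fun_prop
    exact he.aestronglyMeasurable.smul ((continuous_mlTime_comp hρ ha t).aestronglyMeasurable.mul hg.1)
  · refine ae_of_all _ fun η => ?_
    rw [norm_fourierChar_smul_mul]
    exact mul_le_mul_of_nonneg_right (hb _ _ (ha0 η) ht).1 (norm_nonneg _)
  · have : Continuous fun t => mlTime ρ (a η) t :=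
      (continuous_mlTime hρ).comp (by fun_prop : Continuous fun t : ℝ => (a η, t))
    fun_prop

lemma abs_mlTimeDeriv_le {C : ℝ} {δ : ℝ} (hδ : 0 < δ)
    (hC : ∀ lam t, 0 < lam → 0 < t → |mlTimeDeriv ρ lam t| ≤ C * lam ^ δ * t ^ (ρ * δ - 1))
    {lam t : ℝ} (hl : 0 ≤ lam) (ht : 0 < t) :
    |mlTimeDeriv ρ lam t| ≤ C * lam ^ δ * t ^ (ρ * δ - 1) := by
  rcases hl.eq_or_lt with rfl | hl
  · simp [mlTimeDeriv, Real.zero_rpow hδ.ne']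
  · exact hC _ _ hl ht

/-- Differentiation under the integral over times s > t/2. As ρδ ≤ 1, the factor s^{ρδ-1} is largest
at s = t/2, so a multiple of a^δ |g| dominates. -/
lemma hasDerivAt_mlEvolution (hρ : 0 < ρ) (hρ' : ρ ≤ 1) (ha : Continuous a) (ha0 : ∀ η, 0 ≤ a η)
    (hg : Integrable g) {δ : ℝ} (hδ : δ ∈ Ioc (0 : ℝ) 1)
    (hag : Integrable fun η => a η ^ δ * ‖g η‖) (x : RN N) {t : ℝ} (ht : 0 < t) :
    HasDerivAt (mlEvolution ρ a g x) (∫ η, Real.fourierChar (inner ℝ η x) •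
      (((mlTimeDeriv ρ (a η) t : ℝ) : ℂ) * g η)) t := by
  obtain ⟨C, hC, hb⟩ := exists_mlTimeDeriv_bound hρ hρ'
  obtain ⟨C', hC', hb'⟩ := exists_mlTime_bound hρ hρ'
  have hb := fun {lam t : ℝ} => abs_mlTimeDeriv_le (lam := lam) (t := t) hδ.1
    (hb δ (Ioc_subset_Icc_self hδ))
  have : mlEvolution ρ a g x = fun t => ∫ η, Real.fourierChar (inner ℝ η x) •
      (((mlTime ρ (a η) t : ℝ) : ℂ) * g η) := by
    ext t
    rw [mlEvolution, Real.fourierInv_eq]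
  rw [this]
  have he : Continuous fun v : RN N => Real.fourierChar (inner ℝ v x) := by fun_prop
  have hmeas : ∀ s : ℝ, AEStronglyMeasurable (fun η => Real.fourierChar (inner ℝ η x) •
      (((mlTime ρ (a η) s : ℝ) : ℂ) * g η)) volume := fun s =>
    he.aestronglyMeasurable.smul ((continuous_mlTime_comp hρ ha s).aestronglyMeasurable.mul hg.1)
  refine (hasDerivAt_integral_of_dominated_loc_of_deriv_le (s := Ioi (t / 2))
    (bound := fun η => C * (t / 2) ^ (ρ * δ - 1) * (a η ^ δ * ‖g η‖))
    (F' := fun s η => Real.fourierChar (inner ℝ η x) • (((mlTimeDeriv ρ (a η) s : ℝ) : ℂ) * g η))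
    (Ioi_mem_nhds (half_lt_self ht)) (Eventually.of_forall hmeas) ?_ ?_
    (ae_of_all _ fun η s hs => ?_) (hag.const_mul _) (ae_of_all _ fun η s hs => ?_)).2
  · refine (hg.norm.const_mul C').mono' (hmeas t) (ae_of_all _ fun η => ?_)
    rw [norm_fourierChar_smul_mul]
    exact mul_le_mul_of_nonneg_right (hb' _ _ (ha0 η) ht.le).1 (norm_nonneg _)
  · have : Measurable fun η => ((mlTimeDeriv ρ (a η) t : ℝ) : ℂ) :=
      Complex.measurable_ofReal.comp
        ((measurable_mlTimeDeriv hρ).comp (ha.measurable.prodMk measurable_const))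
    exact he.aestronglyMeasurable.smul (this.aestronglyMeasurable.mul hg.1)
  · have hs0 : 0 < s := lt_trans (half_pos ht) hs
    rw [norm_fourierChar_smul_mul]
    have h1 : s ^ (ρ * δ - 1) ≤ (t / 2) ^ (ρ * δ - 1) :=
      Real.rpow_le_rpow_of_nonpos (half_pos ht) (le_of_lt hs)
        (by nlinarith [hδ.1, hδ.2, mul_le_one₀ hρ' hδ.1.le hδ.2])
    have ha' : 0 ≤ a η ^ δ := Real.rpow_nonneg (ha0 η) _
    calc |mlTimeDeriv ρ (a η) s| * ‖g η‖ ≤ C * a η ^ δ * (t / 2) ^ (ρ * δ - 1) * ‖g η‖ := by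
          gcongr
          exact (hb (ha0 η) hs0).trans (by gcongr)
      _ = _ := by ring
  · exact (((hasDerivAt_mlTime hρ (a η) (lt_trans (half_pos ht) hs)).ofReal_comp).mul_const
      (g η)).const_smul (Real.fourierChar (inner ℝ η x))

/-- The Caputo derivative can be taken under the integral over the frequencies. -/
lemma caputo_mlEvolution (hρ : 0 < ρ) (hρ' : ρ < 1) (ha : Continuous a) (ha0 : ∀ η, 0 ≤ a η)
    (hg : Integrable g) {δ : ℝ} (hδ : δ ∈ Ioc (0 : ℝ) 1)
    (hag : Integrable fun η => a η ^ δ * ‖g η‖) (x : RN N) {t : ℝ} (ht : 0 < t) :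
    IntervalIntegrable (fun s => ((t - s) ^ (-ρ)) • deriv (mlEvolution ρ a g x) s) volume 0 t ∧
      caputoDeriv ρ (mlEvolution ρ a g x) t =
        -𝓕⁻ (fun η => (a η : ℂ) * (((mlTime ρ (a η) t : ℝ) : ℂ) * g η)) x := by
  obtain ⟨C, hC, hb⟩ := exists_mlTimeDeriv_bound hρ hρ'.le
  have hb := fun {lam t : ℝ} => abs_mlTimeDeriv_le (lam := lam) (t := t) hδ.1
    (hb δ (Ioc_subset_Icc_self hδ))
  set F : ℝ → RN N → ℂ := fun s η => Real.fourierChar (inner ℝ η x) •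
    ((((t - s) ^ (-ρ) * mlTimeDeriv ρ (a η) s : ℝ) : ℂ) * g η) with hF
  -- The dominating function is a product: (t-s)^{-ρ} s^{ρδ-1}, a Beta integrand, in time and a^δ
  -- |g| in frequency. Fubini then applies.
  have hint : Integrable (Function.uncurry F) ((volume.restrict (Ioc 0 t)).prod volume) := by
    have h1 : Integrable (fun s : ℝ => (t - s) ^ ((1 - ρ) - 1) * s ^ (ρ * δ - 1))
        (volume.restrict (Ioc 0 t)) :=
      (intervalIntegrable_iff_integrableOn_Ioc_of_le ht.le).1
        (intervalIntegrable_sub_rpow_mul_rpow (mul_pos hρ hδ.1) (by linarith) ht)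
    refine ((h1.mul_prod hag).const_mul C).mono' ?_ ?_
    · have he : Continuous fun v : RN N => Real.fourierChar (inner ℝ v x) := by fun_prop
      have hm : Measurable fun p : ℝ × RN N =>
          (((t - p.1) ^ (-ρ) * mlTimeDeriv ρ (a p.2) p.1 : ℝ) : ℂ) := by
        refine Complex.measurable_ofReal.comp (Measurable.mul (by fun_prop) ?_)
        exact (measurable_mlTimeDeriv hρ).comp
          ((ha.measurable.comp measurable_snd).prodMk measurable_fst)
      exact (he.comp continuous_snd).aestronglyMeasurable.smul
        (hm.aestronglyMeasurable.mul hg.1.comp_snd)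
    · have hae : ∀ᵐ p ∂((volume.restrict (Ioc (0 : ℝ) t)).prod (volume : Measure (RN N))),
          p.1 ∈ Ioc (0 : ℝ) t :=
        Measure.quasiMeasurePreserving_fst.ae (ae_restrict_mem measurableSet_Ioc)
      filter_upwards [hae] with p hp
      simp only [Function.uncurry, hF]
      rw [norm_fourierChar_smul_mul, abs_mul, abs_of_nonneg (Real.rpow_nonneg (by linarith [hp.2]) _)]
      have h3 : 0 ≤ (t - p.1) ^ (-ρ) := Real.rpow_nonneg (by linarith [hp.2]) _
      calc _ ≤ (t - p.1) ^ (-ρ) * (C * a p.2 ^ δ * p.1 ^ (ρ * δ - 1)) * ‖g p.2‖ := by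
            gcongr
            exact hb (ha0 _) hp.1
        _ = _ := by
            rw [show (1 - ρ) - 1 = -ρ by ring]
            ring
  have hderiv : ∀ s ∈ Ioc (0 : ℝ) t, ((t - s) ^ (-ρ)) • deriv (mlEvolution ρ a g x) s =
      ∫ η, F s η := by
    intro s hs
    rw [(hasDerivAt_mlEvolution hρ hρ'.le ha ha0 hg hδ hag x hs.1).deriv, ← integral_smul]
    congr 1
    ext η
    rw [hF, smul_comm]
    congr 1
    rw [Complex.real_smul]
    push_cast
    ring
  constructor
  · rw [intervalIntegrable_iff_integrableOn_Ioc_of_le ht.le]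
    exact (hint.integral_prod_left).congr
      ((ae_restrict_mem measurableSet_Ioc).mono fun s hs => (hderiv s hs).symm)
  · have hΓ : Real.Gamma (1 - ρ) ≠ 0 := (Real.Gamma_pos_of_pos (by linarith)).ne'
    rw [caputoDeriv, intervalIntegral.integral_of_le ht.le,
      setIntegral_congr_fun measurableSet_Ioc hderiv, integral_integral_swap hint]
    rw [Real.fourierInv_eq, ← integral_neg, ← integral_smul]
    congr 1
    ext η
    have h1 : ∫ s in Ioc 0 t, F s η = Real.fourierChar (inner ℝ η x) •
        ((((∫ s in (0 : ℝ)..t, (t - s) ^ (-ρ) * mlTimeDeriv ρ (a η) s : ℝ)) : ℂ) * g η) := by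
      rw [intervalIntegral.integral_of_le ht.le, ← integral_complex_ofReal, ← integral_mul_const]
      simp only [hF, Circle.smul_def]
      rw [integral_smul]
    rw [h1, integral_mlTimeDeriv hρ hρ' (ha0 η) ht, smul_comm, ← smul_neg]
    congr 1
    rw [Complex.real_smul]
    push_cast
    have hΓ' : (Real.Gamma (1 - ρ) : ℂ) ≠ 0 := by exact_mod_cast hΓ
    field_simp

/-- Since a |E_ρ(-a t^ρ)| ≤ C t^{-ρ}, a multiple of |g| dominates locally uniformly in t > 0, and no
decay of g beyond integrability is needed. -/
lemma continuousOn_fourierInv_symbol_mul (hρ : 0 < ρ) (hρ' : ρ ≤ 1) (ha : Continuous a)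
    (ha0 : ∀ η, 0 ≤ a η) (hg : Integrable g) :
    ContinuousOn (fun p : RN N × ℝ =>
      𝓕⁻ (fun η => (a η : ℂ) * (((mlTime ρ (a η) p.2 : ℝ) : ℂ) * g η)) p.1) (univ ×ˢ Ioi 0) := by
  obtain ⟨C, hC, hb⟩ := exists_mlTime_bound hρ hρ'
  intro p hp
  have hp2 : 0 < p.2 := hp.2
  refine ContinuousAt.continuousWithinAt ?_
  have : (fun p : RN N × ℝ =>
      𝓕⁻ (fun η => (a η : ℂ) * (((mlTime ρ (a η) p.2 : ℝ) : ℂ) * g η)) p.1) =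
      fun p => ∫ η, Real.fourierChar (inner ℝ η p.1) •
        (((a η * mlTime ρ (a η) p.2 : ℝ) : ℂ) * g η) := by
    ext q
    rw [Real.fourierInv_eq]
    congr 1
    ext η
    push_cast
    rw [mul_assoc]
  rw [this]
  have hev : ∀ᶠ q : RN N × ℝ in 𝓝 p, p.2 / 2 < q.2 :=
    continuous_snd.continuousAt.eventually_const_lt (half_lt_self hp2)
  refine continuousAt_of_dominated (bound := fun η => C * (p.2 / 2) ^ (-ρ) * ‖g η‖)
    (Eventually.of_forall fun q => ?_) (hev.mono fun q hq => ae_of_all _ fun η => ?_)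
    (hg.norm.const_mul _) (ae_of_all _ fun η => ?_)
  · have he : Continuous fun v : RN N => Real.fourierChar (inner ℝ v q.1) := by fun_prop
    have hm : Continuous fun η => ((a η * mlTime ρ (a η) q.2 : ℝ) : ℂ) :=
      Complex.continuous_ofReal.comp
        (ha.mul ((continuous_mlTime hρ).comp (ha.prodMk continuous_const)))
    exact he.aestronglyMeasurable.smul (hm.aestronglyMeasurable.mul hg.1)
  · have hq0 : 0 < q.2 := (half_pos hp2).trans hq
    rw [norm_fourierChar_smul_mul, abs_mul, abs_of_nonneg (ha0 η)]
    refine mul_le_mul_of_nonneg_right ?_ (norm_nonneg _)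
    have h1 := (hb _ _ (ha0 η) hq0.le).2
    have h2 : (p.2 / 2) ^ ρ ≤ q.2 ^ ρ := by gcongr
    rw [Real.rpow_neg (by positivity), ← div_eq_mul_inv, le_div_iff₀ (by positivity)]
    calc a η * |mlTime ρ (a η) q.2| * (p.2 / 2) ^ ρ ≤ a η * |mlTime ρ (a η) q.2| * q.2 ^ ρ := by
          have := ha0 η
          gcongr
      _ = a η * q.2 ^ ρ * |mlTime ρ (a η) q.2| := by ring
      _ ≤ C := h1
  · have : Continuous fun q : RN N × ℝ => mlTime ρ (a η) q.2 :=
      (continuous_mlTime hρ).comp (by fun_prop : Continuous fun q : RN N × ℝ => (a η, q.2))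
    have h2 : Continuous fun q : RN N × ℝ => Real.fourierChar (inner ℝ η q.1) := by fun_prop
    have h3 : Continuous fun q : RN N × ℝ => ((a η * mlTime ρ (a η) q.2 : ℝ) : ℂ) := by fun_prop
    exact (h2.smul (h3.mul continuous_const)).continuousAt

end

/-! ### Existence for the forward problem -/

section
variable {N l : ℕ} {A : MvPolynomial (Fin N) ℝ}

lemma continuous_symbol_two_pi (A : MvPolynomial (Fin N) ℝ) :
    Continuous fun η : RN N => symbol A ((2 * Real.pi) • η) :=
  (continuous_symbol A).comp (continuous_const_smul _)

/-- For `t > 0` the multiplier `E_ρ(-a t^ρ)` absorbs `2 l` powers of the frequency. -/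
lemma exists_norm_pow_mul_mlTime_le (hA : IsEllipticSymbol A l) {ρ : ℝ} (hρ : 0 < ρ) (hρ' : ρ ≤ 1)
    {t : ℝ} (ht : 0 < t) :
    ∃ C, ∀ n ≤ 2 * l, ∀ η : RN N, ‖η‖ ^ n * |mlTime ρ (symbol A ((2 * Real.pi) • η)) t| ≤ C := by
  obtain ⟨c, _, hc, _, hb⟩ := exists_symbol_bounds hA
  obtain ⟨C, hC, hm⟩ := exists_mlTime_bound hρ hρ'
  have hK : 0 < c * (2 * Real.pi) ^ (2 * l) * t ^ ρ := by positivity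
  refine ⟨C + C / (c * (2 * Real.pi) ^ (2 * l) * t ^ ρ), fun n hn η => ?_⟩
  set M := |mlTime ρ (symbol A ((2 * Real.pi) • η)) t|
  have hM : 0 ≤ M := abs_nonneg _
  obtain ⟨h1, h2⟩ := hm _ t (symbol_nonneg hA ((2 * Real.pi) • η)) ht.le
  have h3 := (hb ((2 * Real.pi) • η)).1
  rw [norm_smul, Real.norm_of_nonneg Real.two_pi_pos.le, mul_pow] at h3
  have h4 : ‖η‖ ^ (2 * l) * M ≤ C / (c * (2 * Real.pi) ^ (2 * l) * t ^ ρ) := by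
    rw [le_div_iff₀ hK]
    calc ‖η‖ ^ (2 * l) * M * (c * (2 * Real.pi) ^ (2 * l) * t ^ ρ)
        = c * ((2 * Real.pi) ^ (2 * l) * ‖η‖ ^ (2 * l)) * t ^ ρ * M := by ring
      _ ≤ symbol A ((2 * Real.pi) • η) * t ^ ρ * M := by gcongr
      _ ≤ C := h2
  have h5 : ‖η‖ ^ n ≤ 1 + ‖η‖ ^ (2 * l) := by
    rcases le_total ‖η‖ 1 with h | h
    · have := pow_le_one₀ (n := n) (norm_nonneg η) h
      have := pow_nonneg (norm_nonneg η) (2 * l)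
      linarith
    · have := pow_le_pow_right₀ h hn
      linarith
  calc ‖η‖ ^ n * M ≤ (1 + ‖η‖ ^ (2 * l)) * M := by gcongr
    _ = M + ‖η‖ ^ (2 * l) * M := by ring
    _ ≤ _ := add_le_add h1 h4

lemma integrable_norm_pow_mul_mlTime (hA : IsEllipticSymbol A l) {ρ : ℝ} (hρ : 0 < ρ)
    (hρ' : ρ ≤ 1) {t : ℝ} (ht : 0 < t) {g : RN N → ℂ} (hg : Integrable g) {n : ℕ}
    (hn : n ≤ 2 * l) : Integrable fun η : RN N =>
      ‖η‖ ^ n * ‖((mlTime ρ (symbol A ((2 * Real.pi) • η)) t : ℝ) : ℂ) * g η‖ := by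
  obtain ⟨C, hC⟩ := exists_norm_pow_mul_mlTime_le hA hρ hρ' ht
  refine (hg.norm.const_mul C).mono' ?_ (ae_of_all _ fun η => ?_)
  · have h1 : Continuous fun η : RN N => ‖η‖ ^ n := by fun_prop
    exact h1.aestronglyMeasurable.mul (((continuous_mlTime_comp hρ
      (continuous_symbol_two_pi A) t).aestronglyMeasurable.mul hg.1).norm)
  · rw [norm_mul, norm_pow, norm_norm, norm_norm, norm_mul, Complex.norm_real, Real.norm_eq_abs,
      ← mul_assoc]
    exact mul_le_mul_of_nonneg_right (hC n hn η) (norm_nonneg _)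

/-- The multiplier E_ρ(-a t^ρ) absorbs the polynomial of degree at most 2l. A bounded multiplier
keeps g in L_1 ∩ L_2, from which decay at infinity and square integrability of the derivatives
follow. -/
lemma multiD_mlEvolution (hA : IsEllipticSymbol A l) {ρ : ℝ} (hρ : 0 < ρ)
    (hρ' : ρ ≤ 1) {t : ℝ} (ht : 0 < t) {g : RN N → ℂ} (hg : Integrable g) {α : Fin N →₀ ℕ}
    (hα : order α ≤ 2 * l) :
    ∃ b : RN N → ℂ, Continuous b ∧ (∃ C, ∀ η, ‖b η‖ ≤ C) ∧
      multiD α (fun x => mlEvolution ρ (fun η => symbol A ((2 * Real.pi) • η)) g x t) =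
        𝓕⁻ (fun η => b η * g η) := by
  refine ⟨fun η => ((∏ j, (2 * Real.pi * η j) ^ α j : ℝ) : ℂ) *
    ((mlTime ρ (symbol A ((2 * Real.pi) • η)) t : ℝ) : ℂ), ?_, ?_, ?_⟩
  · exact Continuous.mul (by fun_prop) (continuous_mlTime_comp hρ (continuous_symbol_two_pi A) t)
  · obtain ⟨C, hC⟩ := exists_norm_pow_mul_mlTime_le hA hρ hρ' ht
    refine ⟨(2 * Real.pi) ^ order α * C, fun η => ?_⟩
    have h1 := norm_prod_map_le (multiWord α) η
    rw [prod_map_multiWord, length_multiWord, mul_pow] at h1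
    have h2 : ‖((∏ j, (2 * Real.pi * η j) ^ α j : ℝ) : ℂ)‖ =
        ‖∏ j, (2 * Real.pi * Complex.I * η j : ℂ) ^ α j‖ := by simp [norm_prod]
    rw [norm_mul, h2, Complex.norm_real, Real.norm_eq_abs]
    calc _ ≤ (2 * Real.pi) ^ order α * ‖η‖ ^ order α *
          |mlTime ρ (symbol A ((2 * Real.pi) • η)) t| := by gcongr
      _ ≤ _ := by
        rw [mul_assoc]
        gcongr
        exact hC _ hα η
  · refine (multiD_fourierInv α ((continuous_mlTime_comp hρ
      (continuous_symbol_two_pi A) t).aestronglyMeasurable.mul hg.1)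
      fun n hn => integrable_norm_pow_mul_mlTime hA hρ hρ' ht hg (hn.trans hα)).trans ?_
    simp only [mul_assoc, Pi.mul_apply]

lemma isClassicalSolution_mlEvolution (hA : IsEllipticSymbol A l) {ρ : ℝ} (hρ : 0 < ρ)
    (hρ' : ρ < 1) {T : ℝ} {g : RN N → ℂ} (hg : Integrable g) {δ : ℝ} (hδ : δ ∈ Ioc (0 : ℝ) 1)
    (hag : Integrable fun η => symbol A ((2 * Real.pi) • η) ^ δ * ‖g η‖) :
    IsClassicalSolution A l T ρ (𝓕⁻ g)
      (mlEvolution ρ (fun η => symbol A ((2 * Real.pi) • η)) g) := by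
  have ha := continuous_symbol_two_pi A
  have ha0 : ∀ η : RN N, 0 ≤ symbol A ((2 * Real.pi) • η) := fun η => symbol_nonneg hA _
  have hdiff : ∀ t, 0 < t → ∀ x,
      diffOp A (fun x => mlEvolution ρ (fun η => symbol A ((2 * Real.pi) • η)) g x t) x =
      𝓕⁻ (fun η => ((symbol A ((2 * Real.pi) • η) : ℝ) : ℂ) *
        (((mlTime ρ (symbol A ((2 * Real.pi) • η)) t : ℝ) : ℂ) * g η)) x := fun t ht x =>
    congrFun (diffOp_fourierInv hA.homogeneous ((continuous_mlTime_comp hρ ha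
      t).aestronglyMeasurable.mul hg.1)
      fun n hn => integrable_norm_pow_mul_mlTime hA hρ hρ'.le ht hg hn) x
  have hcap := fun x {t : ℝ} (ht : 0 < t) => caputo_mlEvolution hρ hρ' ha ha0 hg hδ hag x ht
  have hcont := continuousOn_fourierInv_symbol_mul hρ hρ'.le ha ha0 hg
  have hsub : (univ : Set (RN N)) ×ˢ Ioc 0 T ⊆ univ ×ˢ Ioi 0 :=
    prod_mono_right fun t ht => ht.1
  refine ⟨fun x => ⟨?_, fun t ht => ?_, fun t ht => (hcap x ht.1).1⟩, fun t ht => ?_, ?_, ?_,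
    fun x t ht => ?_, fun t ht α hα => ?_, fun x => mlEvolution_zero hρ x⟩
  · exact (continuousOn_mlEvolution hρ hρ'.le ha ha0 hg x).mono Icc_subset_Ici_self
  · exact (hasDerivAt_mlEvolution hρ hρ'.le ha ha0 hg hδ hag x ht.1).differentiableAt
  · exact contDiff_fourierInv fun n hn => integrable_norm_pow_mul_mlTime hA hρ hρ'.le ht.1 hg hn
  · exact (hcont.neg.mono hsub).congr fun p hp => (hcap p.1 hp.2.1).2
  · exact (hcont.mono hsub).congr fun p hp => hdiff p.2 hp.2.1 p.1
  · rw [(hcap x ht.1).2, hdiff t ht.1 x, neg_add_cancel]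
  · obtain ⟨b, -, -, h⟩ := multiD_mlEvolution hA hρ hρ'.le ht.1 hg (α := α)
      (hα.le.trans (by omega))
    rw [h]
    exact tendsto_fourierInv_cocompact _

lemma fourier_mlEvolution (hA : IsEllipticSymbol A l) {ρ : ℝ} (hρ : 0 < ρ) (hρ' : ρ ≤ 1) {t : ℝ}
    (ht : 0 ≤ t) {g : RN N → ℂ} (hg : Integrable g) (hg2 : MemLp g 2 volume) :
    ∃ hu : MemLp (fun x => mlEvolution ρ (fun η => symbol A ((2 * Real.pi) • η)) g x t) 2 volume,
      ((𝓕 (hu.toLp _) : Lp ℂ 2 (volume : Measure (RN N))) : RN N → ℂ) =ᵐ[volume]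
        fun η => ((mlTime ρ (symbol A ((2 * Real.pi) • η)) t : ℝ) : ℂ) * g η := by
  obtain ⟨C, hC, hm⟩ := exists_mlTime_bound hρ hρ'
  have hb : ∀ η : RN N, ‖((mlTime ρ (symbol A ((2 * Real.pi) • η)) t : ℝ) : ℂ)‖ ≤ C := fun η => by
    rw [Complex.norm_real]
    exact (hm _ t (symbol_nonneg hA _) ht).1
  have hc := continuous_mlTime_comp hρ (continuous_symbol_two_pi A) t
  have h1 := integrable_bdd_mul hc hb hg
  have h2 := memLp_bdd_mul hc hb hg2
  refine ⟨memLp_fourierInv h1 h2, ?_⟩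
  have := fourier_toLp_fourierInv h1 h2 (memLp_fourierInv h1 h2)
  change (((𝓕 ((memLp_fourierInv h1 h2).toLp _) : Lp ℂ 2 (volume : Measure (RN N))) : RN N → ℂ))
    =ᵐ[volume] _
  rw [this]
  exact h2.coeFn_toLp

lemma isRegular_mlEvolution (hA : IsEllipticSymbol A l) {ρ : ℝ} (hρ : 0 < ρ) (hρ' : ρ ≤ 1)
    {T : ℝ} {g : RN N → ℂ} (hg : Integrable g) (hg2 : MemLp g 2 volume) :
    IsRegular l T (mlEvolution ρ (fun η => symbol A ((2 * Real.pi) • η)) g) := by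
  obtain ⟨C, hC, hm⟩ := exists_mlTime_bound hρ hρ'
  have hb : ∀ t, 0 ≤ t → ∀ η : RN N,
      ‖((mlTime ρ (symbol A ((2 * Real.pi) • η)) t : ℝ) : ℂ)‖ ≤ C := fun t ht η => by
    rw [Complex.norm_real]
    exact (hm _ t (symbol_nonneg hA _) ht).1
  have hc := continuous_mlTime_comp hρ (continuous_symbol_two_pi A)
  refine ⟨fun t ht α _ hα => ?_, fun t ht α hα => ?_, fun t ht => ?_,
    C * (eLpNorm g 2 volume).toReal, fun t ht => ?_⟩
  · obtain ⟨b, -, -, h⟩ := multiD_mlEvolution hA hρ hρ' ht.1 hg (α := α) hα.le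
    rw [h]
    exact tendsto_fourierInv_cocompact _
  · obtain ⟨b, hbc, ⟨K, hK⟩, h⟩ := multiD_mlEvolution hA hρ hρ' ht.1 hg (α := α) hα
    rw [h]
    exact memLp_fourierInv (integrable_bdd_mul hbc hK hg) (memLp_bdd_mul hbc hK hg2)
  · obtain ⟨hu, h⟩ := fourier_mlEvolution hA hρ hρ' ht.1.le hg hg2
    exact ⟨hu, (integrable_fourierL2_iff hu).2
      ((integrable_congr h).2 (integrable_bdd_mul (hc t) (hb t ht.1.le) hg))⟩
  · change eLpNorm (𝓕⁻ _) 2 volume ≤ _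
    rw [eLpNorm_fourierInv (integrable_bdd_mul (hc t) (hb t ht.1.le) hg)
      (memLp_bdd_mul (hc t) (hb t ht.1.le) hg2), ENNReal.ofReal_mul hC.le,
      ENNReal.ofReal_toReal hg2.eLpNorm_ne_top]
    refine eLpNorm_le_mul_eLpNorm_of_ae_le_mul (ae_of_all _ fun η => ?_) 2
    rw [norm_mul]
    exact mul_le_mul_of_nonneg_right (hb t ht.1.le η) (norm_nonneg _)

/-- The forward problem has a solution whose transform is `E_ρ(-A(ξ) t^ρ) φ̂(ξ)`. -/
theorem exists_forward_solution (hA : IsEllipticSymbol A l) {τ : ℝ} (hτ : (N : ℝ) / 2 < τ)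
    {φ : RN N → ℂ} (hφc : Continuous φ) (hφs : MemSobolevL2 τ φ) (hφ : MemLp φ 2 volume)
    {ρ : ℝ} (hρ : 0 < ρ) (hρ' : ρ < 1) (T : ℝ) :
    ∃ u : RN N → ℝ → ℂ, IsClassicalSolution A l T ρ φ u ∧ IsRegular l T u ∧
      ∀ t, 0 ≤ t → ∃ hu : MemLp (fun x => u x t) 2 volume,
        fourierL2 (fun x => u x t) hu =ᵐ[volume]
          fun ξ => ((mlTime ρ (symbol A ξ) t : ℝ) : ℂ) * fourierL2 φ hφ ξ := by
  have hg := integrable_fourier_of_memSobolev hτ hφs hφ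
  obtain ⟨δ, hδ, hag⟩ := exists_integrable_symbol_rpow_mul_fourier hA hτ hφs hφ
  set g := (𝓕 (hφ.toLp φ) : Lp ℂ 2 (volume : Measure (RN N))) with hgdef
  have hφg : φ = 𝓕⁻ (g : RN N → ℂ) := eq_fourierInv_of_integrable hφc hφ hg
  refine ⟨mlEvolution ρ (fun η => symbol A ((2 * Real.pi) • η)) g, ?_,
    isRegular_mlEvolution hA hρ hρ'.le hg (Lp.memLp g), fun t ht => ?_⟩
  · have := isClassicalSolution_mlEvolution hA hρ hρ' (T := T) hg hδ hag
    rwa [← hφg] at this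
  · obtain ⟨hu, h⟩ := fourier_mlEvolution hA hρ hρ'.le ht hg (Lp.memLp g)
    refine ⟨hu, (fourierL2_ae_eq hu h).trans (ae_of_all _ fun ξ => ?_)⟩
    dsimp only
    rw [smul_smul, mul_inv_cancel₀ Real.two_pi_pos.ne', one_smul, fourierL2, mul_smul_comm]

end

/-! ### Riemann-Liouville integrals -/

/-- The Riemann-Liouville integral of order `α`, without the factor `1 / Γ(α)`. -/
def rlIntegral (α : ℝ) (f : ℝ → ℂ) (t : ℝ) : ℂ :=
  ∫ s in (0 : ℝ)..t, ((t - s) ^ (α - 1)) • f s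

/-- The constant in the composition law of Riemann-Liouville integrals. -/
def rlBeta (α β : ℝ) : ℝ := Real.Gamma α * Real.Gamma β / Real.Gamma (α + β)

lemma rlBeta_comm (α β : ℝ) : rlBeta α β = rlBeta β α := by
  rw [rlBeta, rlBeta, mul_comm, add_comm]

lemma integral_sub_rpow_mul_sub_rpow {α β r t : ℝ} (hα : 0 < α) (hβ : 0 < β) (hrt : r < t) :
    ∫ s in r..t, (t - s) ^ (α - 1) * (s - r) ^ (β - 1) = (t - r) ^ (α + β - 1) * rlBeta α β := by
  have h1 := intervalIntegral.integral_comp_sub_right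
    (fun s => (t - r - s) ^ (α - 1) * s ^ (β - 1)) r (a := r) (b := t)
  rw [sub_self, integral_sub_rpow_mul_rpow hβ hα (sub_pos.2 hrt), add_comm β α,
    mul_comm (Real.Gamma β)] at h1
  rw [rlBeta, ← h1]
  simp only [sub_sub_sub_cancel_right]

lemma intervalIntegrable_sub_rpow_mul_sub_rpow {α β r t : ℝ} (hα : 0 < α) (hβ : 0 < β)
    (hrt : r < t) :
    IntervalIntegrable (fun s => (t - s) ^ (α - 1) * (s - r) ^ (β - 1)) volume r t := by
  have h := (intervalIntegrable_sub_rpow_mul_rpow hβ hα (sub_pos.2 hrt)).comp_sub_right r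
  simpa only [sub_sub_sub_cancel_right, zero_add, sub_add_cancel] using h

/-- The composition law of Riemann-Liouville integrals. -/
lemma rlIntegral_rlIntegral {α β t : ℝ} (hα : 0 < α) (hβ : 0 < β) (ht : 0 < t) {f : ℝ → ℂ}
    (hm : AEStronglyMeasurable f (volume.restrict (Ioc 0 t)))
    (hf : IntervalIntegrable (fun r => ((t - r) ^ (α + β - 1)) • f r) volume 0 t) :
    IntervalIntegrable (fun s => ((t - s) ^ (α - 1)) • rlIntegral β f s) volume 0 t ∧
      rlIntegral α (rlIntegral β f) t = rlBeta α β • rlIntegral (α + β) f t := by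
  have hf' := (intervalIntegrable_iff_integrableOn_Ioc_of_le ht.le).1 hf
  set k : ℝ → ℝ → ℝ := fun s r => (t - s) ^ (α - 1) * (s - r) ^ (β - 1) with hk
  -- The indicator of the triangle r ≤ s extends the integrand to the square, where Fubini applies;
  -- the inner integral in s is a Beta integral.
  set G : ℝ × ℝ → ℂ := {p : ℝ × ℝ | p.2 ≤ p.1}.indicator fun p => k p.1 p.2 • f p.2 with hG
  have hset : MeasurableSet {p : ℝ × ℝ | p.2 ≤ p.1} := measurableSet_le measurable_snd measurable_fst
  have hslice : ∀ r, ∀ g : ℝ → ℂ, r ∈ Ioc 0 t →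
      (∫ s in Ioc 0 t, (Ici r).indicator g s) = ∫ s in r..t, g s := by
    intro r g hr
    rw [setIntegral_indicator measurableSet_Ici,
      intervalIntegral.integral_of_le hr.2, ← integral_Icc_eq_integral_Ioc]
    congr 2
    ext s
    simp only [mem_inter_iff, mem_Ioc, mem_Ici, mem_Icc]
    exact ⟨fun h => ⟨h.2, h.1.2⟩, fun h => ⟨⟨hr.1.trans_le h.1, h.2⟩, h.1⟩⟩
  have hkint : ∀ r ∈ Ioc 0 t, r ≠ t → IntervalIntegrable (fun s => k s r) volume r t :=
    fun r hr hrt => intervalIntegrable_sub_rpow_mul_sub_rpow hα hβ (lt_of_le_of_ne hr.2 hrt)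
  have hkpos : ∀ r ∈ Ioc 0 t, ∀ s ∈ Icc r t, 0 ≤ k s r := fun r hr s hs =>
    mul_nonneg (Real.rpow_nonneg (by linarith [hs.2]) _) (Real.rpow_nonneg (by linarith [hs.1]) _)
  have hae : ∀ᵐ r ∂(volume.restrict (Ioc 0 t)), r ∈ Ioc 0 t ∧ r ≠ t := by
    have h1 : ∀ᵐ r ∂(volume.restrict (Ioc 0 t)), r ≠ t :=
      ae_restrict_of_ae (Measure.ae_ne volume t)
    filter_upwards [ae_restrict_mem measurableSet_Ioc, h1] with r h h' using ⟨h, h'⟩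
  have hGm : AEStronglyMeasurable G ((volume.restrict (Ioc 0 t)).prod
      (volume.restrict (Ioc 0 t))) := by
    refine AEStronglyMeasurable.indicator ?_ hset
    have : Measurable fun p : ℝ × ℝ => k p.1 p.2 := by fun_prop
    exact this.aestronglyMeasurable.smul hm.comp_snd
  have hGs : ∀ r s, G (s, r) = (Ici r).indicator (fun s => k s r • f r) s := fun r s => rfl
  have hGint : Integrable G ((volume.restrict (Ioc 0 t)).prod (volume.restrict (Ioc 0 t))) := by
    rw [integrable_prod_iff' hGm]
    constructor
    · filter_upwards [hae] with r ⟨hr, hrt⟩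
      simp only [hGs]
      rw [integrable_indicator_iff measurableSet_Ici]
      rw [IntegrableOn, Measure.restrict_restrict measurableSet_Ici]
      have h1 := (intervalIntegrable_iff_integrableOn_Icc_of_le hr.2).1 (hkint r hr hrt)
      refine (h1.smul_const (f r)).mono_measure (Measure.restrict_mono ?_ le_rfl)
      rintro s ⟨h2, h3⟩
      exact ⟨h2, h3.2⟩
    · refine (hf'.norm.const_mul (rlBeta α β)).congr ?_
      filter_upwards [hae] with r ⟨hr, hrt⟩
      -- The norms are viewed as complex numbers so that `hslice`, stated for complex-valued
      -- functions, applies to them.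
      have h1 : ∀ s, ((‖G (s, r)‖ : ℝ) : ℂ) =
          (Ici r).indicator (fun s => ((‖k s r • f r‖ : ℝ) : ℂ)) s := by
        intro s
        rw [hGs, norm_indicator_eq_indicator_norm]
        by_cases h : s ∈ (Ici r) <;> simp [h]
      have h2 : ((∫ s in Ioc 0 t, ‖G (s, r)‖ : ℝ) : ℂ) =
          ((‖((t - r) ^ (α + β - 1)) • f r‖ * rlBeta α β : ℝ) : ℂ) := by
        rw [← integral_complex_ofReal]
        simp only [h1]
        rw [hslice r _ hr, intervalIntegral.integral_ofReal]
        congr 1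
        rw [norm_smul, Real.norm_of_nonneg (Real.rpow_nonneg (by linarith [hr.2]) _), mul_right_comm,
          ← integral_sub_rpow_mul_sub_rpow hα hβ (lt_of_le_of_ne hr.2 hrt),
          ← intervalIntegral.integral_mul_const]
        refine intervalIntegral.integral_congr fun s hs => ?_
        rw [uIcc_of_le hr.2] at hs
        rw [norm_smul, Real.norm_of_nonneg (hkpos r hr s hs)]
      rw [mul_comm]
      exact (Complex.ofReal_injective h2).symm
  have hswap := integral_integral_swap (f := fun s r => G (s, r)) hGint
  have hinner : ∀ s ∈ Ioc 0 t, ∫ r in Ioc 0 t, G (s, r) =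
      ((t - s) ^ (α - 1)) • rlIntegral β f s := fun s hs => by
    have h1 : ∀ r, G (s, r) = (Iic s).indicator (fun r => k s r • f r) r := fun r => rfl
    simp only [h1]
    rw [setIntegral_indicator measurableSet_Iic, Ioc_inter_Iic, min_eq_right hs.2, rlIntegral,
      intervalIntegral.integral_of_le hs.1.le, ← integral_smul]
    simp only [hk, smul_smul]
  have hL : ∫ s in Ioc 0 t, ∫ r in Ioc 0 t, G (s, r) = rlIntegral α (rlIntegral β f) t := by
    rw [rlIntegral, intervalIntegral.integral_of_le ht.le]
    exact setIntegral_congr_fun measurableSet_Ioc hinner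
  have hR : ∫ r in Ioc 0 t, ∫ s in Ioc 0 t, G (s, r) = rlBeta α β • rlIntegral (α + β) f t := by
    rw [rlIntegral, intervalIntegral.integral_of_le ht.le, ← integral_smul]
    refine integral_congr_ae ?_
    filter_upwards [hae] with r ⟨hr, hrt⟩
    simp only [hGs]
    rw [hslice r _ hr, intervalIntegral.integral_smul_const,
      integral_sub_rpow_mul_sub_rpow hα hβ (lt_of_le_of_ne hr.2 hrt), smul_smul, mul_comm]
  refine ⟨?_, by rw [← hL, ← hR, hswap]⟩
  rw [intervalIntegrable_iff_integrableOn_Ioc_of_le ht.le]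
  exact (hGint.integral_prod_left).congr ((ae_restrict_mem measurableSet_Ioc).mono hinner)

lemma rlIntegral_one (f : ℝ → ℂ) (t : ℝ) : rlIntegral 1 f t = ∫ s in (0 : ℝ)..t, f s := by
  simp [rlIntegral]

lemma intervalIntegrable_sub_rpow {α t : ℝ} (hα : 0 < α) :
    IntervalIntegrable (fun s => (t - s) ^ (α - 1)) volume 0 t := by
  have := (intervalIntegral.intervalIntegrable_rpow' (a := 0) (b := t) (r := α - 1)
    (by linarith)).comp_sub_left t
  simpa using this.symm

lemma integral_sub_rpow {α t : ℝ} (hα : 0 < α) :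
    ∫ s in (0 : ℝ)..t, (t - s) ^ (α - 1) = t ^ α / α := by
  rw [intervalIntegral.integral_comp_sub_left (fun s => s ^ (α - 1)) t, sub_self, sub_zero,
    integral_rpow (Or.inl (by linarith)), sub_add_cancel, Real.zero_rpow hα.ne', sub_zero]

lemma intervalIntegrable_sub_rpow_smul {α t : ℝ} (hα : 0 < α) {f : ℝ → ℂ}
    (hm : AEStronglyMeasurable f (volume.restrict (uIoc 0 t))) {C : ℝ} (hC : ∀ s, ‖f s‖ ≤ C) :
    IntervalIntegrable (fun s => ((t - s) ^ (α - 1)) • f s) volume 0 t := by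
  have h := (intervalIntegrable_sub_rpow (t := t) hα)
  rw [intervalIntegrable_iff] at h ⊢
  exact h.smul_bdd C hm (ae_of_all _ hC)

lemma norm_rlIntegral_le {α t : ℝ} (hα : 0 < α) (ht : 0 ≤ t) {f : ℝ → ℂ} {C : ℝ}
    (hC : ∀ s, ‖f s‖ ≤ C) : ‖rlIntegral α f t‖ ≤ t ^ α / α * C := by
  rw [← integral_sub_rpow hα, ← intervalIntegral.integral_mul_const]
  refine intervalIntegral.norm_integral_le_of_norm_le ht (ae_of_all _ fun s hs => ?_)
    ((intervalIntegrable_sub_rpow hα).mul_const C)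
  rw [norm_smul, Real.norm_of_nonneg (Real.rpow_nonneg (by linarith [hs.2]) _)]
  exact mul_le_mul_of_nonneg_left (hC s) (Real.rpow_nonneg (by linarith [hs.2]) _)

/-! ### Integrating the Caputo derivative -/

section
variable {ρ T : ℝ} {h : ℝ → ℂ}

/-- Multiply the integrable function (t-s)^{-ρ} h'(s) by the continuous (t-s)^ρ. The open interval
avoids s = t, where the product of the two powers is not 1. -/
lemma CaputoDifferentiable.intervalIntegrable_deriv (hh : CaputoDifferentiable ρ T h) (hρ : 0 < ρ)
    {t : ℝ} (ht : t ∈ Ioc 0 T) : IntervalIntegrable (deriv h) volume 0 t := by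
  have h1 := hh.intervalIntegrable t ht
  have h2 : ContinuousOn (fun s => (t - s) ^ ρ) (uIcc 0 t) :=
    (Continuous.rpow_const (by fun_prop) fun _ => Or.inr hρ.le).continuousOn
  have h3 := h1.continuousOn_smul h2
  rw [intervalIntegrable_iff_integrableOn_Ioo_of_le ht.1.le] at h3 ⊢
  refine h3.congr_fun (fun s hs => ?_) measurableSet_Ioo
  have : 0 < t - s := sub_pos.2 hs.2
  dsimp only
  rw [smul_smul, ← Real.rpow_add this, add_neg_cancel, Real.rpow_zero, one_smul]

lemma CaputoDifferentiable.integral_deriv (hh : CaputoDifferentiable ρ T h) (hρ : 0 < ρ)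
    {t : ℝ} (ht : t ∈ Icc 0 T) : ∫ s in (0 : ℝ)..t, deriv h s = h t - h 0 := by
  rcases ht.1.eq_or_lt with rfl | h0
  · simp
  refine intervalIntegral.integral_eq_sub_of_hasDerivAt_of_le ht.1
    (hh.continuousOn.mono (Icc_subset_Icc_right ht.2)) (fun s hs => ?_)
    (hh.intervalIntegrable_deriv hρ ⟨h0, ht.2⟩)
  exact (hh.differentiableAt s ⟨hs.1, hs.2.trans_le ht.2⟩).hasDerivAt

/-- `I^{1-ρ} (h - h(0)) = I^1 D^ρ h`, and the right-hand side converges absolutely. -/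
lemma CaputoDifferentiable.rlIntegral_sub (hh : CaputoDifferentiable ρ T h) (hρ : 0 < ρ)
    (hρ' : ρ < 1) {t : ℝ} (ht : t ∈ Ioc 0 T) :
    IntervalIntegrable (caputoDeriv ρ h) volume 0 t ∧
      rlIntegral (1 - ρ) (fun s => h s - h 0) t =
        Real.Gamma (1 - ρ) • ∫ s in (0 : ℝ)..t, caputoDeriv ρ h s := by
  have hΓ : Real.Gamma (1 - ρ) ≠ 0 := (Real.Gamma_pos_of_pos (by linarith)).ne'
  have hi := hh.intervalIntegrable_deriv hρ ht
  have hm : AEStronglyMeasurable (deriv h) (volume.restrict (Ioc 0 t)) :=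
    ((intervalIntegrable_iff_integrableOn_Ioc_of_le ht.1.le).1 hi).aestronglyMeasurable
  have hint : ∀ γ : ℝ, γ = 1 - ρ →
      IntervalIntegrable (fun r => ((t - r) ^ γ) • deriv h r) volume 0 t := by
    rintro γ rfl
    exact hi.continuousOn_smul
      (Continuous.rpow_const (by fun_prop) fun _ => Or.inr (by linarith)).continuousOn
  have hcap : caputoDeriv ρ h = fun s => (1 / Real.Gamma (1 - ρ)) • rlIntegral (1 - ρ) (deriv h) s := by
    ext s
    rw [caputoDeriv, rlIntegral]
    simp only [sub_sub_cancel_left]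
  -- Both I^{1-ρ} I^1 and I^1 I^{1-ρ} are the same multiple of the integral of order 2-ρ of h', so
  -- they agree.
  have h1 := (rlIntegral_rlIntegral (α := 1 - ρ) (β := 1) (by linarith) one_pos ht.1 hm
    (hint _ (by ring))).2
  obtain ⟨h0, h2⟩ := rlIntegral_rlIntegral (α := 1) (β := 1 - ρ) one_pos (by linarith) ht.1 hm
    (hint _ (by ring))
  rw [rlBeta_comm, add_comm, ← h2, rlIntegral_one] at h1
  simp only [sub_self, Real.rpow_zero, one_smul] at h0
  have h3 : rlIntegral (1 - ρ) (fun s => h s - h 0) t =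
      rlIntegral (1 - ρ) (rlIntegral 1 (deriv h)) t := by
    refine intervalIntegral.integral_congr fun s hs => ?_
    rw [uIcc_of_le ht.1.le] at hs
    dsimp only
    rw [rlIntegral_one, hh.integral_deriv hρ ⟨hs.1, hs.2.trans ht.2⟩]
  refine ⟨by rw [hcap]; exact h0.smul (1 / Real.Gamma (1 - ρ)), ?_⟩
  rw [h3, h1, hcap, intervalIntegral.integral_smul, smul_smul, mul_one_div_cancel hΓ, one_smul]

end

/-! ### Bounded curves of square integrable functions -/

/-- A jointly measurable function of `(x, s)` whose `L_2` norm in `x` is bounded by `K`. -/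
structure IsL2Curve {N : ℕ} (K : ℝ) (w : RN N → ℝ → ℂ) : Prop where
  measurable : StronglyMeasurable (Function.uncurry w)
  bound : ∀ s, eLpNorm (fun x => w x s) 2 volume ≤ ENNReal.ofReal K

/-- The bilinear pairing `∫ ψ(x) w(x, s) dx`. -/
def pairing {N : ℕ} (ψ : RN N → ℂ) (w : RN N → ℝ → ℂ) (s : ℝ) : ℂ := ∫ x, ψ x * w x s

section
variable {N : ℕ} {K : ℝ} {w : RN N → ℝ → ℂ} {ψ : RN N → ℂ}

lemma IsL2Curve.memLp (hw : IsL2Curve K w) (s : ℝ) : MemLp (fun x => w x s) 2 volume :=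
  ⟨(hw.measurable.comp_measurable measurable_prodMk_right).aestronglyMeasurable,
    (hw.bound s).trans_lt ENNReal.ofReal_lt_top⟩

lemma IsL2Curve.integrable_mul (hw : IsL2Curve K w) (hψ : MemLp ψ 2 volume) (s : ℝ) :
    Integrable fun x => ψ x * w x s :=
  hψ.integrable_mul (hw.memLp s)

lemma IsL2Curve.integral_norm_mul_le (hw : IsL2Curve K w) (hψ : MemLp ψ 2 volume) (s : ℝ) :
    ∫ x, ‖ψ x * w x s‖ ≤ (eLpNorm ψ 2 volume).toReal * max K 0 := by
  have h1 : eLpNorm (ψ • fun x => w x s) 1 volume ≤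
      eLpNorm ψ 2 volume * eLpNorm (fun x => w x s) 2 volume :=
    eLpNorm_smul_le_mul_eLpNorm (hw.memLp s).1 hψ.1
  have h2 : eLpNorm (ψ • fun x => w x s) 1 volume ≤
      eLpNorm ψ 2 volume * ENNReal.ofReal K := h1.trans (by gcongr; exact hw.bound s)
  rw [integral_norm_eq_lintegral_enorm (hw.integrable_mul hψ s).1]
  have h3 := ENNReal.toReal_mono (ENNReal.mul_ne_top hψ.eLpNorm_ne_top ENNReal.ofReal_ne_top) h2
  rw [ENNReal.toReal_mul, ENNReal.toReal_ofReal', eLpNorm_one_eq_lintegral_enorm] at h3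
  exact h3

lemma IsL2Curve.norm_pairing_le (hw : IsL2Curve K w) (hψ : MemLp ψ 2 volume) (s : ℝ) :
    ‖pairing ψ w s‖ ≤ (eLpNorm ψ 2 volume).toReal * max K 0 :=
  (norm_integral_le_integral_norm _).trans (hw.integral_norm_mul_le hψ s)

lemma IsL2Curve.integrable_prod (hw : IsL2Curve K w) (hψ : MemLp ψ 2 volume) {ν : Measure ℝ}
    [SFinite ν] {k : ℝ → ℝ} (hk : Integrable k ν) :
    Integrable (fun p : RN N × ℝ => k p.2 • (ψ p.1 * w p.1 p.2)) (volume.prod ν) := by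
  have hm : AEStronglyMeasurable (fun p : RN N × ℝ => k p.2 • (ψ p.1 * w p.1 p.2))
      (volume.prod ν) :=
    hk.1.comp_snd.smul (hψ.1.comp_fst.mul hw.measurable.aestronglyMeasurable)
  rw [integrable_prod_iff' hm]
  refine ⟨ae_of_all _ fun s => (hw.integrable_mul hψ s).smul (k s), ?_⟩
  refine (hk.norm.mul_const ((eLpNorm ψ 2 volume).toReal * max K 0)).mono'
    hm.norm.prod_swap.integral_prod_right' (ae_of_all _ fun s => ?_)
  dsimp only
  rw [Real.norm_of_nonneg (integral_nonneg fun _ => norm_nonneg _)]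
  simp only [norm_smul (k s)]
  rw [integral_const_mul]
  exact mul_le_mul_of_nonneg_left (hw.integral_norm_mul_le hψ s) (norm_nonneg _)

lemma IsL2Curve.aestronglyMeasurable_pairing (hw : IsL2Curve K w) (hψ : MemLp ψ 2 volume)
    (ν : Measure ℝ) [SFinite ν] : AEStronglyMeasurable (pairing ψ w) ν :=
  (hψ.1.comp_fst.mul hw.measurable.aestronglyMeasurable :
    AEStronglyMeasurable (fun p : RN N × ℝ => ψ p.1 * w p.1 p.2)
      (volume.prod ν)).prod_swap.integral_prod_right'

lemma IsL2Curve.integral_prod_eq (hw : IsL2Curve K w) (hψ : MemLp ψ 2 volume) {t : ℝ}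
    (ht : 0 ≤ t) {k : ℝ → ℝ} (hk : IntervalIntegrable k volume 0 t) :
    ∫ p, k p.2 • (ψ p.1 * w p.1 p.2) ∂(volume.prod (volume.restrict (Ioc 0 t))) =
      ∫ s in (0 : ℝ)..t, k s • pairing ψ w s := by
  have hk' := (intervalIntegrable_iff_integrableOn_Ioc_of_le ht).1 hk
  rw [integral_prod_symm _ (hw.integrable_prod hψ hk'), intervalIntegral.integral_of_le ht]
  simp only [pairing, integral_smul]

lemma IsL2Curve.integral_mul_integral (hw : IsL2Curve K w) (hψ : MemLp ψ 2 volume) {t : ℝ}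
    (ht : 0 ≤ t) {k : ℝ → ℝ} (hk : IntervalIntegrable k volume 0 t) :
    Integrable (fun x => ψ x * ∫ s in (0 : ℝ)..t, k s • w x s) ∧
    ∫ x, ψ x * (∫ s in (0 : ℝ)..t, k s • w x s) = ∫ s in (0 : ℝ)..t, k s • pairing ψ w s := by
  have hk' := (intervalIntegrable_iff_integrableOn_Ioc_of_le ht).1 hk
  have h := hw.integrable_prod hψ hk'
  have e : ∀ x, ψ x * (∫ s in (0 : ℝ)..t, k s • w x s) =
      ∫ s in Ioc 0 t, k s • (ψ x * w x s) := fun x => by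
    rw [intervalIntegral.integral_of_le ht, ← integral_const_mul]
    simp only [mul_smul_comm]
  simp only [e]
  refine ⟨h.integral_prod_left, ?_⟩
  rw [← hw.integral_prod_eq hψ ht hk, integral_prod _ h]

/-- Dominated convergence for the pairing with test functions. -/
lemma IsL2Curve.tendsto_integral_pairing (hw : IsL2Curve K w) {ψs : ℕ → RN N → ℂ}
    (hψs : ∀ n, MemLp (ψs n) 2 volume) (hψ : MemLp ψ 2 volume) {G : RN N → ℝ}
    (hG : MemLp G 2 volume) (hle : ∀ n x, ‖ψs n x‖ ≤ G x)
    (hlim : ∀ x, Tendsto (fun n => ψs n x) atTop (𝓝 (ψ x))) {t : ℝ} (ht : 0 ≤ t) {k : ℝ → ℝ}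
    (hk : IntervalIntegrable k volume 0 t) :
    Tendsto (fun n => ∫ s in (0 : ℝ)..t, k s • pairing (ψs n) w s) atTop
      (𝓝 (∫ s in (0 : ℝ)..t, k s • pairing ψ w s)) := by
  have hk' := (intervalIntegrable_iff_integrableOn_Ioc_of_le ht).1 hk
  simp only [← hw.integral_prod_eq (hψs _) ht hk]
  rw [← hw.integral_prod_eq hψ ht hk]
  have hG' : MemLp (fun x => (G x : ℂ)) 2 volume := hG.ofReal
  refine tendsto_integral_of_dominated_convergence
    (fun p => ‖k p.2 • (((G p.1 : ℝ) : ℂ) * w p.1 p.2)‖)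
    (fun n => (hw.integrable_prod (hψs n) hk').1) (hw.integrable_prod hG' hk').norm
    (fun n => ae_of_all _ fun p => ?_) (ae_of_all _ fun p => ?_)
  · simp only [norm_smul, norm_mul]
    gcongr
    rw [Complex.norm_real]
    exact (hle n _).trans (le_abs_self _)
  · exact ((hlim p.1).mul_const _).const_smul _

lemma IsL2Curve.sub {K' : ℝ} {w' : RN N → ℝ → ℂ} (hw : IsL2Curve K w) (hw' : IsL2Curve K' w') :
    IsL2Curve (max K 0 + max K' 0) (fun x s => w x s - w' x s) := by
  refine ⟨hw.measurable.sub hw'.measurable, fun s => ?_⟩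
  refine (eLpNorm_sub_le (hw.memLp s).1 (hw'.memLp s).1 (by norm_num)).trans ?_
  rw [ENNReal.ofReal_add (le_max_right _ _) (le_max_right _ _)]
  exact add_le_add ((hw.bound s).trans (ENNReal.ofReal_le_ofReal (le_max_left _ _)))
    ((hw'.bound s).trans (ENNReal.ofReal_le_ofReal (le_max_left _ _)))

lemma IsL2Curve.pairing_sub {K' : ℝ} {w' : RN N → ℝ → ℂ} (hw : IsL2Curve K w)
    (hw' : IsL2Curve K' w') (hψ : MemLp ψ 2 volume) (s : ℝ) :
    pairing ψ (fun x s => w x s - w' x s) s = pairing ψ w s - pairing ψ w' s := by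
  simp only [pairing, mul_sub]
  exact integral_sub (hw.integrable_mul hψ s) (hw'.integrable_mul hψ s)

/-- The Cauchy-Schwarz inequality in s, then Tonelli: the squared norm is at most t times the time
integral of the squared L_2 norms. -/
lemma IsL2Curve.memLp_integral (hw : IsL2Curve K w) {t : ℝ} (ht : 0 ≤ t) :
    MemLp (fun x => ∫ s in (0 : ℝ)..t, w x s) 2 volume := by
  simp only [intervalIntegral.integral_of_le ht]
  refine ⟨hw.measurable.integral_prod_right'.aestronglyMeasurable, ?_⟩
  rw [eLpNorm_lt_top_iff_lintegral_rpow_enorm_lt_top two_ne_zero ENNReal.ofNat_ne_top]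
  simp only [ENNReal.toReal_ofNat]
  set μ := volume.restrict (Ioc (0 : ℝ) t)
  have hμ : μ univ = ENNReal.ofReal t := by simp [μ]
  have hm : Measurable fun p : RN N × ℝ => ‖w p.1 p.2‖ₑ ^ (2 : ℝ) :=
    hw.measurable.enorm.pow_const _
  have h1 : ∀ x, ‖∫ s, w x s ∂μ‖ₑ ^ (2 : ℝ) ≤
      (∫⁻ s, ‖w x s‖ₑ ^ (2 : ℝ) ∂μ) * ENNReal.ofReal t := by
    intro x
    have hmx : AEMeasurable (fun s => ‖w x s‖ₑ) μ :=
      (hw.measurable.comp_measurable measurable_prodMk_left).enorm.aemeasurable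
    have h2 := ENNReal.lintegral_mul_le_Lp_mul_Lq μ Real.HolderConjugate.two_two hmx
      (aemeasurable_const (b := (1 : ENNReal)))
    simp only [Pi.mul_apply, mul_one, ENNReal.one_rpow, lintegral_one, hμ] at h2
    calc ‖∫ s, w x s ∂μ‖ₑ ^ (2 : ℝ) ≤ (∫⁻ s, ‖w x s‖ₑ ∂μ) ^ (2 : ℝ) := by
          gcongr
          exact enorm_integral_le_lintegral_enorm _
      _ ≤ ((∫⁻ s, ‖w x s‖ₑ ^ (2 : ℝ) ∂μ) ^ (1 / 2 : ℝ) * ENNReal.ofReal t ^ (1 / 2 : ℝ)) ^ (2 : ℝ) := by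
          gcongr
      _ = _ := by
          rw [ENNReal.mul_rpow_of_nonneg _ _ (by norm_num), ← ENNReal.rpow_mul, ← ENNReal.rpow_mul]
          norm_num
  calc ∫⁻ x, ‖∫ s, w x s ∂μ‖ₑ ^ (2 : ℝ)
      ≤ ∫⁻ x, (∫⁻ s, ‖w x s‖ₑ ^ (2 : ℝ) ∂μ) * ENNReal.ofReal t := lintegral_mono h1
    _ = (∫⁻ x, (∫⁻ s, ‖w x s‖ₑ ^ (2 : ℝ) ∂μ)) * ENNReal.ofReal t :=
        lintegral_mul_const _ hm.lintegral_prod_right'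
    _ = (∫⁻ s, (∫⁻ x, ‖w x s‖ₑ ^ (2 : ℝ)) ∂μ) * ENNReal.ofReal t := by
        rw [lintegral_lintegral_swap hm.aemeasurable]
    _ ≤ (∫⁻ _, ENNReal.ofReal K ^ (2 : ℝ) ∂μ) * ENNReal.ofReal t := by
        gcongr with s
        have h3 := hw.bound s
        rw [eLpNorm_eq_lintegral_rpow_enorm_toReal two_ne_zero ENNReal.ofNat_ne_top] at h3
        have h4 := ENNReal.rpow_le_rpow h3 (z := 2) (by norm_num)
        rw [← ENNReal.rpow_mul] at h4
        simpa using h4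
    _ < ⊤ := by
        rw [lintegral_const, hμ]
        finiteness

end

/-! ### Calculus of word derivatives -/

section
variable {N : ℕ} {f g : RN N → ℂ}

lemma coordDeriv_eq_fderiv {j : Fin N} {x : RN N} (hf : DifferentiableAt ℝ f x) :
    coordDeriv j f x = fderiv ℝ f x (EuclideanSpace.single j 1) :=
  hf.lineDeriv_eq_fderiv

lemma coordDeriv_eq_fderiv_fun {n : WithTop ℕ∞} (hf : ContDiff ℝ n f) (hn : 1 ≤ n) (j : Fin N) :
    coordDeriv j f = fun x => fderiv ℝ f x (EuclideanSpace.single j 1) :=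
  funext fun x => coordDeriv_eq_fderiv (hf.differentiable (by positivity) x)

lemma contDiff_coordDeriv {n m : WithTop ℕ∞} (hf : ContDiff ℝ n f) (hmn : m + 1 ≤ n) (j : Fin N) :
    ContDiff ℝ m (coordDeriv j f) := by
  rw [coordDeriv_eq_fderiv_fun hf (le_trans (by simp) hmn)]
  exact (hf.fderiv_right hmn).clm_apply contDiff_const

lemma contDiff_wordDeriv_nat {m : ℕ} (L : List (Fin N))
    (hf : ContDiff ℝ ((m + L.length : ℕ) : WithTop ℕ∞) f) :
    ContDiff ℝ (m : WithTop ℕ∞) (wordDeriv L f) := by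
  induction L generalizing m with
  | nil => exact hf
  | cons j L ih =>
    have : ContDiff ℝ ((m + 1 : ℕ) : WithTop ℕ∞) (wordDeriv L f) := ih (by
      convert hf using 2
      simp only [List.length_cons]
      omega)
    exact contDiff_coordDeriv this (by norm_cast) j

lemma contDiff_wordDeriv (hf : ContDiff ℝ (⊤ : ℕ∞) f) (L : List (Fin N)) :
    ContDiff ℝ (⊤ : ℕ∞) (wordDeriv L f) := by
  induction L with
  | nil => exact hf
  | cons j L ih => exact contDiff_coordDeriv ih (by exact_mod_cast le_top) j

lemma hasCompactSupport_coordDeriv {n : WithTop ℕ∞} (hf : ContDiff ℝ n f) (hn : 1 ≤ n)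
    (hc : HasCompactSupport f) (j : Fin N) : HasCompactSupport (coordDeriv j f) := by
  rw [coordDeriv_eq_fderiv_fun hf hn]
  exact hc.fderiv_apply (𝕜 := ℝ) _

lemma hasCompactSupport_wordDeriv (hf : ContDiff ℝ (⊤ : ℕ∞) f) (hc : HasCompactSupport f)
    (L : List (Fin N)) : HasCompactSupport (wordDeriv L f) := by
  induction L with
  | nil => exact hc
  | cons j L ih => exact hasCompactSupport_coordDeriv (contDiff_wordDeriv hf L) (by exact_mod_cast le_top) ih j

lemma wordDeriv_concat (L : List (Fin N)) (j : Fin N) (f : RN N → ℂ) :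
    wordDeriv (L ++ [j]) f = wordDeriv L (coordDeriv j f) :=
  wordDeriv_append L [j] f

lemma wordDeriv_congr_nhds (L : List (Fin N)) {x : RN N} (h : f =ᶠ[𝓝 x] g) :
    wordDeriv L f =ᶠ[𝓝 x] wordDeriv L g := by
  induction L with
  | nil => exact h
  | cons j L ih =>
    filter_upwards [ih.eventuallyEq_nhds] with y hy using hy.lineDeriv_eq

lemma wordDeriv_add (hf : ContDiff ℝ (⊤ : ℕ∞) f) (hg : ContDiff ℝ (⊤ : ℕ∞) g)
    (L : List (Fin N)) : wordDeriv L (fun x => f x + g x) = fun x => wordDeriv L f x + wordDeriv L g x := by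
  induction L with
  | nil => rfl
  | cons j L ih =>
    ext x
    have h1 := ((contDiff_wordDeriv hf L).differentiable (by simp) x)
    have h2 := ((contDiff_wordDeriv hg L).differentiable (by simp) x)
    change coordDeriv j (wordDeriv L _) x = coordDeriv j (wordDeriv L f) x + coordDeriv j (wordDeriv L g) x
    rw [ih, coordDeriv_eq_fderiv (h1.fun_add h2), coordDeriv_eq_fderiv h1, coordDeriv_eq_fderiv h2,
      fderiv_fun_add h1 h2]
    rfl

lemma coordDeriv_mul (hf : ContDiff ℝ (⊤ : ℕ∞) f) (hg : ContDiff ℝ (⊤ : ℕ∞) g)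
    (j : Fin N) : coordDeriv j (fun x => f x * g x) =
      fun x => coordDeriv j f x * g x + f x * coordDeriv j g x := by
  ext x
  have h1 := (hf.differentiable (by simp) x)
  have h2 := (hg.differentiable (by simp) x)
  rw [coordDeriv_eq_fderiv (h1.fun_mul h2), coordDeriv_eq_fderiv h1, coordDeriv_eq_fderiv h2,
    fderiv_fun_mul h1 h2]
  simp only [add_apply, smul_apply, smul_eq_mul]
  ring

lemma wordDeriv_comp_smul (hf : ContDiff ℝ (⊤ : ℕ∞) f) (c : ℝ) (L : List (Fin N)) :
    wordDeriv L (fun x => f (c • x)) = fun x => (c : ℂ) ^ L.length * wordDeriv L f (c • x) := by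
  induction L with
  | nil => simp [wordDeriv]
  | cons j L ih =>
    ext x
    have h1 : HasFDerivAt (wordDeriv L f) (fderiv ℝ (wordDeriv L f) (c • x)) (c • x) :=
      ((contDiff_wordDeriv hf L).differentiable (by simp) _).hasFDerivAt
    have h2 : HasFDerivAt (fun x : RN N => c • x) (c • ContinuousLinearMap.id ℝ (RN N)) x :=
      (hasFDerivAt_id x).const_smul c
    have h3 := (h1.comp x h2).const_mul ((c : ℂ) ^ L.length)
    change coordDeriv j (wordDeriv L _) x = _ * coordDeriv j (wordDeriv L f) (c • x)
    rw [ih, coordDeriv_eq_fderiv h1.differentiableAt, List.length_cons, pow_succ]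
    refine (coordDeriv_eq_fderiv h3.differentiableAt).trans ?_
    have h4 := h3.fderiv
    rw [h4]
    simp
    ring

/-- Integration by parts against a test function. -/
lemma integral_mul_wordDeriv {ψ : RN N → ℂ} (L : List (Fin N)) (hψ : ContDiff ℝ (⊤ : ℕ∞) ψ)
    (hψc : HasCompactSupport ψ) (hf : ContDiff ℝ (L.length : WithTop ℕ∞) f) :
    ∫ x, ψ x * wordDeriv L f x = (-1) ^ L.length * ∫ x, wordDeriv L.reverse ψ x * f x := by
  induction L generalizing ψ with
  | nil => simp [wordDeriv]
  | cons j L ih =>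
    have hF : ContDiff ℝ (1 : WithTop ℕ∞) (wordDeriv L f) := by
      have := contDiff_wordDeriv_nat (m := 1) (f := f) L (by
        rwa [add_comm, ← List.length_cons (a := j)])
      exact_mod_cast this
    have hψ' : ContDiff ℝ (⊤ : ℕ∞) (coordDeriv j ψ) := contDiff_coordDeriv hψ (by exact_mod_cast le_top) j
    have hψ'c := hasCompactSupport_coordDeriv hψ (by exact_mod_cast le_top) hψc j
    have h1 : ∫ x, ψ x * coordDeriv j (wordDeriv L f) x =
        -∫ x, coordDeriv j ψ x * wordDeriv L f x := by
      have hF' : Continuous (coordDeriv j (wordDeriv L f)) :=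
        (contDiff_coordDeriv hF (m := 0) (by simp) j).continuous
      have e1 := coordDeriv_eq_fderiv_fun hψ (by exact_mod_cast le_top) j
      have e2 := coordDeriv_eq_fderiv_fun hF le_rfl j
      simp only [e1] at hψ' hψ'c ⊢
      simp only [e2] at hF' ⊢
      refine integral_mul_fderiv_eq_neg_fderiv_mul_of_integrable ?_ ?_ ?_
        (fun x _ => hψ.differentiable (by simp) x) (fun x _ => hF.differentiable (by simp) x)
      · exact (hψ'.continuous.mul hF.continuous).integrable_of_hasCompactSupport hψ'c.mul_right
      · exact (hψ.continuous.mul hF').integrable_of_hasCompactSupport hψc.mul_right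
      · exact (hψ.continuous.mul hF.continuous).integrable_of_hasCompactSupport hψc.mul_right
    change ∫ x, ψ x * coordDeriv j (wordDeriv L f) x = _
    rw [h1, ih hψ' hψ'c (hf.of_le (by simp)), List.reverse_cons,
      wordDeriv_concat, List.length_cons, pow_succ]
    ring

/-! ### The transposed operator -/

/-- The transpose of `A(D)`. -/
def diffOpT (A : MvPolynomial (Fin N) ℝ) (ψ : RN N → ℂ) : RN N → ℂ :=
  fun x => ∑ α ∈ A.support, ((A.coeff α : ℝ) : ℂ) *
    (Complex.I ^ order α * wordDeriv (multiWord α).reverse ψ x)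

lemma contDiff_diffOpT (A : MvPolynomial (Fin N) ℝ) (hf : ContDiff ℝ (⊤ : ℕ∞) f) :
    ContDiff ℝ (⊤ : ℕ∞) (diffOpT A f) :=
  ContDiff.sum fun _ _ => contDiff_const.mul (contDiff_const.mul (contDiff_wordDeriv hf _))

lemma integral_mul_diffOp {m : ℕ} {A : MvPolynomial (Fin N) ℝ} (hA : A.IsHomogeneous m)
    {ψ : RN N → ℂ} (hψ : ContDiff ℝ (⊤ : ℕ∞) ψ) (hψc : HasCompactSupport ψ)
    (hf : ContDiff ℝ (m : WithTop ℕ∞) f) :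
    ∫ x, ψ x * diffOp A f x = ∫ x, diffOpT A ψ x * f x := by
  have hlen : ∀ α ∈ A.support, (multiWord α).length = m := fun α hα => by
    rw [length_multiWord, order_eq_of_mem_support hA hα]
  simp only [diffOp, diffOpT, multiD, partialDeriv_eq_wordDeriv, Finset.mul_sum, Finset.sum_mul]
  rw [integral_finsetSum, integral_finsetSum]
  · refine Finset.sum_congr rfl fun α hα => ?_
    have h := integral_mul_wordDeriv (multiWord α) hψ hψc (by rwa [hlen α hα])
    have e1 : ∀ x, ψ x * (((A.coeff α : ℝ) : ℂ) * ((-Complex.I) ^ order α *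
        wordDeriv (multiWord α) f x)) = (((A.coeff α : ℝ) : ℂ) * (-Complex.I) ^ order α) *
          (ψ x * wordDeriv (multiWord α) f x) := fun x => by ring
    have e2 : ∀ x, ((A.coeff α : ℝ) : ℂ) * (Complex.I ^ order α *
        wordDeriv (multiWord α).reverse ψ x) * f x = (((A.coeff α : ℝ) : ℂ) * Complex.I ^ order α) *
          (wordDeriv (multiWord α).reverse ψ x * f x) := fun x => by ring
    simp only [e1, e2]
    rw [integral_const_mul, integral_const_mul, h, length_multiWord, ← mul_assoc, mul_assoc _ _ ((-1) ^ _),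
      ← mul_pow, neg_mul_neg, mul_one]
  · intro α _
    exact (((continuous_const.mul (continuous_const.mul (contDiff_wordDeriv hψ _).continuous)).mul
      hf.continuous).integrable_of_hasCompactSupport
        (HasCompactSupport.mul_right (HasCompactSupport.mul_left (HasCompactSupport.mul_left
          (hasCompactSupport_wordDeriv hψ hψc _)))))
  · intro α hα
    have hc : Continuous (wordDeriv (multiWord α) f) :=
      (contDiff_wordDeriv_nat (m := 0) (multiWord α) (by rwa [hlen α hα, zero_add])).continuous
    exact (hψ.continuous.mul (continuous_const.mul
      (continuous_const.mul hc))).integrable_of_hasCompactSupport hψc.mul_right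

/-! ### Cutoffs -/

/-- The Leibniz rule by induction on the word. The innermost derivative is removed first, since it
turns f g into two products of the same kind. -/
lemma exists_dominating_wordDeriv_mul (L : List (Fin N)) {f g : ℕ → RN N → ℂ}
    (hf : ∀ n, ContDiff ℝ (⊤ : ℕ∞) (f n)) (hg : ∀ n, ContDiff ℝ (⊤ : ℕ∞) (g n))
    (hfb : ∀ M, ∃ C : ℝ, ∀ n x, ‖wordDeriv M (f n) x‖ ≤ C)
    (hgb : ∀ M, ∃ G : RN N → ℝ, MemLp G 2 volume ∧ ∀ n x, ‖wordDeriv M (g n) x‖ ≤ G x) :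
    ∃ G : RN N → ℝ, MemLp G 2 volume ∧ ∀ n x, ‖wordDeriv L (fun y => f n y * g n y) x‖ ≤ G x := by
  induction L using List.reverseRecOn generalizing f g with
  | nil =>
    obtain ⟨C, hC⟩ := hfb []
    obtain ⟨G, hG, hGb⟩ := hgb []
    refine ⟨fun x => C * G x, hG.const_mul C, fun n x => ?_⟩
    have h1 := hC n x
    have h2 := hGb n x
    change ‖f n x * g n x‖ ≤ _
    rw [norm_mul]
    exact mul_le_mul h1 h2 (norm_nonneg _) ((norm_nonneg _).trans h1)
  | append_singleton L j ih =>
    have hf' : ∀ n, ContDiff ℝ (⊤ : ℕ∞) (coordDeriv j (f n)) :=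
      fun n => contDiff_coordDeriv (hf n) (by exact_mod_cast le_top) j
    have hg' : ∀ n, ContDiff ℝ (⊤ : ℕ∞) (coordDeriv j (g n)) :=
      fun n => contDiff_coordDeriv (hg n) (by exact_mod_cast le_top) j
    obtain ⟨G₁, h1, h1'⟩ := ih hf' hg
      (fun M => by simpa only [wordDeriv_concat] using hfb (M ++ [j])) hgb
    obtain ⟨G₂, h2, h2'⟩ := ih hf hg' hfb
      (fun M => by simpa only [wordDeriv_concat] using hgb (M ++ [j]))
    refine ⟨fun x => G₁ x + G₂ x, h1.add h2, fun n x => ?_⟩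
    rw [wordDeriv_concat, coordDeriv_mul (hf n) (hg n),
      wordDeriv_add ((hf' n).mul (hg n)) ((hf n).mul (hg' n))]
    exact (norm_add_le _ _).trans (add_le_add (h1' n x) (h2' n x))

/-- A smooth function with square integrable derivatives is the limit of test functions, with
convergence and domination of all the derivatives. -/
lemma exists_cutoff {ψ : RN N → ℂ} (hψ : ContDiff ℝ (⊤ : ℕ∞) ψ)
    (hψ2 : ∀ M, MemLp (wordDeriv M ψ) 2 volume) :
    ∃ ψs : ℕ → RN N → ℂ, (∀ n, ContDiff ℝ (⊤ : ℕ∞) (ψs n)) ∧ (∀ n, HasCompactSupport (ψs n)) ∧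
      (∀ M, ∃ G : RN N → ℝ, MemLp G 2 volume ∧ ∀ n x, ‖wordDeriv M (ψs n) x‖ ≤ G x) ∧
      ∀ M x, Tendsto (fun n => wordDeriv M (ψs n) x) atTop (𝓝 (wordDeriv M ψ x)) := by
  let b : ContDiffBump (0 : RN N) := ⟨1, 2, one_pos, one_lt_two⟩
  set θ : RN N → ℂ := fun x => ((b x : ℝ) : ℂ) with hθ
  have hθs : ContDiff ℝ (⊤ : ℕ∞) θ := Complex.ofRealCLM.contDiff.comp b.contDiff
  have hθc : HasCompactSupport θ := b.hasCompactSupport.comp_left Complex.ofReal_zero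
  -- Dilated bumps equal to 1 on the ball of radius n + 1. As c n ≤ 1, the chain rule does not
  -- enlarge their derivatives, and at each fixed x all derivatives of the product are eventually
  -- those of ψ.
  set c : ℕ → ℝ := fun n => ((n : ℝ) + 1)⁻¹ with hc
  have hc0 : ∀ n, 0 < c n := fun n => by positivity
  have hc1 : ∀ n, c n ≤ 1 := fun n => inv_le_one_of_one_le₀ (by simp)
  have hθn : ∀ n, ContDiff ℝ (⊤ : ℕ∞) fun x => θ (c n • x) := fun n => by fun_prop
  refine ⟨fun n x => θ (c n • x) * ψ x, fun n => (hθn n).mul hψ, fun n => ?_, fun M => ?_,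
    fun M x => ?_⟩
  · exact HasCompactSupport.mul_right
      (hθc.comp_homeomorph (Homeomorph.smulOfNeZero (c n) (hc0 n).ne'))
  · refine exists_dominating_wordDeriv_mul M hθn (fun _ => hψ) (fun M => ?_)
      (fun M => ⟨fun x => ‖wordDeriv M ψ x‖, (hψ2 M).norm, fun _ _ => le_rfl⟩)
    obtain ⟨C, hC⟩ := (contDiff_wordDeriv hθs M).continuous.bounded_above_of_compact_support
      (hasCompactSupport_wordDeriv hθs hθc M)
    refine ⟨C, fun n x => ?_⟩
    rw [wordDeriv_comp_smul hθs, norm_mul, norm_pow, Complex.norm_real,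
      Real.norm_of_nonneg (hc0 n).le]
    exact (mul_le_of_le_one_left (norm_nonneg _) (pow_le_one₀ (hc0 n).le (hc1 n))).trans (hC _)
  · refine tendsto_const_nhds.congr' ?_
    have h1 : Tendsto (fun n : ℕ => (n : ℝ) + 1) atTop atTop :=
      tendsto_atTop_add_const_right _ _ tendsto_natCast_atTop_atTop
    filter_upwards [h1.eventually_gt_atTop ‖x‖] with n hn
    refine (wordDeriv_congr_nhds M ?_).eq_of_nhds
    have h2 : ∀ᶠ y in 𝓝 x, ‖y‖ < (n : ℝ) + 1 := continuous_norm.continuousAt.eventually_lt_const hn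
    filter_upwards [h2] with y hy
    have : b (c n • y) = 1 := b.one_of_mem_closedBall (by
      rw [mem_closedBall_zero_iff, norm_smul, Real.norm_of_nonneg (hc0 n).le]
      change c n * ‖y‖ ≤ 1
      rw [hc]
      have : (0 : ℝ) < n + 1 := by positivity
      field_simp
      exact hy.le)
    simp [hθ, this]

end

/-! ### The weak form of the equation -/

section
variable {N l : ℕ} {A : MvPolynomial (Fin N) ℝ} {T ρ : ℝ} {φ : RN N → ℂ} {u : RN N → ℝ → ℂ}

/-- The curve `u`, frozen outside `[0, T]`. -/
def frozen (hT : 0 < T) (u : RN N → ℝ → ℂ) (x : RN N) (s : ℝ) : ℂ :=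
  u x (projIcc 0 T hT.le s)

lemma frozen_of_mem (hT : 0 < T) (u : RN N → ℝ → ℂ) (x : RN N) {s : ℝ} (hs : s ∈ Icc 0 T) :
    frozen hT u x s = u x s := by
  rw [frozen, projIcc_of_mem _ hs]

lemma continuous_frozen (hT : 0 < T) (hu : IsClassicalSolution A l T ρ φ u) (x : RN N) :
    Continuous (frozen hT u x) :=
  (hu.caputo_exists x).continuousOn.comp_continuous
    (continuous_subtype_val.comp continuous_projIcc) fun s => (projIcc 0 T hT.le s).2

/-- Joint measurability of a solution is not assumed. It follows from continuity in s for fixed x,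
which freezing extends to the whole line, and measurability in x for fixed s. -/
lemma isL2Curve_frozen (hT : 0 < T) (hφ : Continuous φ) (hφ2 : MemLp φ 2 volume)
    (hu : IsClassicalSolution A l T ρ φ u) (hr : IsRegular l T u) :
    ∃ K, IsL2Curve K (frozen hT u) := by
  obtain ⟨C, hC⟩ := hr.bounded
  have hslice : ∀ s ∈ Icc 0 T, Continuous (fun x => u x s) := fun s hs => by
    rcases hs.1.eq_or_lt with rfl | h
    · simpa only [hu.initial] using hφ
    · exact (hu.contDiff s ⟨h, hs.2⟩).continuous
  refine ⟨max C (eLpNorm φ 2 volume).toReal, ?_, fun s => ?_⟩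
  · have := stronglyMeasurable_uncurry_of_continuous_of_stronglyMeasurable
      (u := fun s x => frozen hT u x s) (continuous_frozen hT hu)
      fun s => (hslice _ (projIcc 0 T hT.le s).2).stronglyMeasurable
    exact this.comp_measurable measurable_swap
  · have h := (projIcc 0 T hT.le s).2
    unfold frozen
    rcases h.1.eq_or_lt with h0 | h0
    · rw [← h0]
      simp only [hu.initial]
      exact (ENNReal.ofReal_toReal hφ2.eLpNorm_ne_top).ge.trans
        (ENNReal.ofReal_le_ofReal (le_max_right _ _))
    · exact (hC _ ⟨h0, h.2⟩).trans (ENNReal.ofReal_le_ofReal (le_max_left _ _))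

lemma isL2Curve_const (hφ : Continuous φ) (hφ2 : MemLp φ 2 volume) :
    ∃ K, IsL2Curve K (fun x (_ : ℝ) => φ x) :=
  ⟨(eLpNorm φ 2 volume).toReal, (hφ.comp continuous_fst).stronglyMeasurable,
    fun _ => (ENNReal.ofReal_toReal hφ2.eLpNorm_ne_top).ge⟩

lemma memLp_of_test {ψ : RN N → ℂ} (hψ : Continuous ψ) (hψc : HasCompactSupport ψ) :
    MemLp ψ 2 volume :=
  hψ.memLp_of_hasCompactSupport hψc

/-- For a > 0 the integrand is continuous on the compact set supp ψ × [a, b] and vanishes for x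
outside supp ψ. -/
lemma integrable_mul_diffOp_prod (hu : IsClassicalSolution A l T ρ φ u) {ψ : RN N → ℂ}
    (hψ : Continuous ψ) (hψc : HasCompactSupport ψ) {a b : ℝ} (ha : 0 < a) (hb : b ≤ T) :
    Integrable (fun p : RN N × ℝ => ψ p.1 * diffOp A (fun x => u x p.2) p.1)
      (volume.prod (volume.restrict (Ioc a b))) := by
  have h1 : ContinuousOn (fun p : RN N × ℝ => ψ p.1 * diffOp A (fun x => u x p.2) p.1)
      (tsupport ψ ×ˢ Icc a b) :=
    (hψ.comp continuous_fst).continuousOn.mul (hu.continuousOn_diffOp.mono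
      (prod_mono (subset_univ _) fun s hs => ⟨ha.trans_le hs.1, hs.2.trans hb⟩))
  have h2 : IntegrableOn (fun p : RN N × ℝ => ψ p.1 * diffOp A (fun x => u x p.2) p.1)
      (tsupport ψ ×ˢ Icc a b) :=
    h1.integrableOn_compact (hψc.isCompact.prod isCompact_Icc)
  have h3 : IntegrableOn (fun p : RN N × ℝ => ψ p.1 * diffOp A (fun x => u x p.2) p.1)
      (univ ×ˢ Ioc a b) := by
    refine h2.of_forall_sdiff_eq_zero (MeasurableSet.univ.prod measurableSet_Ioc) ?_
    rintro ⟨x, s⟩ ⟨⟨_, hs⟩, hx⟩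
    have : x ∉ tsupport ψ := fun h => hx ⟨h, Ioc_subset_Icc_self hs⟩
    simp [image_eq_zero_of_notMem_tsupport this]
  rwa [IntegrableOn, Measure.volume_eq_prod, ← Measure.prod_restrict, Measure.restrict_univ] at h3

/-- The equation tested against `ψ` and integrated over `[a, b]`. -/
lemma integral_mul_integral_caputoDeriv (hA : IsEllipticSymbol A l) (hT : 0 < T)
    (hu : IsClassicalSolution A l T ρ φ u) {ψ : RN N → ℂ} (hψ : ContDiff ℝ (⊤ : ℕ∞) ψ)
    (hψc : HasCompactSupport ψ) {a b : ℝ} (ha : 0 < a) (hab : a ≤ b) (hb : b ≤ T) :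
    ∫ x, ψ x * (∫ s in a..b, caputoDeriv ρ (u x) s) =
      -∫ s in a..b, pairing (diffOpT A ψ) (frozen hT u) s := by
  have hint := integrable_mul_diffOp_prod hu hψ.continuous hψc ha hb
  have e : ∀ x, ψ x * (∫ s in a..b, caputoDeriv ρ (u x) s) =
      -∫ s in Ioc a b, ψ x * diffOp A (fun y => u y s) x := fun x => by
    rw [intervalIntegral.integral_of_le hab, integral_const_mul, ← mul_neg, ← integral_neg]
    congr 1
    refine setIntegral_congr_fun measurableSet_Ioc fun s hs => ?_
    exact eq_neg_of_add_eq_zero_left (hu.equation x s ⟨ha.trans hs.1, hs.2.trans hb⟩)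
  simp only [e]
  rw [integral_neg, integral_integral_swap hint, intervalIntegral.integral_of_le hab]
  congr 1
  refine setIntegral_congr_fun measurableSet_Ioc fun s hs => ?_
  have hs' : s ∈ Ioc 0 T := ⟨ha.trans hs.1, hs.2.trans hb⟩
  rw [integral_mul_diffOp hA.homogeneous hψ hψc (hu.contDiff s hs')]
  simp only [pairing, frozen_of_mem hT u _ (Ioc_subset_Icc_self hs')]

lemma hasCompactSupport_diffOpT {ψ : RN N → ℂ}
    (hψc : HasCompactSupport ψ) : HasCompactSupport (diffOpT A ψ) := by
  refine HasCompactSupport.intro' (K := tsupport ψ) hψc.isCompact (isClosed_tsupport _)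
    fun x hx => Finset.sum_eq_zero fun α _ => ?_
  have h1 : ψ =ᶠ[𝓝 x] 0 := notMem_tsupport_iff_eventuallyEq.1 hx
  have h2 := (wordDeriv_congr_nhds (multiWord α).reverse h1).eq_of_nhds
  have h3 : ∀ L : List (Fin N), wordDeriv L (0 : RN N → ℂ) = 0 := fun L => by
    induction L with
    | nil => rfl
    | cons j L ih =>
      change coordDeriv j (wordDeriv L 0) = 0
      rw [ih]
      ext x
      simp [coordDeriv, lineDeriv]
  rw [h2, h3]
  simp

/-- For fixed x, I^{1-ρ}(u - φ) is the time integral of D^ρ u. The equation can be tested only away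
from t = 0, where A(D)u need not be controlled, so the identity is first proved for the increment
over [a, t]. Once A(D) is moved to ψ, only L_2 bounds on u remain, and a → 0. -/
lemma weak_identity (hA : IsEllipticSymbol A l) (hρ : 0 < ρ) (hρ' : ρ < 1) (hT : 0 < T)
    (hφ : Continuous φ) (hφ2 : MemLp φ 2 volume) (hu : IsClassicalSolution A l T ρ φ u)
    (hr : IsRegular l T u) {ψ : RN N → ℂ} (hψ : ContDiff ℝ (⊤ : ℕ∞) ψ)
    (hψc : HasCompactSupport ψ) {t : ℝ} (ht : t ∈ Ioc 0 T) :
    rlIntegral (1 - ρ) (pairing ψ fun x s => frozen hT u x s - φ x) t =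
      -(Real.Gamma (1 - ρ) • rlIntegral 1 (pairing (diffOpT A ψ) (frozen hT u)) t) := by
  obtain ⟨K, hK⟩ := isL2Curve_frozen hT hφ hφ2 hu hr
  obtain ⟨K₀, hK₀⟩ := isL2Curve_const hφ hφ2
  have hw := hK.sub hK₀
  have hψ2 := memLp_of_test hψ.continuous hψc
  have hψT := contDiff_diffOpT A hψ
  have hψTc := hasCompactSupport_diffOpT (A := A) hψc
  have hψT2 := memLp_of_test hψT.continuous hψTc
  set y := pairing (diffOpT A ψ) (frozen hT u)
  have hyint : ∀ b, IntervalIntegrable y volume 0 b := fun b => by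
    have := intervalIntegrable_sub_rpow_smul (t := b) one_pos
      (hK.aestronglyMeasurable_pairing hψT2 _) (hK.norm_pairing_le hψT2)
    simpa using this
  have hJ : ∀ x, ∀ b ∈ Ioc 0 T,
      (∫ s in (0 : ℝ)..b, ((b - s) ^ ((1 - ρ) - 1)) • (frozen hT u x s - φ x)) =
        Real.Gamma (1 - ρ) • ∫ s in (0 : ℝ)..b, caputoDeriv ρ (u x) s := fun x b hb => by
    rw [← ((hu.caputo_exists x).rlIntegral_sub hρ hρ' hb).2, rlIntegral]
    refine intervalIntegral.integral_congr fun s hs => ?_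
    rw [uIcc_of_le hb.1.le] at hs
    rw [frozen_of_mem hT u x ⟨hs.1, hs.2.trans hb.2⟩, hu.initial]
  have hpair := fun (b : ℝ) (hb : b ∈ Ioc 0 T) => hw.integral_mul_integral hψ2 hb.1.le
    (intervalIntegrable_sub_rpow (t := b) (α := 1 - ρ) (by linarith))
  -- The difference of the two sides of the identity does not depend on the time; below it is shown
  -- to be O(a^{1-ρ}) + O(a), hence zero.
  have key : ∀ a ∈ Ioc 0 t, rlIntegral (1 - ρ) (pairing ψ fun x s => frozen hT u x s - φ x) t +
      Real.Gamma (1 - ρ) • rlIntegral 1 y t =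
      rlIntegral (1 - ρ) (pairing ψ fun x s => frozen hT u x s - φ x) a +
      Real.Gamma (1 - ρ) • rlIntegral 1 y a := by
    intro a ha
    have haT : a ∈ Ioc 0 T := ⟨ha.1, ha.2.trans ht.2⟩
    have h1 : rlIntegral (1 - ρ) (pairing ψ fun x s => frozen hT u x s - φ x) t -
        rlIntegral (1 - ρ) (pairing ψ fun x s => frozen hT u x s - φ x) a =
        -(Real.Gamma (1 - ρ) • ∫ s in a..t, y s) := by
      rw [rlIntegral, rlIntegral, ← (hpair t ht).2, ← (hpair a haT).2,
        ← integral_sub (hpair t ht).1 (hpair a haT).1, ← smul_neg,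
        ← integral_mul_integral_caputoDeriv hA hT hu hψ hψc ha.1 ha.2 ht.2, ← integral_smul]
      congr 1
      ext x
      rw [hJ x t ht, hJ x a haT, ← mul_sub, ← smul_sub,
        intervalIntegral.integral_interval_sub_left
          ((hu.caputo_exists x).rlIntegral_sub hρ hρ' ht).1
          ((hu.caputo_exists x).rlIntegral_sub hρ hρ' haT).1, mul_smul_comm]
    have h2 : rlIntegral 1 y t - rlIntegral 1 y a = ∫ s in a..t, y s := by
      rw [rlIntegral_one, rlIntegral_one,
        intervalIntegral.integral_interval_sub_left (hyint t) (hyint a)]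
    rw [← h2, smul_sub] at h1
    linear_combination h1
  set C₁ := (eLpNorm ψ 2 volume).toReal * max (max K 0 + max K₀ 0) 0
  set C₂ := (eLpNorm (diffOpT A ψ) 2 volume).toReal * max K 0
  have hle : ∀ a ∈ Ioc 0 t,
      ‖rlIntegral (1 - ρ) (pairing ψ fun x s => frozen hT u x s - φ x) t +
        Real.Gamma (1 - ρ) • rlIntegral 1 y t‖ ≤
      a ^ (1 - ρ) / (1 - ρ) * C₁ + |Real.Gamma (1 - ρ)| * (a ^ (1 : ℝ) / 1 * C₂) := by
    intro a ha
    rw [key a ha]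
    refine (norm_add_le _ _).trans (add_le_add ?_ ?_)
    · exact norm_rlIntegral_le (by linarith) ha.1.le (hw.norm_pairing_le hψ2)
    · rw [norm_smul, Real.norm_eq_abs]
      exact mul_le_mul_of_nonneg_left
        (norm_rlIntegral_le one_pos ha.1.le (hK.norm_pairing_le hψT2)) (abs_nonneg _)
  have hlim : Tendsto (fun a : ℝ => a ^ (1 - ρ) / (1 - ρ) * C₁ +
      |Real.Gamma (1 - ρ)| * (a ^ (1 : ℝ) / 1 * C₂)) (𝓝[>] 0) (𝓝 0) := by
    have hc : Continuous fun a : ℝ => a ^ (1 - ρ) / (1 - ρ) * C₁ +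
        |Real.Gamma (1 - ρ)| * (a ^ (1 : ℝ) / 1 * C₂) := by
      have := Real.continuous_rpow_const (q := 1 - ρ) (by linarith)
      have := Real.continuous_rpow_const (q := 1) (by norm_num)
      fun_prop
    have := (hc.tendsto 0).mono_left (nhdsWithin_le_nhds (s := Ioi 0))
    simpa [Real.zero_rpow (by linarith : (1 : ℝ) - ρ ≠ 0)] using this
  have h0 := ge_of_tendsto hlim (mem_of_superset (Ioc_mem_nhdsGT ht.1) hle)
  exact eq_neg_of_add_eq_zero_left (norm_le_zero_iff.1 h0)

end

/-! ### Uniqueness for the forward problem -/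

section
variable {N l : ℕ} {A : MvPolynomial (Fin N) ℝ} {T ρ : ℝ} {φ : RN N → ℂ}

/-- The difference of two curves, frozen outside `[0, T]`. -/
def frozenSub (hT : 0 < T) (u v : RN N → ℝ → ℂ) (x : RN N) (s : ℝ) : ℂ :=
  frozen hT u x s - frozen hT v x s

lemma rlIntegral_sub_fun {α t : ℝ} {f g : ℝ → ℂ}
    (hf : IntervalIntegrable (fun s => ((t - s) ^ (α - 1)) • f s) volume 0 t)
    (hg : IntervalIntegrable (fun s => ((t - s) ^ (α - 1)) • g s) volume 0 t) :
    rlIntegral α (fun s => f s - g s) t = rlIntegral α f t - rlIntegral α g t := by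
  simp only [rlIntegral, smul_sub]
  exact intervalIntegral.integral_sub hf hg

lemma IsL2Curve.intervalIntegrable_pairing {K : ℝ} {w : RN N → ℝ → ℂ} (hw : IsL2Curve K w)
    {ψ : RN N → ℂ} (hψ : MemLp ψ 2 volume) {α : ℝ} (hα : 0 < α) (t : ℝ) :
    IntervalIntegrable (fun s => ((t - s) ^ (α - 1)) • pairing ψ w s) volume 0 t :=
  intervalIntegrable_sub_rpow_smul hα (hw.aestronglyMeasurable_pairing hψ _)
    (hw.norm_pairing_le hψ)

lemma isL2Curve_frozenSub (hT : 0 < T) {u v : RN N → ℝ → ℂ} (hφ : Continuous φ)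
    (hφ2 : MemLp φ 2 volume) (hu : IsClassicalSolution A l T ρ φ u) (hur : IsRegular l T u)
    (hv : IsClassicalSolution A l T ρ φ v) (hvr : IsRegular l T v) :
    ∃ K, IsL2Curve K (frozenSub hT u v) := by
  obtain ⟨K, hK⟩ := isL2Curve_frozen hT hφ hφ2 hu hur
  obtain ⟨K', hK'⟩ := isL2Curve_frozen hT hφ hφ2 hv hvr
  exact ⟨_, hK.sub hK'⟩

lemma weak_identity_frozenSub (hA : IsEllipticSymbol A l) (hρ : 0 < ρ) (hρ' : ρ < 1) (hT : 0 < T)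
    (hφ : Continuous φ) (hφ2 : MemLp φ 2 volume) {u v : RN N → ℝ → ℂ}
    (hu : IsClassicalSolution A l T ρ φ u) (hur : IsRegular l T u)
    (hv : IsClassicalSolution A l T ρ φ v) (hvr : IsRegular l T v) {ψ : RN N → ℂ}
    (hψ : ContDiff ℝ (⊤ : ℕ∞) ψ) (hψc : HasCompactSupport ψ) {t : ℝ} (ht : t ∈ Ioc 0 T) :
    rlIntegral (1 - ρ) (pairing ψ (frozenSub hT u v)) t =
      -(Real.Gamma (1 - ρ) • rlIntegral 1 (pairing (diffOpT A ψ) (frozenSub hT u v)) t) := by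
  obtain ⟨K, hK⟩ := isL2Curve_frozen hT hφ hφ2 hu hur
  obtain ⟨K', hK'⟩ := isL2Curve_frozen hT hφ hφ2 hv hvr
  obtain ⟨K₀, hK₀⟩ := isL2Curve_const hφ hφ2
  have hψ2 := memLp_of_test hψ.continuous hψc
  have hψT2 := memLp_of_test (contDiff_diffOpT A hψ).continuous
    (hasCompactSupport_diffOpT (A := A) hψc)
  have e1 : pairing ψ (frozenSub hT u v) = fun s =>
      pairing ψ (fun x s => frozen hT u x s - φ x) s -
        pairing ψ (fun x s => frozen hT v x s - φ x) s := by
    ext s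
    rw [← (hK.sub hK₀).pairing_sub (hK'.sub hK₀) hψ2]
    simp only [sub_sub_sub_cancel_right]
    rfl
  have e2 : pairing (diffOpT A ψ) (frozenSub hT u v) = fun s =>
      pairing (diffOpT A ψ) (frozen hT u) s - pairing (diffOpT A ψ) (frozen hT v) s := by
    ext s
    exact hK.pairing_sub hK' hψT2 s
  rw [e1, e2, rlIntegral_sub_fun
      ((hK.sub hK₀).intervalIntegrable_pairing hψ2 (by linarith) t)
      ((hK'.sub hK₀).intervalIntegrable_pairing hψ2 (by linarith) t),
    rlIntegral_sub_fun (hK.intervalIntegrable_pairing hψT2 one_pos t)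
      (hK'.intervalIntegrable_pairing hψT2 one_pos t),
    weak_identity hA hρ hρ' hT hφ hφ2 hu hur hψ hψc ht,
    weak_identity hA hρ hρ' hT hφ hφ2 hv hvr hψ hψc ht, smul_sub]
  ring

/-- An identity between pairings passes from test functions to smooth functions with square
integrable derivatives. -/
lemma rlIntegral_pairing_eq_of_test {K : ℝ} {w : RN N → ℝ → ℂ} (hw : IsL2Curve K w) {α β c t : ℝ}
    (hα : 0 < α) (hβ : 0 < β) (ht : 0 ≤ t)
    (h : ∀ ψ : RN N → ℂ, ContDiff ℝ (⊤ : ℕ∞) ψ → HasCompactSupport ψ →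
      rlIntegral α (pairing ψ w) t = c • rlIntegral β (pairing (diffOpT A ψ) w) t)
    {ψ : RN N → ℂ} (hψ : ContDiff ℝ (⊤ : ℕ∞) ψ) (hψ2 : ∀ M, MemLp (wordDeriv M ψ) 2 volume) :
    rlIntegral α (pairing ψ w) t = c • rlIntegral β (pairing (diffOpT A ψ) w) t := by
  obtain ⟨ψs, hs, hsc, hdom, hlim⟩ := exists_cutoff hψ hψ2
  choose G hG hGle using hdom
  have hψs2 := fun n => memLp_of_test (hs n).continuous (hsc n)
  have hψsT2 := fun n => memLp_of_test (contDiff_diffOpT A (hs n)).continuous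
    (hasCompactSupport_diffOpT (A := A) (hsc n))
  have hT2 : MemLp (diffOpT A ψ) 2 volume := memLp_finsetSum _ fun α _ =>
    MemLp.const_mul (MemLp.const_mul (hψ2 _) _) _
  have l1 := hw.tendsto_integral_pairing hψs2 (hψ2 []) (hG []) (hGle []) (hlim []) ht
    (intervalIntegrable_sub_rpow (t := t) hα)
  have l2 := hw.tendsto_integral_pairing hψsT2 hT2
    (G := fun x => ∑ α ∈ A.support, |A.coeff α| * G (multiWord α).reverse x)
    (memLp_finsetSum _ fun α _ => (hG _).const_mul _)
    (fun n x => (norm_sum_le _ _).trans (Finset.sum_le_sum fun α _ => by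
      rw [norm_mul, norm_mul, norm_pow, Complex.norm_I, one_pow, one_mul, Complex.norm_real,
        Real.norm_eq_abs]
      exact mul_le_mul_of_nonneg_left (hGle _ n x) (abs_nonneg _)))
    (fun x => tendsto_finsetSum _ fun α _ => ((hlim _ x).const_mul _).const_mul _) ht
    (intervalIntegrable_sub_rpow (t := t) hβ)
  refine tendsto_nhds_unique (l1.congr fun n => ?_) (l2.const_smul c)
  exact h (ψs n) (hs n) (hsc n)

lemma integrable_norm_pow_mul_of_hasCompactSupport {χ : RN N → ℂ} (hχ : Continuous χ)
    (hχc : HasCompactSupport χ) (n : ℕ) : Integrable fun v : RN N => ‖v‖ ^ n * ‖χ v‖ :=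
  ((by fun_prop : Continuous fun v : RN N => ‖v‖ ^ n * ‖χ v‖)).integrable_of_hasCompactSupport
    hχc.norm.mul_left

/-- The order 2l is even, so the sign from transposition is trivial, and reversing a word does not
change its symbol: on these functions the transpose acts as A(D). -/
lemma diffOpT_fourierInv (hA : IsEllipticSymbol A l) {χ : RN N → ℂ} (hχ : Continuous χ)
    (hχc : HasCompactSupport χ) :
    diffOpT A (𝓕⁻ χ) = 𝓕⁻ (fun v => ((symbol A ((2 * Real.pi) • v) : ℝ) : ℂ) * χ v) := by
  have hi := integrable_norm_pow_mul_of_hasCompactSupport hχ hχc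
  rw [← diffOp_fourierInv hA.homogeneous hχ.aestronglyMeasurable fun n _ => hi n]
  ext x
  refine Finset.sum_congr rfl fun α hα => ?_
  rw [multiD, partialDeriv_eq_wordDeriv, wordDeriv_fourierInv _ hχ.aestronglyMeasurable
    fun n _ => hi n, wordDeriv_fourierInv _ hχ.aestronglyMeasurable fun n _ => hi n,
    order_eq_of_mem_support hA.homogeneous hα, neg_pow, (even_two_mul l).neg_one_pow, one_mul]
  simp only [List.map_reverse, (List.reverse_perm _).prod_eq]

lemma memLp_wordDeriv_fourierInv {χ : RN N → ℂ} (hχ : Continuous χ) (hχc : HasCompactSupport χ)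
    (M : List (Fin N)) : MemLp (wordDeriv M (𝓕⁻ χ)) 2 volume := by
  rw [wordDeriv_fourierInv _ hχ.aestronglyMeasurable
    fun n _ => integrable_norm_pow_mul_of_hasCompactSupport hχ hχc n]
  have hc := (continuous_prod_map M).mul hχ
  have hcs : HasCompactSupport ((fun v : RN N =>
      (M.map fun j => (2 * Real.pi * Complex.I * v j : ℂ)).prod) * χ) := hχc.mul_left
  exact memLp_fourierInv (hc.integrable_of_hasCompactSupport hcs) (memLp_of_test hc hcs)

lemma contDiff_fourierInv_top {χ : RN N → ℂ} (hχ : Continuous χ) (hχc : HasCompactSupport χ) :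
    ContDiff ℝ (⊤ : ℕ∞) (𝓕⁻ χ) :=
  contDiff_infty.2 fun _ => contDiff_fourierInv fun n _ =>
    integrable_norm_pow_mul_of_hasCompactSupport hχ hχc n

/-- The Riemann-Liouville integral of order `α`. -/
def fracIntegral (α : ℝ) (f : ℝ → ℂ) (t : ℝ) : ℂ := (Real.Gamma α)⁻¹ • rlIntegral α f t

lemma fracIntegral_fracIntegral {α β t : ℝ} (hα : 0 < α) (hβ : 0 < β) (ht : 0 < t) {f : ℝ → ℂ}
    (hf : IntervalIntegrable (fun r => ((t - r) ^ (α + β - 1)) • f r) volume 0 t)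
    (hm : AEStronglyMeasurable f (volume.restrict (Ioc 0 t))) :
    fracIntegral α (fracIntegral β f) t = fracIntegral (α + β) f t := by
  have h := (rlIntegral_rlIntegral hα hβ ht hm hf).2
  have e : rlIntegral α (fracIntegral β f) t =
      (Real.Gamma β)⁻¹ • rlIntegral α (rlIntegral β f) t := by
    rw [rlIntegral, rlIntegral, ← intervalIntegral.integral_smul]
    simp only [fracIntegral, smul_comm (Real.Gamma β)⁻¹]
  have h1 := (Real.Gamma_pos_of_pos hα).ne'
  have h2 := (Real.Gamma_pos_of_pos hβ).ne'
  have h3 := (Real.Gamma_pos_of_pos (add_pos hα hβ)).ne'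
  rw [fracIntegral, e, h, fracIntegral, smul_smul, smul_smul, rlBeta]
  congr 1
  field_simp

lemma fracIntegral_congr {α t : ℝ} (ht : 0 ≤ t) {f g : ℝ → ℂ} (h : ∀ s ∈ Ioc 0 t, f s = g s) :
    fracIntegral α f t = fracIntegral α g t := by
  rw [fracIntegral, fracIntegral, rlIntegral, rlIntegral, intervalIntegral.integral_of_le ht,
    intervalIntegral.integral_of_le ht]
  congr 1
  exact setIntegral_congr_fun measurableSet_Ioc fun s hs => congrArg _ (h s hs)

lemma fracIntegral_const_mul (α c t : ℝ) (f : ℝ → ℂ) :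
    fracIntegral α (fun s => c * f s) t = c * fracIntegral α f t := by
  rw [fracIntegral, fracIntegral, rlIntegral, rlIntegral, mul_smul_comm,
    ← intervalIntegral.integral_const_mul]
  simp only [mul_smul_comm]

lemma norm_fracIntegral_le {α t : ℝ} (hα : 0 < α) (ht : 0 ≤ t) {f : ℝ → ℂ} {C : ℝ}
    (hC : ∀ s, ‖f s‖ ≤ C) : ‖fracIntegral α f t‖ ≤ (Real.Gamma (α + 1))⁻¹ * t ^ α * C := by
  have hΓ := Real.Gamma_pos_of_pos hα
  rw [fracIntegral, norm_smul, Real.norm_of_nonneg (inv_nonneg.2 hΓ.le), Real.Gamma_add_one hα.ne']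
  calc _ ≤ (Real.Gamma α)⁻¹ * (t ^ α / α * C) := by
        gcongr
        exact norm_rlIntegral_le hα ht hC
    _ = _ := by field_simp

/-- A curve which satisfies the homogeneous equation in the weak form, with zero initial value,
has vanishing time integrals. -/
lemma integral_pairing_fourierInv_eq_zero (hA : IsEllipticSymbol A l) (hρ : 0 < ρ) (hρ' : ρ < 1)
    {K : ℝ} {w : RN N → ℝ → ℂ} (hw : IsL2Curve K w)
    (h : ∀ ψ : RN N → ℂ, ContDiff ℝ (⊤ : ℕ∞) ψ → HasCompactSupport ψ → ∀ t ∈ Ioc 0 T,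
      rlIntegral (1 - ρ) (pairing ψ w) t =
        -(Real.Gamma (1 - ρ) • rlIntegral 1 (pairing (diffOpT A ψ) w) t))
    {χ : RN N → ℂ} (hχ : Continuous χ) (hχc : HasCompactSupport χ) {t : ℝ} (ht : t ∈ Ioc 0 T) :
    ∫ s in (0 : ℝ)..t, pairing (𝓕⁻ χ) w s = 0 := by
  set a : RN N → ℂ := fun v => ((symbol A ((2 * Real.pi) • v) : ℝ) : ℂ) with ha
  have hac : Continuous a := Complex.continuous_ofReal.comp (continuous_symbol_two_pi A)
  have hΓ : Real.Gamma (1 - ρ) ≠ 0 := (Real.Gamma_pos_of_pos (by linarith)).ne'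
  have hmem : ∀ χ : RN N → ℂ, Continuous χ → HasCompactSupport χ → MemLp (𝓕⁻ χ) 2 volume :=
    fun χ h1 h2 => memLp_wordDeriv_fourierInv h1 h2 []
  have hint : ∀ χ : RN N → ℂ, Continuous χ → HasCompactSupport χ → ∀ α t : ℝ, 0 < α →
      IntervalIntegrable (fun s => ((t - s) ^ (α - 1)) • pairing (𝓕⁻ χ) w s) volume 0 t :=
    fun χ h1 h2 α t hα => hw.intervalIntegrable_pairing (hmem χ h1 h2) hα t
  -- Applying I^ρ to the weak equation gives I^1 y_χ = -I^ρ I^1 y_{aχ}, where y_χ is the pairing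
  -- with the inverse transform of χ. Such a function is not compactly supported in x, hence the
  -- passage through cutoffs.
  have hstep : ∀ χ : RN N → ℂ, Continuous χ → HasCompactSupport χ → ∀ t ∈ Ioc 0 T,
      fracIntegral 1 (pairing (𝓕⁻ χ) w) t =
        fracIntegral ρ (fun s => (-1 : ℝ) * fracIntegral 1 (pairing (𝓕⁻ (a * χ)) w) s) t := by
    intro χ h1 h2 t ht
    have e1 := fracIntegral_fracIntegral (α := ρ) (β := 1 - ρ) hρ (by linarith) ht.1
      (hint χ h1 h2 _ t (by linarith)) (hw.aestronglyMeasurable_pairing (hmem χ h1 h2) _)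
    rw [add_sub_cancel] at e1
    rw [← e1]
    refine fracIntegral_congr ht.1.le fun s hs => ?_
    have e2 := rlIntegral_pairing_eq_of_test (A := A) hw (α := 1 - ρ) (β := 1)
      (c := -Real.Gamma (1 - ρ)) (by linarith) one_pos hs.1.le
      (fun ψ hψ hψc => by rw [h ψ hψ hψc s ⟨hs.1, hs.2.trans ht.2⟩, neg_smul])
      (contDiff_fourierInv_top h1 h2) (memLp_wordDeriv_fourierInv h1 h2)
    rw [fracIntegral, e2, diffOpT_fourierInv hA h1 h2, smul_smul, fracIntegral, Real.Gamma_one,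
      inv_one, one_smul, mul_neg, inv_mul_cancel₀ hΓ, neg_smul, one_smul]
    simp only [Complex.ofReal_neg, Complex.ofReal_one, neg_mul, one_mul]
    rfl
  have hiter : ∀ n : ℕ, ∀ χ : RN N → ℂ, Continuous χ → HasCompactSupport χ → ∀ t ∈ Ioc 0 T,
      fracIntegral 1 (pairing (𝓕⁻ χ) w) t =
        ((-1 : ℝ) ^ n : ℝ) * fracIntegral (ρ * n + 1) (pairing (𝓕⁻ (a ^ n * χ)) w) t := by
    intro n
    induction n with
    | zero => intro χ _ _ t _; simp
    | succ n ih =>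
      intro χ h1 h2 t ht
      have h1' : Continuous (a * χ) := hac.mul h1
      have h2' : HasCompactSupport (a * χ) := h2.mul_left
      have h1'' : Continuous (a ^ n * (a * χ)) := (hac.pow n).mul h1'
      have h2'' : HasCompactSupport (a ^ n * (a * χ)) := h2'.mul_left
      rw [hstep χ h1 h2 t ht, fracIntegral_congr ht.1.le fun s hs => by
        rw [ih (a * χ) h1' h2' s ⟨hs.1, hs.2.trans ht.2⟩]]
      rw [fracIntegral_const_mul, fracIntegral_const_mul, fracIntegral_fracIntegral hρ
        (by positivity) ht.1 (hint _ h1'' h2'' _ t (by positivity))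
        (hw.aestronglyMeasurable_pairing (hmem _ h1'' h2'') _), pow_succ, pow_succ, mul_assoc (a ^ n)]
      push_cast
      rw [show ρ + (ρ * n + 1) = ρ * (n + 1) + 1 by ring]
      ring
  -- The compact support of χ makes A(D) act as a bounded operator here, so n iterations cost at
  -- most |Λ|^n.
  obtain ⟨Λ, hΛ⟩ : ∃ Λ : ℝ, ∀ v ∈ tsupport χ, ‖a v‖ ≤ Λ :=
    hχc.isCompact.exists_bound_of_continuousOn hac.continuousOn
  have hχ2 := memLp_of_test hχ hχc
  have hpow : ∀ n : ℕ, (eLpNorm (𝓕⁻ (a ^ n * χ)) 2 volume).toReal ≤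
      |Λ| ^ n * (eLpNorm χ 2 volume).toReal := by
    intro n
    have h1'' : Continuous (a ^ n * χ) := (hac.pow n).mul hχ
    have h2'' : HasCompactSupport (a ^ n * χ) := hχc.mul_left
    rw [eLpNorm_fourierInv (h1''.integrable_of_hasCompactSupport h2'') (memLp_of_test h1'' h2''),
      ← ENNReal.toReal_ofReal (pow_nonneg (abs_nonneg Λ) n), ← ENNReal.toReal_mul]
    refine ENNReal.toReal_mono (ENNReal.mul_ne_top ENNReal.ofReal_ne_top hχ2.eLpNorm_ne_top)
      (eLpNorm_le_mul_eLpNorm_of_ae_le_mul (ae_of_all _ fun v => ?_) 2)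
    by_cases hv : v ∈ tsupport χ
    · rw [Pi.mul_apply, Pi.pow_apply, norm_mul, norm_pow]
      gcongr
      exact (hΛ v hv).trans (le_abs_self _)
    · simp [image_eq_zero_of_notMem_tsupport hv]
  have hbound : ∀ n : ℕ, ‖fracIntegral 1 (pairing (𝓕⁻ χ) w) t‖ ≤
      |(Real.Gamma (ρ * n + 2))⁻¹| * (|Λ| * t ^ ρ) ^ n *
        (t * ((eLpNorm χ 2 volume).toReal * max K 0)) := by
    intro n
    have h1'' : Continuous (a ^ n * χ) := (hac.pow n).mul hχ
    have h2'' : HasCompactSupport (a ^ n * χ) := hχc.mul_left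
    rw [hiter n χ hχ hχc t ht, norm_mul, Complex.norm_real, norm_pow, norm_neg, norm_one, one_pow,
      one_mul]
    have hΓ2 : 0 < Real.Gamma (ρ * n + 2) := Real.Gamma_pos_of_pos (by positivity)
    refine (norm_fracIntegral_le (by positivity) ht.1.le
      (hw.norm_pairing_le (hmem _ h1'' h2''))).trans ?_
    rw [abs_of_pos (inv_pos.2 hΓ2), show ρ * n + 1 + 1 = ρ * n + 2 by ring, Real.rpow_add ht.1,
      Real.rpow_one, Real.rpow_mul ht.1.le, Real.rpow_natCast, mul_pow]
    calc _ ≤ (Real.Gamma (ρ * n + 2))⁻¹ * ((t ^ ρ) ^ n * t) *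
          (|Λ| ^ n * (eLpNorm χ 2 volume).toReal * max K 0) := by
          have := ht.1
          gcongr
          exact hpow n
      _ = _ := by ring
  have hlim : Tendsto (fun n : ℕ => |(Real.Gamma (ρ * n + 2))⁻¹| * (|Λ| * t ^ ρ) ^ n *
        (t * ((eLpNorm χ 2 volume).toReal * max K 0))) atTop (𝓝 0) := by
    have := (summable_mittagLeffler hρ two_pos (|Λ| * t ^ ρ)
      (by have := ht.1; positivity)).tendsto_atTop_zero
    simpa using this.mul_const (t * ((eLpNorm χ 2 volume).toReal * max K 0))
  have h0 := ge_of_tendsto' hlim hbound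
  have h1 := norm_le_zero_iff.1 h0
  rwa [fracIntegral, Real.Gamma_one, inv_one, one_smul, rlIntegral_one] at h1

/-- The forward problem has at most one solution. -/
theorem forward_solution_unique (hA : IsEllipticSymbol A l) (hρ : 0 < ρ) (hρ' : ρ < 1)
    (hT : 0 < T) (hφ : Continuous φ) (hφ2 : MemLp φ 2 volume) {u v : RN N → ℝ → ℂ}
    (hu : IsClassicalSolution A l T ρ φ u) (hur : IsRegular l T u)
    (hv : IsClassicalSolution A l T ρ φ v) (hvr : IsRegular l T v) (x : RN N) {t : ℝ}
    (ht : t ∈ Icc 0 T) : u x t = v x t := by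
  obtain ⟨K, hK⟩ := isL2Curve_frozenSub hT hφ hφ2 hu hur hv hvr
  have hcont : ∀ x, Continuous (frozenSub hT u v x) := fun x =>
    (continuous_frozen hT hu x).sub (continuous_frozen hT hv x)
  -- The time integral is orthogonal to every inverse transform of a test function. The null set
  -- depends on t; restricting to rational times gives a common one, and continuity in t then
  -- recovers all times.
  have hzero : ∀ t ∈ Ioc 0 T, ∀ᵐ x, ∫ s in (0 : ℝ)..t, frozenSub hT u v x s = 0 := by
    intro t ht
    refine ae_eq_zero_of_integral_fourierInv_eq_zero (hK.memLp_integral ht.1.le) fun χ hχ => ?_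
    rw [SchwartzMap.fourierInv_coe]
    have h1 := hK.integral_mul_integral (ψ := 𝓕⁻ (χ : RN N → ℂ))
      (memLp_wordDeriv_fourierInv χ.continuous hχ []) ht.1.le
      (intervalIntegrable_const (c := (1 : ℝ)))
    simp only [one_smul] at h1
    rw [h1.2]
    exact integral_pairing_fourierInv_eq_zero hA hρ hρ' hK
      (fun ψ h1 h2 t ht => weak_identity_frozenSub hA hρ hρ' hT hφ hφ2 hu hur hv hvr h1 h2 ht)
      χ.continuous hχ ht
  have hall : ∀ᵐ x, ∀ q : ℚ, (q : ℝ) ∈ Ioc 0 T →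
      ∫ s in (0 : ℝ)..q, frozenSub hT u v x s = 0 := by
    rw [ae_all_iff]
    intro q
    by_cases hq : (q : ℝ) ∈ Ioc 0 T
    · filter_upwards [hzero q hq] with x hx _ using hx
    · exact ae_of_all _ fun x h => absurd h hq
  have hae : ∀ᵐ x, ∀ t ∈ Icc 0 T, u x t = v x t := by
    filter_upwards [hall] with x hx
    have hprim : ∀ t, HasDerivAt (fun t => ∫ s in (0 : ℝ)..t, frozenSub hT u v x s)
        (frozenSub hT u v x t) t := fun t =>
      intervalIntegral.integral_hasDerivAt_right ((hcont x).intervalIntegrable _ _)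
        (hcont x).aestronglyMeasurable.stronglyMeasurableAtFilter (hcont x).continuousAt
    have hpc : Continuous fun t => ∫ s in (0 : ℝ)..t, frozenSub hT u v x s :=
      continuous_iff_continuousAt.2 fun t => (hprim t).continuousAt
    have h1 : ∀ t ∈ Ioo 0 T, ∫ s in (0 : ℝ)..t, frozenSub hT u v x s = 0 := by
      intro t ht
      have hcl : IsClosed {t : ℝ | ∫ s in (0 : ℝ)..t, frozenSub hT u v x s = 0} :=
        isClosed_eq hpc continuous_const
      refine hcl.closure_subset_iff.2 ?_
        (Rat.denseRange_cast (𝕜 := ℝ) |>.open_subset_closure_inter isOpen_Ioo ht)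
      rintro _ ⟨hq, q, rfl⟩
      exact hx q (Ioo_subset_Ioc_self hq)
    -- The primitive vanishes identically on the open interval, hence so does its derivative; the
    -- endpoints follow by continuity.
    have h2 : ∀ t ∈ Ioo 0 T, frozenSub hT u v x t = 0 := by
      intro t ht
      refine (hprim t).unique ((hasDerivAt_const t (0 : ℂ)).congr_of_eventuallyEq ?_)
      filter_upwards [Ioo_mem_nhds ht.1 ht.2] with s hs using h1 s hs
    intro t ht
    have hcl : IsClosed {t : ℝ | frozenSub hT u v x t = 0} := isClosed_eq (hcont x) continuous_const
    have h3 : frozenSub hT u v x t = 0 :=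
      hcl.closure_subset_iff.2 h2 (by rwa [closure_Ioo hT.ne])
    rw [frozenSub, frozen_of_mem hT u x ht, frozen_of_mem hT v x ht] at h3
    exact sub_eq_zero.1 h3
  rcases ht.1.eq_or_lt with rfl | h0
  · rw [hu.initial, hv.initial]
  · have h1 : (fun x => u x t) =ᵐ[volume] fun x => v x t := by
      filter_upwards [hae] with x hx using hx t ht
    exact congrFun ((Continuous.ae_eq_iff_eq volume (hu.contDiff t ⟨h0, ht.2⟩).continuous
      (hv.contDiff t ⟨h0, ht.2⟩).continuous).1 h1) x

end

/-! ### The inverse problem -/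

lemma fourierL2_congr {N : ℕ} {f g : RN N → ℂ} (h : f = g) (hf : MemLp f 2 volume)
    (hg : MemLp g 2 volume) : fourierL2 f hf = fourierL2 g hg := by
  subst h
  rfl

section
variable {N l : ℕ} {A : MvPolynomial (Fin N) ℝ} {τ T ρ t : ℝ} {φ : RN N → ℂ}

/-- The transform of the solution at time `t` has the value `E_ρ(-A(ξ) t^ρ) φ̂(ξ)` at every Lebesgue
point `ξ` of `φ̂`. -/
lemma hasValueAt_fourierL2_solution (hρ : 0 < ρ) (hφ : MemLp φ 2 volume) {ξ : RN N} {c : ℂ}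
    (hc : HasValueAt (fourierL2 φ hφ) ξ c) {f : RN N → ℂ} (hf : MemLp f 2 volume)
    (h : fourierL2 f hf =ᵐ[volume]
      fun ξ => ((mlTime ρ (symbol A ξ) t : ℝ) : ℂ) * fourierL2 φ hφ ξ) :
    HasValueAt (fourierL2 f hf) ξ (((mlTime ρ (symbol A ξ) t : ℝ) : ℂ) * c) :=
  (hc.continuous_mul (locallyIntegrable_fourierL2 hφ)
    (continuous_mlTime_comp hρ (continuous_symbol A) t)).congr_ae h.symm

/-- The datum of the inverse problem determines the value `E_ρ(-A(ξ₀) t₀^ρ)`. -/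
lemma IsInverseSolution.datum_eq (hA : IsEllipticSymbol A l) (hτ : (N : ℝ) / 2 < τ)
    (hφc : Continuous φ) (hφs : MemSobolevL2 τ φ) (hφ : MemLp φ 2 volume) {ξ₀ : RN N} {c : ℂ}
    (hc : HasValueAt (fourierL2 φ hφ) ξ₀ c) {ρ₀ t₀ d₀ : ℝ} (hρ₀ : 0 < ρ₀) (ht₀ : t₀ ∈ Ioc 0 T)
    {u : RN N → ℝ → ℂ} (hu : IsInverseSolution A l T ρ₀ φ ξ₀ t₀ d₀ u ρ) :
    |mlTime ρ (symbol A ξ₀) t₀| * ‖c‖ = d₀ := by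
  have hρ := hρ₀.trans_le hu.order_mem.1
  have hT := ht₀.1.trans_le ht₀.2
  obtain ⟨v, hv, hvr, hvf⟩ := exists_forward_solution hA hτ hφc hφs hφ hρ hu.order_mem.2 T
  obtain ⟨hv2, hvf⟩ := hvf t₀ ht₀.1.le
  obtain ⟨hu2, z, hz, rfl⟩ := hu.datum
  have heq : (fun x => u x t₀) = fun x => v x t₀ := funext fun x =>
    forward_solution_unique hA hρ hu.order_mem.2 hT hφc hφ hu.classical hu.regular hv hvr x
      (Ioc_subset_Icc_self ht₀)
  have hval := hasValueAt_fourierL2_solution hρ hφ hc hv2 hvf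
  rw [← fourierL2_congr heq hu2] at hval
  rw [(HasValueAt.unique (locallyIntegrable_fourierL2 hu2) hz hval), norm_mul, Complex.norm_real,
    Real.norm_eq_abs]

lemma exists_isInverseSolution (hA : IsEllipticSymbol A l) (hτ : (N : ℝ) / 2 < τ)
    (hφc : Continuous φ) (hφs : MemSobolevL2 τ φ) (hφ : MemLp φ 2 volume) {ξ₀ : RN N} {c : ℂ}
    (hc : HasValueAt (fourierL2 φ hφ) ξ₀ c) {ρ₀ t₀ d₀ : ℝ} (hρ₀ : 0 < ρ₀) (ht₀ : 0 ≤ t₀)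
    (hρ : ρ ∈ Ico ρ₀ 1) (hd : |mlTime ρ (symbol A ξ₀) t₀| * ‖c‖ = d₀) (T : ℝ) :
    ∃ u, IsInverseSolution A l T ρ₀ φ ξ₀ t₀ d₀ u ρ := by
  obtain ⟨v, hv, hvr, hvf⟩ :=
    exists_forward_solution hA hτ hφc hφs hφ (hρ₀.trans_le hρ.1) hρ.2 T
  obtain ⟨hv2, hvf⟩ := hvf t₀ ht₀
  refine ⟨v, hρ, hv, hvr, hv2, _,
    hasValueAt_fourierL2_solution (hρ₀.trans_le hρ.1) hφ hc hv2 hvf, ?_⟩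
  rw [norm_mul, Complex.norm_real, Real.norm_eq_abs, hd]

end

end Subdiffusion

end

/-- The number `T₀` depends only on `λ₀ = A(ξ₀)` and `ρ₀`; the lower bound is the value
`E_1(-λ₀ t₀)` of the Mittag-Leffler function at `ρ = 1`. -/
theorem theorem1p3 (lam₀ ρ₀ : ℝ) (hlam₀ : 0 < lam₀) (hρ₀ : ρ₀ ∈ Set.Ioo (0 : ℝ) 1) :
    ∃ T₀ : ℝ, 0 < T₀ ∧
      ∀ (N l : ℕ) (A : MvPolynomial (Fin N) ℝ), IsEllipticSymbol A l →
      ∀ (τ : ℝ), (N : ℝ) / 2 < τ →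
      ∀ (φ : RN N → ℂ), Continuous φ → MemSobolevL2 τ φ →
      ∀ (hφ : MeasureTheory.MemLp φ 2 MeasureTheory.volume) (ξ₀ : RN N) (c : ℂ),
        ξ₀ ≠ 0 → symbol A ξ₀ = lam₀ → HasValueAt (fourierL2 φ hφ) ξ₀ c → c ≠ 0 →
      ∀ (T t₀ d₀ : ℝ), T₀ ≤ t₀ → t₀ ≤ T →
        (HasUniqueInverseSolution A l T ρ₀ φ ξ₀ t₀ d₀ ↔
          Real.exp (-(lam₀ * t₀)) < d₀ / ‖c‖ ∧
            d₀ / ‖c‖ ≤ mittagLeffler ρ₀ (-(lam₀ * t₀ ^ ρ₀))) := by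
  obtain ⟨T₀, hT₀, hmono⟩ := exists_strictAntiOn_mittagLeffler hlam₀ hρ₀.1 hρ₀.2
  refine ⟨T₀, by linarith, fun N l A hA τ hτ φ hφc hφs hφ ξ₀ c _ hξ₀ hc hc0 T t₀ d₀ ht₀ htT => ?_⟩
  obtain ⟨hcont, hanti⟩ := hmono t₀ ht₀
  have ht₀' : t₀ ∈ Ioc 0 T := ⟨by linarith, htT⟩
  have hT : 0 < T := ht₀'.1.trans_le htT
  have hcpos : 0 < ‖c‖ := norm_pos_iff.2 hc0
  have hone : mittagLeffler 1 (-(lam₀ * t₀ ^ (1 : ℝ))) = Real.exp (-(lam₀ * t₀)) := by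
    rw [mittagLeffler_one, Real.rpow_one]
  -- Positivity comes from monotonicity in ρ: the value exceeds the exponential reached at ρ = 1.
  have hpos : ∀ ρ ∈ Ico ρ₀ 1, 0 < mittagLeffler ρ (-(lam₀ * t₀ ^ ρ)) := fun ρ hρ => by
    have := hanti ⟨hρ.1, hρ.2.le⟩ ⟨hρ₀.2.le, le_rfl⟩ hρ.2
    simp only [hone] at this
    exact (Real.exp_pos _).trans this
  have hdatum : ∀ u ρ, IsInverseSolution A l T ρ₀ φ ξ₀ t₀ d₀ u ρ →
      mittagLeffler ρ (-(lam₀ * t₀ ^ ρ)) = d₀ / ‖c‖ := fun u ρ hu => by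
    have h := hu.datum_eq hA hτ hφc hφs hφ hc hρ₀.1 ht₀'
    rw [mlTime, hξ₀, abs_of_pos (hpos ρ hu.order_mem)] at h
    rw [← h, mul_div_cancel_right₀ _ hcpos.ne']
  constructor
  · rintro ⟨⟨u, ρ, hu⟩, -⟩
    have hρ := hu.order_mem
    rw [← hdatum u ρ hu]
    refine ⟨?_, hanti.antitoneOn ⟨le_rfl, hρ₀.2.le⟩ ⟨hρ.1, hρ.2.le⟩ hρ.1⟩
    rw [← hone]
    exact hanti ⟨hρ.1, hρ.2.le⟩ ⟨hρ₀.2.le, le_rfl⟩ hρ.2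
  · rintro ⟨h1, h2⟩
    constructor
    · rw [← hone] at h1
      -- The strict lower and non-strict upper inequality correspond to excluding ρ = 1 and
      -- including ρ₀.
      obtain ⟨ρ, hρ, hval⟩ := intermediate_value_Ico' hρ₀.2.le hcont ⟨h1, h2⟩
      have hd : |mlTime ρ (symbol A ξ₀) t₀| * ‖c‖ = d₀ := by
        rw [mlTime, hξ₀, abs_of_pos (hpos ρ hρ)]
        dsimp only at hval
        rw [hval, div_mul_cancel₀ _ hcpos.ne']
      obtain ⟨u, hu⟩ := exists_isInverseSolution hA hτ hφc hφs hφ hc hρ₀.1 ht₀'.1.le hρ hd T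
      exact ⟨u, ρ, hu⟩
    · intro u₁ ρ₁ u₂ ρ₂ hu₁ hu₂
      have hρ : ρ₁ = ρ₂ := hanti.injOn ⟨hu₁.order_mem.1, hu₁.order_mem.2.le⟩
        ⟨hu₂.order_mem.1, hu₂.order_mem.2.le⟩
        ((hdatum u₁ ρ₁ hu₁).trans (hdatum u₂ ρ₂ hu₂).symm)
      subst hρ
      exact ⟨rfl, fun x t ht => forward_solution_unique hA (hρ₀.1.trans_le hu₁.order_mem.1)
        hu₁.order_mem.2 hT hφc hφ hu₁.classical hu₁.regular hu₂.classical hu₂.regular x ht⟩
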